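/- **Setting.** Fix integers $n,N\ge 1$ and numbers $A,d>0$. For $1<a<b$ let $\Omega=(-A,A)^n\times(a,b)$, with points $\mathbf x=(x_1,\dots,x_n,y)$. For $\alpha\in[-d,d]$ put $\mathbf x_\alpha=(\alpha,0,\dots,0)$ and $\nu(\mathbf x,\alpha)=(\mathbf x-\mathbf x_\alpha)/|\mathbf x-\mathbf x_\alpha|$. Let $\mu_s\in C^2(\mathbb R^{n+1})$, $\mu_s\ge 0$, $\mu_s=0$ outside $\Omega$, and let $K\in C^2(\overline\Omega\times[-d,d]^2)$, $K\ge 0$. Let $\{\Psi_s\}_{s\ge 0}$ be the orthonormal basis of $L_2(-d,d)$ obtained from $\{\alpha^s e^\alpha\}_{s\ge0}$ by Gram–Schmidt. For $0\le k,s\le N-1$, $1\le i\le n$, $W=(w_0,\dots,w_{N-1})^T\in\mathbb R^N$ and $w(\alpha)=\sum_{s=0}^{N-1} w_s\Psi_s(\alpha)$, set $$(D_N(\mathbf x))_{ks}=\int_{-d}^d\Big(\Psi_s'+\frac{\partial_\alpha\nu_{n+1}}{\nu_{n+1}}\Psi_s\Big)\Psi_k\,d\alpha,\qquad (A_i(\mathbf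 x))_{ks}=\int_{-d}^d\Big(\frac{\nu_i}{\nu_{n+1}}\Psi_s'+\frac{\partial_\alpha\nu_i}{\nu_{n+1}}\Psi_s\Big)\Psi_k\,d\alpha,$$ $$F(W,\mathbf x)_k=-\int_{-d}^d\frac{\mu_s(\mathbf x)}{\nu_{n+1}(\mathbf x,\alpha)}\,\partial_\alpha\Big[e^{-w(\alpha)}\int_{-d}^dK(\mathbf x,\alpha,\beta)e^{w(\beta)}d\beta\Big]\Psi_k(\alpha)\,d\alpha .$$ Let $m>1$ be an integer and $h=2A/m$, with $h\ge h_0>0$. Let $\Omega_1^h$ be the uniform grid with step $h$ in $[-A,A]^n$ (boundary nodes included) and $\Omega^h=\Omega_1^h\times(a,b)$. Its boundary $\partial\Omega^h$ consists of all the nodes at $y=a$ and at $y=b$, and of the boundary nodes of the grid for all $y\in(a,b)$. For $Q:\Omega_1^h\times[a,b]\to\mathbb R^N$ let $Q_{x_k}$ be the central difference quotient (step $2h$) in $x_k$ at interior nodes, and, all sums being over the interior nodes $p$, $$\|Q\|_{L^{2,h}_N}^2=\sum_p\int_a^b|Q|^2dy,\qquad \|Q\|_{H^{1,h}_N}^2=\sum_p\sum_{k=1}^n\int_a^b\big(|Q|^2+|Q_{x_k}|^2+|Q_y|^2\big)dy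 .$$ $H^{1,h}_N$ is the space of the $Q$ that lie in $H^1(a,b)$ (as continuous functions on $[a,b]$) over each interior node and have $Q_{x_k}\in L_2(a,b)$; $H^{1,h}_{N,0}$ is the subspace of the $Q$ that vanish on $\partial\Omega^h$. For $R>0$ and a function $P^h$ on $\partial\Omega^h$ let $$\overline{B(R,P^h)}=\{W\in H_N^{1,h}:\ W=P^h\text{ on }\partial\Omega^h,\ \|W\|_{H_N^{1,h}}\le R\},$$ $$J_\lambda(W)=\Big\|\Big(D_NW_y+\sum_{i=1}^nA_iW_{x_i}+F(W,\cdot)\Big)e^{\lambda y}\Big\|_{L_N^{2,h}}^2 .$$ Let $\kappa$ be an upper bound for $\|K\|_{C^1(\overline\Omega\times[-d,d]^2)}$ and $\sigma$ an upper bound for $\max\mu_s$. **Theorem 4.2.** There are numbers $a_0=a_0(A,d,N)>1$ such that, for all $b>a\ge a_0$, $D_N(\mathbf x)$ is invertible for all $\mathbf x\in\overline\Omega$. Moreover: 1. Let $1<a<b$. For every $\lambda\ge 0$ and $W\in\overline{B(R,P^h)}$ the functional $J_\lambda$ has a Fréchet derivative at $W$ in the directions of $H^{1,h}_{N,0}$,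 represented through the scalar product by an element $J'_\lambda(W)\in H^{1,h}_{N,0}$, and $$\|J'_\lambda(W_1)-J'_\lambda(W_2)\|_{H_N^{1,h}}\le C_4\|W_1-W_2\|_{H_N^{1,h}}\qquad\forall\, W_1,W_2\in\overline{B(R,P^h)},$$ where $C_4>0$ depends only on $n,N,A,d,a,b,h_0,\kappa,\sigma,R,\lambda$. Let now $a_0$ be any such number, and let $b>a\ge a_0$. 2. There are $C_3>0$, depending only on $n,N,A,d,a,b,h_0,\kappa$, and $\lambda_1\ge1$, depending only on the same parameters and on $R$ and $\sigma$, such that for all $\lambda\ge\lambda_1$ and all $W_1,W_2\in\overline{B(R,P^h)}$ $$J_\lambda(W_2)-J_\lambda(W_1)-J_\lambda'(W_1)(W_2-W_1)\ \ge\ C_3e^{2\lambda a}\|W_2-W_1\|^2_{H_N^{1,h}} .$$ 3. For every $\lambda\ge\lambda_1$, if $\overline{B(R,P^h)}\neq\varnothing$, there is a unique minimizer $W_{\min,\lambda}$ of $J_\lambda$ on $\overline{B(R,P^h)}$, and $$J'_\lambda(W_{\min,\lambda})(W-W_{\min,\lambda})\ge0\qquad\forall\, W\in\overline{B(R,P^h)}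 .$$ -/

import Mathlib

open MeasureTheory Set

noncomputable section

namespace Convexification

/-! ### Geometry, medium, Fourier basis -/

/-- Points `(x, y)` of `ℝⁿ⁺¹`, with `x = (x₁, …, xₙ)`; the coordinate `x₁` is `x 0`. -/
abbrev Pt (n : ℕ) : Type := (Fin n → ℝ) × ℝ

/-- Values `W(x) ∈ ℝᴺ`, with the Euclidean norm. -/
abbrev Vec (N : ℕ) : Type := EuclideanSpace ℝ (Fin N)

/-- The open prism `Ω = (-A, A)ⁿ × (a, b)`. -/
def Omega (n : ℕ) (A a b : ℝ) : Set (Pt n) :=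
  {X | (∀ i, X.1 i ∈ Ioo (-A) A) ∧ X.2 ∈ Ioo a b}

/-- The closed prism `[-A, A]ⁿ × [a, b]`. -/
def OmegaBar (n : ℕ) (A a b : ℝ) : Set (Pt n) :=
  {X | (∀ i, X.1 i ∈ Icc (-A) A) ∧ X.2 ∈ Icc a b}

/-- The domain `Ω̄ × [-d, d]²` of the phase function. -/
def phaseDomain (n : ℕ) (A a b d : ℝ) : Set (Pt n × (ℝ × ℝ)) :=
  OmegaBar n A a b ×ˢ (Icc (-d) d ×ˢ Icc (-d) d)

/-- The standing assumptions on the phase function `K(x, α, β)` and the scattering coefficient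
`μ_s`, together with upper bounds `κ` for the `C¹` norm of `K` and `σ` for the maximum of `μ_s`. -/
structure IsMedium (n : ℕ) (A a b d κ σ : ℝ) (K : Pt n → ℝ → ℝ → ℝ) (μs : Pt n → ℝ) : Prop where
  K_nonneg : ∀ z ∈ phaseDomain n A a b d, 0 ≤ K z.1 z.2.1 z.2.2
  K_contDiffOn : ContDiffOn ℝ 2 (fun z : Pt n × (ℝ × ℝ) => K z.1 z.2.1 z.2.2)
    (phaseDomain n A a b d)
  K_le : ∀ z ∈ phaseDomain n A a b d, |K z.1 z.2.1 z.2.2| ≤ κ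
  K_deriv_le : ∀ z ∈ phaseDomain n A a b d,
    ‖fderivWithin ℝ (fun z : Pt n × (ℝ × ℝ) => K z.1 z.2.1 z.2.2) (phaseDomain n A a b d) z‖ ≤ κ
  μs_nonneg : ∀ X, 0 ≤ μs X
  μs_contDiff : ContDiff ℝ 2 μs
  μs_eq_zero : ∀ X, X ∉ Omega n A a b → μs X = 0
  μs_le : ∀ X, μs X ≤ σ

/-- The vector `x - (α, 0, …, 0)` of the first `n` coordinates of `𝐱 - 𝐱_α`; the last coordinate
of `𝐱 - 𝐱_α` is `y`. -/
def srcDiff {n : ℕ} [NeZero n] (X : Pt n) (α : ℝ) : Fin n → ℝ :=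
  Function.update X.1 0 (X.1 0 - α)

/-- The Euclidean distance `|𝐱 - 𝐱_α|`. -/
def srcDist {n : ℕ} [NeZero n] (X : Pt n) (α : ℝ) : ℝ :=
  Real.sqrt (∑ i, srcDiff X α i ^ 2 + X.2 ^ 2)

/-- The components `ν₁, …, νₙ` of the unit vector `ν(𝐱, α) = (𝐱 - 𝐱_α) / |𝐱 - 𝐱_α|`. -/
def nuX {n : ℕ} [NeZero n] (X : Pt n) (i : Fin n) (α : ℝ) : ℝ := srcDiff X α i / srcDist X α

/-- The last component `ν_{n+1}` of `ν(𝐱, α)`. -/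
def nuY {n : ℕ} [NeZero n] (X : Pt n) (α : ℝ) : ℝ := X.2 / srcDist X α

/-- The orthonormal basis `Ψ_s` of `L₂(-d, d)`: Gram-Schmidt orthonormalization of the functions
`α ↦ α ^ s * exp α`, `s = 0, 1, 2, …`. -/
def Psi (d : ℝ) (s : ℕ) : ℝ → ℝ :=
  let g : ℝ → ℝ := fun α => α ^ s * Real.exp α -
    ∑ k : Fin s, (∫ t in (-d)..d, t ^ s * Real.exp t * Psi d k.1 t) * Psi d k.1 α
  fun α => g α / Real.sqrt (∫ t in (-d)..d, g t ^ 2)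
termination_by s
decreasing_by all_goals exact k.2

/-! ### The first order system for the Fourier coefficients

The truncated series `w = ∑ₛ wₛ Ψₛ` is inserted in the equation for `w` (with the unknown
coefficient eliminated by `∂_α`), and the result is multiplied by `Ψ_k` and integrated over
`(-d, d)`. Row `k` of the matrices below belongs to `Ψ_k`, column `s` to the unknown `wₛ`. -/

/-- The matrix of the term `∂_y w_α`. -/
def matM (N : ℕ) (d : ℝ) : Matrix (Fin N) (Fin N) ℝ :=
  Matrix.of fun k s => ∫ α in (-d)..d, deriv (Psi d s) α * Psi d k α

/-- The matrix `A_{n+1}` of the term `(∂_α ν_{n+1} / ν_{n+1}) w_y`. -/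
def matAy {n : ℕ} [NeZero n] (N : ℕ) (d : ℝ) (X : Pt n) : Matrix (Fin N) (Fin N) ℝ :=
  Matrix.of fun k s => ∫ α in (-d)..d,
    deriv (nuY X) α / nuY X α * Psi d s α * Psi d k α

/-- The matrix `D_N = M_N + A_{n+1}`. -/
def matD {n : ℕ} [NeZero n] (N : ℕ) (d : ℝ) (X : Pt n) : Matrix (Fin N) (Fin N) ℝ :=
  matM N d + matAy N d X

/-- The matrix `A_i` of the terms `(ν_i / ν_{n+1}) ∂_α w_{x_i} + (∂_α ν_i / ν_{n+1}) w_{x_i}`. -/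
def matA {n : ℕ} [NeZero n] (N : ℕ) (d : ℝ) (i : Fin n) (X : Pt n) : Matrix (Fin N) (Fin N) ℝ :=
  Matrix.of fun k s => ∫ α in (-d)..d,
    (nuX X i α / nuY X α * deriv (Psi d s) α + deriv (nuX X i) α / nuY X α * Psi d s α) * Psi d k α

/-- The truncated Fourier series `α ↦ ∑ₛ Wₛ Ψₛ(α)`. -/
def series {N : ℕ} (d : ℝ) (W : Vec N) (α : ℝ) : ℝ := ∑ s : Fin N, W s * Psi d s α

/-- The nonlinear term `F(W, 𝐱) ∈ ℝᴺ` of the system: the projections on `Ψ_k` of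
`-(μ_s / ν_{n+1}) ∂_α [exp (-w(α)) ∫ K(𝐱, α, β) exp (w(β)) dβ]` with `w = ∑ₛ Wₛ Ψₛ`. -/
def nonlin {n N : ℕ} [NeZero n] (d : ℝ) (K : Pt n → ℝ → ℝ → ℝ) (μs : Pt n → ℝ)
    (W : Vec N) (X : Pt n) : Vec N :=
  WithLp.toLp 2 fun k => ∫ α in (-d)..d,
    -(μs X / nuY X α) *
      deriv (fun α' => Real.exp (-series d W α') *
        ∫ β in (-d)..d, K X α' β * Real.exp (series d W β)) α * Psi d k α

/-- `a₀ > 1` is such that `D_N(𝐱)` is invertible for all `𝐱 ∈ Ω̄` as soon as `a ≥ a₀`. -/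
def IsFar (n : ℕ) [NeZero n] (N : ℕ) (A d a₀ : ℝ) : Prop :=
  1 < a₀ ∧ ∀ a b : ℝ, a₀ ≤ a → a < b → ∀ X ∈ OmegaBar n A a b, IsUnit (matD N d X)

/-! ### The grid and the semi-discrete spaces -/

/-- Indices `(j₁, …, jₙ)`, `0 ≤ jᵢ ≤ m`, of the nodes of the grid in `[-A, A]ⁿ`. -/
abbrev Node (n m : ℕ) : Type := Fin n → Fin (m + 1)

/-- The grid step size `h = 2A / m`. -/
def meshStep (A : ℝ) (m : ℕ) : ℝ := 2 * A / m

/-- The point of the semi-discrete domain over the node `p` at the height `y`. -/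
def gridPt {n m : ℕ} (A : ℝ) (p : Node n m) (y : ℝ) : Pt n :=
  (fun i => -A + (p i : ℕ) * meshStep A m, y)

/-- Interior nodes: `0 < jᵢ < m` for all `i`. -/
def intNodes (n m : ℕ) : Finset (Node n m) := Fintype.piFinset fun _ => Finset.Ioo 0 (Fin.last m)

/-- `ℝᴺ`-valued functions of a node and of `y`. -/
abbrev GridFn (n m N : ℕ) : Type := Node n m → ℝ → Vec N

/-- The central difference `∂_{x_k} Q` (used at interior nodes only, so that no index wraps). -/
def fd {n m N : ℕ} (A : ℝ) (k : Fin n) (Q : GridFn n m N) : GridFn n m N := fun p y =>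
  (1 / (2 * meshStep A m)) •
    (Q (Function.update p k (p k + 1)) y - Q (Function.update p k (p k - 1)) y)

/-- The square of the norm of `L_N^{2,h}`. -/
def l2NormSq {n m N : ℕ} (a b : ℝ) (Q : GridFn n m N) : ℝ :=
  ∑ p ∈ intNodes n m, ∫ y in Ioo a b, ‖Q p y‖ ^ 2

/-- The norm of `H_N^{1,h}`. -/
def h1Norm {n m N : ℕ} (A a b : ℝ) (Q : GridFn n m N) : ℝ :=
  Real.sqrt (∑ p ∈ intNodes n m, ∑ k : Fin n, ∫ y in Ioo a b,
    (‖Q p y‖ ^ 2 + ‖fd A k Q p y‖ ^ 2 + ‖deriv (Q p) y‖ ^ 2))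

/-- `u ∈ H¹(a, b)`, as a continuous function on `[a, b]`: the primitive of a function of
`L₂(a, b)` (which is then the derivative of `u` almost everywhere). -/
def IsH1 {N : ℕ} (a b : ℝ) (u : ℝ → Vec N) : Prop :=
  ∃ g : ℝ → Vec N, MemLp g 2 (volume.restrict (Ioo a b)) ∧
    ∀ y ∈ Icc a b, u y = u a + ∫ t in a..y, g t

theorem IsH1.add {N : ℕ} {a b : ℝ} {u v : ℝ → Vec N} (hu : IsH1 a b u) (hv : IsH1 a b v) :
    IsH1 a b (u + v) := by
  obtain ⟨g, hg, hgu⟩ := hu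
  obtain ⟨k, hk, hkv⟩ := hv
  refine ⟨g + k, hg.add hk, fun y hy => ?_⟩
  have key : ∀ f : ℝ → Vec N, MemLp f 2 (volume.restrict (Ioo a b)) →
      IntervalIntegrable f volume a y := by
    intro f hf
    rw [intervalIntegrable_iff_integrableOn_Ioo_of_le hy.1]
    have h : IntegrableOn f (Ioo a b) := hf.integrable (by norm_num)
    exact h.mono_set (Ioo_subset_Ioo_right hy.2)
  have := intervalIntegral.integral_add (key g hg) (key k hk)
  simp only [Pi.add_apply]
  rw [this, hgu y hy, hkv y hy]
  abel

theorem IsH1.smul {N : ℕ} {a b : ℝ} {u : ℝ → Vec N} (c : ℝ) (hu : IsH1 a b u) :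
    IsH1 a b (c • u) := by
  obtain ⟨g, hg, hgu⟩ := hu
  refine ⟨c • g, hg.const_smul c, fun y hy => ?_⟩
  simp only [Pi.smul_apply]
  rw [intervalIntegral.integral_smul, hgu y hy, smul_add]

theorem IsH1.ae_hasDerivAt {N : ℕ} {a b : ℝ} {u : ℝ → Vec N} (hu : IsH1 a b u) :
    ∃ g : ℝ → Vec N, MemLp g 2 (volume.restrict (Ioo a b)) ∧
      ∀ᵐ y ∂(volume.restrict (Ioo a b)), HasDerivAt u (g y) y := by
  obtain ⟨g, hg, hgu⟩ := hu
  refine ⟨g, hg, ?_⟩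
  rcases le_or_gt b a with hab | hab
  · simp [Ioo_eq_empty_of_le hab]
  have hi : IntervalIntegrable g volume a b := by
    rw [intervalIntegrable_iff_integrableOn_Ioo_of_le hab.le]
    exact hg.integrable (by norm_num)
  rw [ae_restrict_iff' measurableSet_Ioo]
  filter_upwards [hi.ae_hasDerivAt_integral] with y hy hyab
  have h1 := hy (by rw [uIcc_of_le hab.le]; exact Ioo_subset_Icc_self hyab) a left_mem_uIcc
  refine (h1.const_add (u a)).congr_of_eventuallyEq ?_
  filter_upwards [Ioo_mem_nhds hyab.1 hyab.2] with z hz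
  exact hgu z (Ioo_subset_Icc_self hz)

theorem IsH1.ae_differentiableAt {N : ℕ} {a b : ℝ} {u : ℝ → Vec N} (hu : IsH1 a b u) :
    ∀ᵐ y ∂(volume.restrict (Ioo a b)), DifferentiableAt ℝ u y := by
  obtain ⟨g, -, h⟩ := hu.ae_hasDerivAt
  filter_upwards [h] with y hy using hy.differentiableAt

theorem IsH1.memLp_deriv {N : ℕ} {a b : ℝ} {u : ℝ → Vec N} (hu : IsH1 a b u) :
    MemLp (deriv u) 2 (volume.restrict (Ioo a b)) := by
  obtain ⟨g, hg, h⟩ := hu.ae_hasDerivAt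
  refine (memLp_congr_ae ?_).2 hg
  filter_upwards [h] with y hy using hy.deriv

theorem IsH1.continuousOn {N : ℕ} {a b : ℝ} {u : ℝ → Vec N} (hu : IsH1 a b u) :
    ContinuousOn u (Icc a b) := by
  rcases le_or_gt b a with hab | hab
  · exact (Set.subsingleton_Icc_of_ge hab).continuousOn u
  obtain ⟨g, hg, hgu⟩ := hu
  have hi : IntegrableOn g (uIcc a b) := by
    rw [uIcc_of_le hab.le, integrableOn_Icc_iff_integrableOn_Ioo]
    exact hg.integrable (by norm_num)
  have := intervalIntegral.continuousOn_primitive_interval hi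
  rw [uIcc_of_le hab.le] at this
  exact (continuousOn_const.add this).congr hgu

theorem IsH1.memLp {N : ℕ} {a b : ℝ} {u : ℝ → Vec N} (hu : IsH1 a b u) :
    MemLp u 2 (volume.restrict (Ioo a b)) := by
  obtain ⟨C, hC⟩ := isCompact_Icc.exists_bound_of_continuousOn hu.continuousOn
  refine MemLp.of_bound
    ((hu.continuousOn.mono Ioo_subset_Icc_self).aestronglyMeasurable measurableSet_Ioo) C ?_
  rw [ae_restrict_iff' measurableSet_Ioo]
  exact Filter.Eventually.of_forall fun y hy => hC y (Ioo_subset_Icc_self hy)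

theorem fd_add {n m N : ℕ} (A : ℝ) (k : Fin n) (u v : GridFn n m N) (p : Node n m) :
    fd A k (u + v) p = fd A k u p + fd A k v p := by
  funext y
  simp only [fd, Pi.add_apply, ← smul_add]
  congr 1
  abel

theorem fd_smul {n m N : ℕ} (A : ℝ) (k : Fin n) (c : ℝ) (u : GridFn n m N) (p : Node n m) :
    fd A k (c • u) p = c • fd A k u p := by
  funext y
  simp only [fd, Pi.smul_apply, ← smul_sub]
  rw [smul_comm]

/-- The space `H_N^{1,h}(Ω^h)`. Its elements are functions of the nodes and of `y ∈ [a, b]`; to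
have one representative of each, they are extended by zero to `y ∉ [a, b]`. -/
def H1h (n m N : ℕ) (A a b : ℝ) : Submodule ℝ (GridFn n m N) where
  carrier := {W | (∀ p ∈ intNodes n m, IsH1 a b (W p)) ∧
    (∀ p ∈ intNodes n m, ∀ k, MemLp (fd A k W p) 2 (volume.restrict (Ioo a b))) ∧
    ∀ p, ∀ y ∉ Icc a b, W p y = 0}
  zero_mem' := by
    refine ⟨fun p _ => ⟨0, MemLp.zero, by simp⟩, fun p _ k => ?_, by simp⟩
    have : fd A k (0 : GridFn n m N) p = 0 := by funext y; simp [fd]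
    rw [this]
    exact MemLp.zero
  add_mem' := by
    rintro u v ⟨hu1, hu2, hu3⟩ ⟨hv1, hv2, hv3⟩
    refine ⟨fun p hp => (hu1 p hp).add (hv1 p hp), fun p hp k => ?_, fun p y hy => ?_⟩
    · rw [fd_add]
      exact (hu2 p hp k).add (hv2 p hp k)
    · simp [hu3 p y hy, hv3 p y hy]
  smul_mem' := by
    rintro c u ⟨hu1, hu2, hu3⟩
    refine ⟨fun p hp => (hu1 p hp).smul c, fun p hp k => ?_, fun p y hy => ?_⟩
    · rw [fd_smul]
      exact (hu2 p hp k).const_smul c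
    · simp [hu3 p y hy]

/-- `W = P` on `∂Ω^h`: at all nodes for `y = a` and `y = b`, and at the boundary nodes for all
`y ∈ [a, b]`. -/
def EqOnBdry {n m N : ℕ} (a b : ℝ) (W P : GridFn n m N) : Prop :=
  ∀ p, ∀ y ∈ Icc a b, (p ∉ intNodes n m ∨ y = a ∨ y = b) → W p y = P p y

/-- The subspace `H_{N,0}^{1,h}(Ω^h)` of the functions which vanish on `∂Ω^h`. -/
def H10sub (n m N : ℕ) (A a b : ℝ) : Submodule ℝ (GridFn n m N) where
  carrier := {v | v ∈ H1h n m N A a b ∧ EqOnBdry a b v 0}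
  zero_mem' := ⟨zero_mem _, fun _ _ _ _ => rfl⟩
  add_mem' := by
    rintro u v ⟨hu, hu0⟩ ⟨hv, hv0⟩
    refine ⟨add_mem hu hv, fun p y hy hp => ?_⟩
    simp [hu0 p y hy hp, hv0 p y hy hp]
  smul_mem' := by
    rintro c u ⟨hu, hu0⟩
    refine ⟨Submodule.smul_mem _ c hu, fun p y hy hp => ?_⟩
    simp [hu0 p y hy hp]

/-- The space `H_{N,0}^{1,h}(Ω^h)` as a type (which carries the norm of `H_N^{1,h}`). -/
def H10 (n m N : ℕ) (A a b : ℝ) : Type := H10sub n m N A a b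

namespace H10

variable {n m N : ℕ} {A a b : ℝ}

instance : AddCommGroup (H10 n m N A a b) := inferInstanceAs (AddCommGroup (H10sub n m N A a b))

instance : Module ℝ (H10 n m N A a b) := inferInstanceAs (Module ℝ (H10sub n m N A a b))

/-- The underlying function. -/
def fn (v : H10 n m N A a b) : GridFn n m N := v.1

theorem fn_add (u v : H10 n m N A a b) : (u + v).fn = u.fn + v.fn := rfl

theorem fn_smul (c : ℝ) (v : H10 n m N A a b) : (c • v).fn = c • v.fn := rfl

theorem isH1 (v : H10 n m N A a b) {p : Node n m} (hp : p ∈ intNodes n m) : IsH1 a b (v.fn p) :=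
  v.2.1.1 p hp

theorem memLp_fd (v : H10 n m N A a b) {p : Node n m} (hp : p ∈ intNodes n m) (k : Fin n) :
    MemLp (fd A k v.fn p) 2 (volume.restrict (Ioo a b)) :=
  v.2.1.2.1 p hp k

/-- The integrand of the scalar product. -/
def dens (u v : H10 n m N A a b) (p : Node n m) (k : Fin n) (y : ℝ) : ℝ :=
  inner ℝ (u.fn p y) (v.fn p y) + inner ℝ (fd A k u.fn p y) (fd A k v.fn p y) +
    inner ℝ (deriv (u.fn p) y) (deriv (v.fn p) y)

theorem integrable_inner_of_memLp {f g : ℝ → Vec N} (hf : MemLp f 2 (volume.restrict (Ioo a b)))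
    (hg : MemLp g 2 (volume.restrict (Ioo a b))) :
    IntegrableOn (fun y => (inner ℝ (f y) (g y) : ℝ)) (Ioo a b) := by
  have hf2 := (memLp_two_iff_integrable_sq_norm hf.1).1 hf
  have hg2 := (memLp_two_iff_integrable_sq_norm hg.1).1 hg
  refine (hf2.add hg2).mono' (hf.1.inner hg.1) (Filter.Eventually.of_forall fun y => ?_)
  have := norm_inner_le_norm (𝕜 := ℝ) (f y) (g y)
  simp only [Pi.add_apply]
  nlinarith [sq_nonneg (‖f y‖ - ‖g y‖), norm_nonneg (f y), norm_nonneg (g y)]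

theorem integrable_dens (u v : H10 n m N A a b) {p : Node n m} (hp : p ∈ intNodes n m)
    (k : Fin n) : IntegrableOn (dens u v p k) (Ioo a b) :=
  ((integrable_inner_of_memLp (u.isH1 hp).memLp (v.isH1 hp).memLp).add
    (integrable_inner_of_memLp (u.memLp_fd hp k) (v.memLp_fd hp k))).add
    (integrable_inner_of_memLp (u.isH1 hp).memLp_deriv (v.isH1 hp).memLp_deriv)

/-- The scalar product of `H_{N,0}^{1,h}`. -/
def ip (u v : H10 n m N A a b) : ℝ :=
  ∑ p ∈ intNodes n m, ∑ k : Fin n, ∫ y in Ioo a b, dens u v p k y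

theorem dens_self (v : H10 n m N A a b) (p : Node n m) (k : Fin n) (y : ℝ) :
    dens v v p k y = ‖v.fn p y‖ ^ 2 + ‖fd A k v.fn p y‖ ^ 2 + ‖deriv (v.fn p) y‖ ^ 2 := by
  simp only [dens, real_inner_self_eq_norm_sq]

theorem dens_self_nonneg (v : H10 n m N A a b) (p : Node n m) (k : Fin n) (y : ℝ) :
    0 ≤ dens v v p k y := by
  rw [dens_self]
  positivity

theorem eq_zero_of_ip_self [NeZero n] (v : H10 n m N A a b) (h : ip v v = 0) : v = 0 := by
  have hfun : v.fn = 0 := by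
    funext p y
    by_cases hy : y ∈ Icc a b
    swap
    · exact v.2.1.2.2 p y hy
    by_cases hp : p ∉ intNodes n m ∨ y = a ∨ y = b
    · exact v.2.2 p y hy hp
    push Not at hp
    obtain ⟨hp, hya, hyb⟩ := hp
    have hy' : y ∈ Ioo a b := ⟨lt_of_le_of_ne hy.1 (Ne.symm hya), lt_of_le_of_ne hy.2 hyb⟩
    have hnn : ∀ p k, 0 ≤ ∫ y in Ioo a b, dens v v p k y := fun p k =>
      integral_nonneg fun y => dens_self_nonneg v p k y
    have h1 := (Finset.sum_eq_zero_iff_of_nonneg fun p _ =>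
      Finset.sum_nonneg fun k _ => hnn p k).1 h p hp
    have h2 := (Finset.sum_eq_zero_iff_of_nonneg fun k _ => hnn p k).1 h1 0 (Finset.mem_univ _)
    have h3 := (integral_eq_zero_iff_of_nonneg (fun y => dens_self_nonneg v p 0 y)
      (integrable_dens v v hp 0)).1 h2
    have h4 : v.fn p =ᵐ[volume.restrict (Ioo a b)] fun _ => (0 : Vec N) := by
      filter_upwards [h3] with z hz
      rw [dens_self, Pi.zero_apply] at hz
      have : ‖v.fn p z‖ ^ 2 = 0 := by
        nlinarith [sq_nonneg ‖v.fn p z‖, sq_nonneg ‖fd A 0 v.fn p z‖,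
          sq_nonneg ‖deriv (v.fn p) z‖]
      simpa using this
    exact Measure.eqOn_open_of_ae_eq h4 isOpen_Ioo
      ((v.isH1 hp).continuousOn.mono Ioo_subset_Icc_self) continuousOn_const hy'
  exact Subtype.ext hfun

/-- The scalar product as a Mathlib inner product structure. -/
@[reducible] def core [NeZero n] : InnerProductSpace.Core ℝ (H10 n m N A a b) where
  inner := ip
  conj_inner_symm u v := by
    simp only [ip, dens, conj_trivial, real_inner_comm]
  re_inner_nonneg v := by
    simp only [RCLike.re_to_real]
    exact Finset.sum_nonneg fun p _ => Finset.sum_nonneg fun k _ =>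
      integral_nonneg fun y => dens_self_nonneg v p k y
  add_left u v w := by
    simp only [ip, ← Finset.sum_add_distrib]
    refine Finset.sum_congr rfl fun p hp => Finset.sum_congr rfl fun k _ => ?_
    rw [← integral_add (integrable_dens u w hp k) (integrable_dens v w hp k)]
    refine integral_congr_ae ?_
    filter_upwards [(u.isH1 hp).ae_differentiableAt, (v.isH1 hp).ae_differentiableAt] with y hu hv
    simp only [dens, fn_add, fd_add, Pi.add_apply, deriv_add hu hv, inner_add_left]
    ring
  smul_left u v r := by
    simp only [ip, Finset.mul_sum, conj_trivial]
    refine Finset.sum_congr rfl fun p hp => Finset.sum_congr rfl fun k _ => ?_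
    rw [← integral_const_mul]
    refine integral_congr_ae ?_
    filter_upwards [(u.isH1 hp).ae_differentiableAt] with y hu
    simp only [dens, fn_smul, fd_smul, Pi.smul_apply, deriv_const_smul r hu,
      real_inner_smul_left]
    ring
  definite := eq_zero_of_ip_self

instance [NeZero n] : NormedAddCommGroup (H10 n m N A a b) := core.toNormedAddCommGroup

instance [NeZero n] : InnerProductSpace ℝ (H10 n m N A a b) := InnerProductSpace.ofCore core.toCore

theorem norm_eq [NeZero n] (v : H10 n m N A a b) : ‖v‖ = h1Norm A a b v.fn := by
  rw [norm_eq_sqrt_real_inner]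
  change Real.sqrt (ip v v) = _
  simp only [ip, dens_self, h1Norm]

end H10

/-! ### The functional -/

/-- The left hand side `D_N W_y + ∑ᵢ A_i W_{x_i} + F(W, 𝐱)` of the semi-discrete system. -/
def residual {n m N : ℕ} [NeZero n] (A d : ℝ) (K : Pt n → ℝ → ℝ → ℝ) (μs : Pt n → ℝ)
    (W : GridFn n m N) : GridFn n m N := fun p y =>
  Matrix.toLpLin 2 2 (matD N d (gridPt A p y)) (deriv (W p) y) +
    ∑ i : Fin n, Matrix.toLpLin 2 2 (matA N d i (gridPt A p y)) (fd A i W p y) +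
    nonlin d K μs (W p y) (gridPt A p y)

/-- The weighted functional `J_λ(W)`, with the Carleman weight `exp (λ y)`. -/
def J {n m N : ℕ} [NeZero n] (A a b d : ℝ) (K : Pt n → ℝ → ℝ → ℝ) (μs : Pt n → ℝ) (lam : ℝ)
    (W : GridFn n m N) : ℝ :=
  l2NormSq a b fun p y => Real.exp (lam * y) • residual A d K μs W p y

/-- The Fréchet derivative of `J_λ` at `W`, as a functional on `H_{N,0}^{1,h}` (the space of
differences of functions with the same boundary values). -/
def dJ {n m N : ℕ} [NeZero n] (A a b d : ℝ) (K : Pt n → ℝ → ℝ → ℝ) (μs : Pt n → ℝ) (lam : ℝ)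
    (W : GridFn n m N) : H10 n m N A a b →L[ℝ] ℝ :=
  fderiv ℝ (fun v : H10 n m N A a b => J A a b d K μs lam (W + v.fn)) 0

/-- The closed ball: all `W ∈ H_N^{1,h}` with `W = P` on `∂Ω^h` and `‖W‖ ≤ R`. -/
def Bbar {n m N : ℕ} (A a b R : ℝ) (P : GridFn n m N) : Set (GridFn n m N) :=
  {W | W ∈ H1h n m N A a b ∧ EqOnBdry a b W P ∧ h1Norm A a b W ≤ R}

/-- The difference `W₂ - W₁` of two elements of the closed ball, an element of `H_{N,0}^{1,h}`. -/
def bdiff {n m N : ℕ} {A a b R : ℝ} {P W₁ W₂ : GridFn n m N} (h₂ : W₂ ∈ Bbar A a b R P)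
    (h₁ : W₁ ∈ Bbar A a b R P) : H10 n m N A a b :=
  ⟨W₂ - W₁, sub_mem h₂.1 h₁.1, fun p y hy hp => by
    simp [h₂.2.1 p y hy hp, h₁.2.1 p y hy hp]⟩

end Convexification

end

open Convexification

/-! Since the mesh step is bounded below, difference quotients in `x` are bounded operators on grid
functions. The residual is therefore an ordinary differential operator `D_N W_y` in `y` plus lower
order terms, and the weight `e^{λy}` makes these terms small. If `u(b) = 0`, then `e^{λy}|u(y)| ≤
∫_y^b e^{-λ(t-y)} e^{λt}|u'(t)| dt`, and Cauchy-Schwarz gives `e^{2λy}|u(y)|² ≤ (1/2λ) ∫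
e^{2λt}|u'|²` (`IsH1.weighted_norm_sq_le`, `exp_mul_norm_fn_le`).

Convexity. Let `r₁`, `r₂` be the weighted residuals of `W` and `W + v`, and `Tv` the linearization
of the residual at `W`. Over each node, the contribution to `J(W + v) - J(W) - J'(W)v` is `‖r₂ -
r₁‖² + 2⟨r₁, r₂ - r₁ - Tv⟩`. Uniform invertibility of `D_N` bounds the first term below by `c²/2`
times the weighted norm of `v_y`, up to a multiple of `M² = sup e^{2λy}|v|²`
(`half_weighted_deriv_le`). The second is at most a multiple of `M²`, with a factor independent of
`λ`, because the remainder is quadratic in `v` and can carry both copies of the weight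
(`abs_inner_remainder_le`). As `M²` may be taken to be `1/(2λ)` times the weighted norm of the
derivatives, large `λ` absorbs both errors, and the Poincaré inequality `H10.norm_sq_le_deriv`
returns to the full norm (`exists_convexity`).

Invertibility of `D_N`. Each `Ψ_s` is `e^α` times a polynomial of degree `s`, so `Ψ_s' - Ψ_s` is
`e^α` times a polynomial of smaller degree. Hence `M_N` is triangular with unit diagonal
(`det_matM`), and `A_{n+1}` tends to zero as `a` grows (`exists_isFar`).

Differentiability. The nonlinear term is an integral over `(-d, d)²` of a linear function of `W`
times an exponential of a linear one; on balls it has a Lipschitz derivative with constants governed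
by `κ` and `σ` (`exists_nonlin_bounds`). Since `H¹(a, b)` embeds in the continuous functions, this
pointwise calculus passes to `L₂` (`norm_wRes_add_sub_le`, `hasFDerivAt_J`,
`exists_lipschitz_gradF`).

Minimization. Strong convexity makes minimizing sequences Cauchy, and `H_{N,0}^{1,h}` is complete
(`H10.completeSpace`). The constants are uniform in the grid because `h ≥ h₀` leaves finitely many
values of `m` (`exists_uniform_bound`). -/

open MeasureTheory Set

noncomputable section

namespace Convexification

section

/-! ### The orthonormal basis -/

/-- The Gram-Schmidt residual of `α ^ s * exp α`, before normalization. -/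
def psiNum (d : ℝ) (s : ℕ) (α : ℝ) : ℝ :=
  α ^ s * Real.exp α -
    ∑ k : Fin s, (∫ t in (-d)..d, t ^ s * Real.exp t * Psi d k.1 t) * Psi d k.1 α

theorem Psi_eq (d : ℝ) (s : ℕ) (α : ℝ) :
    Psi d s α = psiNum d s α / Real.sqrt (∫ t in (-d)..d, psiNum d s t ^ 2) := by
  rw [Psi]
  rfl

theorem integral_sq_poly_mul_exp_pos {d : ℝ} (hd : 0 < d) {p : Polynomial ℝ} (hp : p ≠ 0) :
    0 < ∫ t in (-d)..d, (p.eval t * Real.exp t) ^ 2 := by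
  refine intervalIntegral.integral_pos (by linarith) ?_ (fun x _ => sq_nonneg _) ?_
  · exact Continuous.continuousOn (by fun_prop)
  · by_contra! h
    refine hp (Polynomial.eq_zero_of_infinite_isRoot p ?_)
    refine (Set.Icc_infinite (show -d < d by linarith)).mono fun x hx => ?_
    have h1 := h x hx
    have h2 : p.eval x * Real.exp x = 0 := by
      have := sq_nonneg (p.eval x * Real.exp x)
      exact pow_eq_zero_iff (two_ne_zero) |>.1 (le_antisymm h1 this)
    simpa [(Real.exp_pos x).ne'] using h2

/-- The subtracted projections only involve polynomials of degree below `s`, so the leading term of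
`X ^ s` survives. -/
theorem exists_poly_psiNum {d : ℝ} (s : ℕ)
    (ih : ∀ k < s, ∃ p : Polynomial ℝ, p.degree = k ∧ ∀ α, Psi d k α = p.eval α * Real.exp α) :
    ∃ p : Polynomial ℝ, p.degree = s ∧ ∀ α, psiNum d s α = p.eval α * Real.exp α := by
  choose! q hq hq' using ih
  set c : ℕ → ℝ := fun k => ∫ t in (-d)..d, t ^ s * Real.exp t * Psi d k t
  refine ⟨Polynomial.X ^ s - ∑ k : Fin s, Polynomial.C (c k) * q k, ?_, fun α => ?_⟩
  · rw [Polynomial.degree_sub_eq_left_of_degree_lt, Polynomial.degree_X_pow]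
    rw [Polynomial.degree_X_pow]
    refine (Polynomial.degree_sum_le _ _).trans_lt ?_
    refine (Finset.sup_lt_iff (WithBot.bot_lt_coe s)).2 fun k _ => ?_
    refine (Polynomial.degree_mul_le _ _).trans_lt ?_
    refine (add_le_add_left Polynomial.degree_C_le _).trans_lt ?_
    rw [zero_add]
    rw [hq k k.2]
    exact Nat.cast_lt.2 k.2
  · simp only [psiNum, Polynomial.eval_sub, Polynomial.eval_pow, Polynomial.eval_X,
      Polynomial.eval_finsetSum, Polynomial.eval_mul, Polynomial.eval_C, sub_mul, Finset.sum_mul]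
    congr 1
    refine Finset.sum_congr rfl fun k _ => ?_
    rw [hq' k k.2]
    ring

theorem psiNorm_pos_of_poly {d : ℝ} (hd : 0 < d) {s : ℕ}
    (h : ∃ p : Polynomial ℝ, p.degree = s ∧ ∀ α, psiNum d s α = p.eval α * Real.exp α) :
    0 < ∫ t in (-d)..d, psiNum d s t ^ 2 := by
  obtain ⟨p, hp, hp'⟩ := h
  simp only [hp']
  refine integral_sq_poly_mul_exp_pos hd ?_
  rintro rfl
  simp at hp

/-- The normalizing factor is nonzero because a nonzero polynomial has finitely many roots. The
exact degree is what makes `matM` triangular later. -/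
theorem exists_poly_Psi {d : ℝ} (hd : 0 < d) (s : ℕ) :
    ∃ p : Polynomial ℝ, p.degree = s ∧ ∀ α, Psi d s α = p.eval α * Real.exp α := by
  induction s using Nat.strong_induction_on with
  | _ s ih =>
    have h := exists_poly_psiNum s ih
    have hpos := psiNorm_pos_of_poly hd h
    obtain ⟨p, hp, hp'⟩ := h
    refine ⟨Polynomial.C (1 / Real.sqrt (∫ t in (-d)..d, psiNum d s t ^ 2)) * p, ?_, fun α => ?_⟩
    · rw [Polynomial.degree_C_mul (by positivity), hp]
    · rw [Psi_eq, hp' α]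
      simp only [Polynomial.eval_mul, Polynomial.eval_C]
      ring

theorem psiNorm_pos {d : ℝ} (hd : 0 < d) (s : ℕ) : 0 < ∫ t in (-d)..d, psiNum d s t ^ 2 :=
  psiNorm_pos_of_poly hd (exists_poly_psiNum s fun k _ => exists_poly_Psi hd k)

theorem hasDerivAt_poly_mul_exp (p : Polynomial ℝ) (α : ℝ) :
    HasDerivAt (fun α => p.eval α * Real.exp α)
      (p.derivative.eval α * Real.exp α + p.eval α * Real.exp α) α :=
  (p.hasDerivAt α).mul (Real.hasDerivAt_exp α)

theorem Psi_contDiff {d : ℝ} (hd : 0 < d) (s : ℕ) : ContDiff ℝ 2 (Psi d s) := by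
  obtain ⟨p, -, hp⟩ := exists_poly_Psi hd s
  rw [show Psi d s = fun α => p.eval α * Real.exp α from funext hp]
  exact (p.contDiff_aeval (𝕜 := ℝ) 2).mul Real.contDiff_exp

theorem Psi_continuous {d : ℝ} (hd : 0 < d) (s : ℕ) : Continuous (Psi d s) :=
  (Psi_contDiff hd s).continuous

theorem Psi_hasDerivAt {d : ℝ} (hd : 0 < d) (s : ℕ) (α : ℝ) :
    HasDerivAt (Psi d s) (deriv (Psi d s) α) α :=
  ((Psi_contDiff hd s).differentiable (by norm_num) α).hasDerivAt

theorem deriv_Psi_continuous {d : ℝ} (hd : 0 < d) (s : ℕ) : Continuous (deriv (Psi d s)) :=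
  (Psi_contDiff hd s).continuous_deriv (by norm_num)

theorem psiNum_eq_smul_Psi {d : ℝ} (hd : 0 < d) (s : ℕ) (α : ℝ) :
    psiNum d s α = Real.sqrt (∫ t in (-d)..d, psiNum d s t ^ 2) * Psi d s α := by
  rw [Psi_eq]
  field_simp [(Real.sqrt_pos.2 (psiNorm_pos hd s)).ne']

/-- For `k < s` the numerator of `Ψ_s` has lost exactly its projection on `Ψ_k`, the earlier
functions being orthonormal by induction; for `k = s` the normalization gives 1. Symmetry removes
the restriction `k ≤ s` afterwards. -/
theorem Psi_orthonormal_aux {d : ℝ} (hd : 0 < d) (s : ℕ) :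
    ∀ k ≤ s, ∫ t in (-d)..d, Psi d s t * Psi d k t = if k = s then 1 else 0 := by
  induction s using Nat.strong_induction_on with
  | _ s ih =>
    intro k hk
    rcases hk.lt_or_eq with hk | rfl
    · rw [if_neg hk.ne]
      set r := Real.sqrt (∫ t in (-d)..d, psiNum d s t ^ 2)
      have h1 : ∀ t, Psi d s t * Psi d k t = r⁻¹ * (t ^ s * Real.exp t * Psi d k t -
          ∑ j : Fin s, (∫ t in (-d)..d, t ^ s * Real.exp t * Psi d j.1 t) *
            (Psi d j.1 t * Psi d k t)) := by
        intro t
        rw [Psi_eq, psiNum, div_eq_inv_mul, mul_assoc, sub_mul, Finset.sum_mul]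
        simp only [mul_assoc]
        rfl
      have hc := fun j => Psi_continuous hd j
      have hij : ∀ j : Fin s, ∫ t in (-d)..d, Psi d j.1 t * Psi d k t =
          if j = ⟨k, hk⟩ then 1 else 0 := by
        intro j
        rcases le_total k j.1 with h | h
        · rw [ih j.1 j.2 k h]
          simp [Fin.ext_iff, eq_comm]
        · simp only [mul_comm (Psi d j.1 _)]
          rw [ih k hk j.1 h]
          simp [Fin.ext_iff]
      simp only [h1]
      rw [intervalIntegral.integral_const_mul, intervalIntegral.integral_sub,
        intervalIntegral.integral_finsetSum]
      · simp only [intervalIntegral.integral_const_mul, hij]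
        simp
      · intro j _
        exact Continuous.intervalIntegrable (by have := hc j; have := hc k; fun_prop) _ _
      · exact Continuous.intervalIntegrable (by have := hc k; fun_prop) _ _
      · exact Continuous.intervalIntegrable
          (continuous_finsetSum _ fun j _ => by have := hc j; have := hc k; fun_prop) _ _
    · rw [if_pos rfl]
      have hpos := psiNorm_pos hd k
      have : ∀ t, Psi d k t * Psi d k t = (∫ t in (-d)..d, psiNum d k t ^ 2)⁻¹ *
          psiNum d k t ^ 2 := by
        intro t
        rw [Psi_eq, div_mul_div_comm, Real.mul_self_sqrt hpos.le]
        ring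
      simp only [this]
      rw [intervalIntegral.integral_const_mul, inv_mul_cancel₀ hpos.ne']

theorem Psi_orthonormal {d : ℝ} (hd : 0 < d) (s k : ℕ) :
    ∫ t in (-d)..d, Psi d s t * Psi d k t = if k = s then 1 else 0 := by
  rcases le_total k s with h | h
  · exact Psi_orthonormal_aux hd s k h
  · simp only [mul_comm (Psi d s _)]
    rw [Psi_orthonormal_aux hd k s h]
    simp [eq_comm]

/-- Solving the Gram-Schmidt formula for `t ^ j * exp t` places this function in the span of `Ψ_0,
…, Ψ_j`, which is orthogonal to `Ψ_k`. -/
theorem integral_pow_mul_Psi {d : ℝ} (hd : 0 < d) {j k : ℕ} (hjk : j < k) :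
    ∫ t in (-d)..d, t ^ j * Real.exp t * Psi d k t = 0 := by
  have hc := fun j => Psi_continuous hd j
  have h : ∀ t, t ^ j * Real.exp t * Psi d k t =
      Real.sqrt (∫ t in (-d)..d, psiNum d j t ^ 2) * (Psi d j t * Psi d k t) +
      ∑ i : Fin j, (∫ t in (-d)..d, t ^ j * Real.exp t * Psi d i.1 t) *
        (Psi d i.1 t * Psi d k t) := by
    intro t
    rw [← mul_assoc, ← psiNum_eq_smul_Psi hd, psiNum, sub_mul, Finset.sum_mul]
    simp only [mul_assoc]
    ring
  simp only [h]
  rw [intervalIntegral.integral_add, intervalIntegral.integral_finsetSum]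
  · simp only [intervalIntegral.integral_const_mul, Psi_orthonormal hd]
    rw [if_neg hjk.ne', mul_zero, zero_add]
    refine Finset.sum_eq_zero fun i _ => ?_
    rw [if_neg (i.2.trans hjk).ne', mul_zero]
  · intro i _
    exact Continuous.intervalIntegrable (by have := hc i; have := hc k; fun_prop) _ _
  · exact Continuous.intervalIntegrable (by have := hc j; have := hc k; fun_prop) _ _
  · exact Continuous.intervalIntegrable
      (continuous_finsetSum _ fun i _ => by have := hc i; have := hc k; fun_prop) _ _

theorem integral_poly_mul_Psi {d : ℝ} (hd : 0 < d) {k : ℕ} {p : Polynomial ℝ}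
    (hp : p.degree < k) : ∫ t in (-d)..d, p.eval t * Real.exp t * Psi d k t = 0 := by
  rcases eq_or_ne p 0 with rfl | h0
  · simp
  have hc := Psi_continuous hd k
  have h : ∀ t, p.eval t * Real.exp t * Psi d k t =
      ∑ i ∈ Finset.range k, p.coeff i * (t ^ i * Real.exp t * Psi d k t) := by
    intro t
    rw [Polynomial.eval_eq_sum_range' (n := k), Finset.sum_mul, Finset.sum_mul]
    · simp only [mul_assoc]
    · exact (Polynomial.natDegree_lt_iff_degree_lt h0).2 hp
  simp only [h]
  rw [intervalIntegral.integral_finsetSum]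
  · refine Finset.sum_eq_zero fun i hi => ?_
    rw [intervalIntegral.integral_const_mul, integral_pow_mul_Psi hd (Finset.mem_range.1 hi),
      mul_zero]
  · intro i _
    exact Continuous.intervalIntegrable (by fun_prop) _ _

/-- From `Ψ_s = p e^α` follows `Ψ_s' = Ψ_s + p' e^α`. The last term has degree below `s ≤ k`, hence
is orthogonal to `Ψ_k`, and orthonormality evaluates the rest. -/
theorem integral_deriv_Psi_mul_Psi {d : ℝ} (hd : 0 < d) {s k : ℕ} (hsk : s ≤ k) :
    ∫ t in (-d)..d, deriv (Psi d s) t * Psi d k t = if k = s then 1 else 0 := by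
  have hc := fun j => Psi_continuous hd j
  obtain ⟨p, hp, hp'⟩ := exists_poly_Psi hd s
  have hD : ∀ t, deriv (Psi d s) t = p.derivative.eval t * Real.exp t + Psi d s t := by
    intro t
    rw [hp' t, ← (hasDerivAt_poly_mul_exp p t).deriv]
    congr 1
    exact funext hp'
  have hp0 : p ≠ 0 := by
    rintro rfl
    simp at hp
  simp only [hD, add_mul]
  rw [intervalIntegral.integral_add, Psi_orthonormal hd, integral_poly_mul_Psi hd, zero_add]
  · refine (Polynomial.degree_derivative_lt hp0).trans_le ?_
    rw [hp]
    exact_mod_cast hsk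
  · exact Continuous.intervalIntegrable (by have := hc k; fun_prop) _ _
  · exact Continuous.intervalIntegrable (by have := hc s; have := hc k; fun_prop) _ _

theorem det_matM {d : ℝ} (hd : 0 < d) (N : ℕ) : (matM N d).det = 1 := by
  rw [Matrix.det_of_isUpperTriangular]
  · refine Finset.prod_eq_one fun i _ => ?_
    rw [matM, Matrix.of_apply, integral_deriv_Psi_mul_Psi hd le_rfl, if_pos rfl]
  · intro i j hij
    have hij' : j < i := hij
    rw [matM, Matrix.of_apply, integral_deriv_Psi_mul_Psi hd hij'.le, if_neg]
    exact fun h => hij'.ne' (Fin.ext h)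

/-- The vector of the values of the basis functions. -/
def psiVec (N : ℕ) (d α : ℝ) : Vec N := WithLp.toLp 2 fun k => Psi d k α

/-- The vector of the derivatives of the basis functions. -/
def psiVec' (N : ℕ) (d α : ℝ) : Vec N := WithLp.toLp 2 fun k => deriv (Psi d k) α

theorem psiVec_continuous {d : ℝ} (hd : 0 < d) (N : ℕ) : Continuous (psiVec N d) :=
  (PiLp.continuous_toLp 2 _).comp (continuous_pi fun k => Psi_continuous hd k)

theorem psiVec'_continuous {d : ℝ} (hd : 0 < d) (N : ℕ) : Continuous (psiVec' N d) :=
  (PiLp.continuous_toLp 2 _).comp (continuous_pi fun k => deriv_Psi_continuous hd k)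

/-- As an inner product, the truncated series lets the nonlinear term be studied in an abstract
inner product space, without coordinates. -/
theorem series_eq_inner {N : ℕ} (d : ℝ) (W : Vec N) (α : ℝ) :
    series d W α = inner ℝ (psiVec N d α) W := by
  simp [series, psiVec, PiLp.inner_apply]

theorem series_hasDerivAt {N : ℕ} {d : ℝ} (hd : 0 < d) (W : Vec N) (α : ℝ) :
    HasDerivAt (series d W) (inner ℝ (psiVec' N d α) W) α := by
  have : HasDerivAt (series d W)
      (∑ s : Fin N, W s * deriv (Psi d s) α) α :=
    HasDerivAt.fun_sum fun s _ => (Psi_hasDerivAt hd s α).const_mul (W s)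
  simpa [psiVec', PiLp.inner_apply] using this

end

section

/-! ### Geometry of the directions and the coefficient matrices -/

variable {n : ℕ} [NeZero n]

/-- The square of the distance `|𝐱 - 𝐱_α|`. -/
def srcDistSq (X : Pt n) (α : ℝ) : ℝ := ∑ i, srcDiff X α i ^ 2 + X.2 ^ 2

theorem sq_le_srcDistSq (X : Pt n) (α : ℝ) : X.2 ^ 2 ≤ srcDistSq X α :=
  le_add_of_nonneg_left (Finset.sum_nonneg fun _ _ => sq_nonneg _)

theorem srcDistSq_pos {X : Pt n} (hX : 0 < X.2) (α : ℝ) : 0 < srcDistSq X α :=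
  (by positivity : 0 < X.2 ^ 2).trans_le (sq_le_srcDistSq X α)

theorem srcDist_pos {X : Pt n} (hX : 0 < X.2) (α : ℝ) : 0 < srcDist X α :=
  Real.sqrt_pos.2 (srcDistSq_pos hX α)

theorem srcDist_sq {X : Pt n} (hX : 0 < X.2) (α : ℝ) : srcDist X α ^ 2 = srcDistSq X α :=
  Real.sq_sqrt (srcDistSq_pos hX α).le

theorem srcDiff_zero (X : Pt n) (α : ℝ) : srcDiff X α 0 = X.1 0 - α := by
  simp [srcDiff]

theorem srcDiff_continuous : Continuous fun z : Pt n × ℝ => srcDiff z.1 z.2 :=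
  (continuous_fst.comp continuous_fst).update 0 (by fun_prop)

theorem srcDistSq_continuous : Continuous fun z : Pt n × ℝ => srcDistSq z.1 z.2 := by
  have h : ∀ i, Continuous fun z : Pt n × ℝ => srcDiff z.1 z.2 i :=
    fun i => (continuous_apply i).comp srcDiff_continuous
  unfold srcDistSq
  fun_prop

theorem srcDist_continuous : Continuous fun z : Pt n × ℝ => srcDist z.1 z.2 :=
  srcDistSq_continuous.sqrt

theorem hasDerivAt_srcDiff (X : Pt n) (i : Fin n) (α : ℝ) :
    HasDerivAt (fun α => srcDiff X α i) (-(if i = 0 then 1 else 0)) α := by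
  by_cases hi : i = 0
  · subst hi
    simp only [srcDiff_zero, if_true]
    exact (hasDerivAt_id α).const_sub (X.1 0)
  · simp only [srcDiff, Function.update_of_ne hi, if_neg hi, neg_zero]
    exact hasDerivAt_const α _

theorem hasDerivAt_srcDist {X : Pt n} (hX : 0 < X.2) (α : ℝ) :
    HasDerivAt (srcDist X) (-(X.1 0 - α) / srcDist X α) α := by
  have h1 : HasDerivAt (srcDistSq X) (∑ i, 2 * srcDiff X α i * -(if i = 0 then 1 else 0)) α := by
    refine HasDerivAt.add_const _ (HasDerivAt.fun_sum fun i _ => ?_)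
    refine ((hasDerivAt_srcDiff X i α).fun_pow 2).congr_deriv ?_
    norm_num
  have h2 : ∑ i, 2 * srcDiff X α i * -(if i = 0 then (1 : ℝ) else 0) = -2 * (X.1 0 - α) := by
    simp [srcDiff_zero]
  rw [h2] at h1
  refine (h1.sqrt (srcDistSq_pos hX α).ne').congr_deriv ?_
  change _ / (2 * srcDist X α) = _
  have := (srcDist_pos hX α).ne'
  field_simp

/-- This is the logarithmic derivative of `y / |𝐱 - 𝐱_α|`. The square roots cancel, leaving a
quotient that is visibly continuous and small for large `y`. -/
theorem deriv_nuY_div {X : Pt n} (hX : 0 < X.2) (α : ℝ) :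
    deriv (nuY X) α / nuY X α = (X.1 0 - α) / srcDistSq X α := by
  have h := srcDist_pos hX α
  have h1 : HasDerivAt (nuY X) _ α :=
    (hasDerivAt_const α X.2).div (hasDerivAt_srcDist hX α) h.ne'
  rw [h1.deriv, nuY, ← srcDist_sq hX]
  field_simp
  ring

theorem nuX_div {X : Pt n} (hX : 0 < X.2) (i : Fin n) (α : ℝ) :
    nuX X i α / nuY X α = srcDiff X α i / X.2 := by
  have h := srcDist_pos hX α
  rw [nuX, nuY]
  field_simp

theorem deriv_nuX_div {X : Pt n} (hX : 0 < X.2) (i : Fin n) (α : ℝ) :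
    deriv (nuX X i) α / nuY X α =
      (-(if i = 0 then 1 else 0) + srcDiff X α i * (X.1 0 - α) / srcDistSq X α) / X.2 := by
  have h := srcDist_pos hX α
  have h1 : HasDerivAt (nuX X i) _ α :=
    (hasDerivAt_srcDiff X i α).div (hasDerivAt_srcDist hX α) h.ne'
  rw [h1.deriv, nuY, ← srcDist_sq hX]
  generalize (if i = 0 then (1 : ℝ) else 0) = c
  field_simp
  ring

/-- The integrand `f` contains derivatives whose joint continuity is not apparent; on `s` it is
replaced by the explicit formula `g`. -/
theorem continuousOn_paramIntegral {Y : Type*} [TopologicalSpace Y] [FirstCountableTopology Y]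
    {s : Set Y} {f : Y → ℝ → ℝ} {g : Y → ℝ → ℝ} {u v : ℝ} (hfg : ∀ x ∈ s, ∀ t, f x t = g x t)
    (hg : ContinuousOn (fun z : Y × ℝ => g z.1 z.2) (s ×ˢ univ)) :
    ContinuousOn (fun x => ∫ t in u..v, f x t) s := by
  rw [continuousOn_iff_continuous_domRestrict]
  have h : s.domRestrict (fun x => ∫ t in u..v, f x t) = fun x : s => ∫ t in u..v, g x t := by
    funext x
    simp only [domRestrict_apply, hfg x x.2]
  rw [h]
  refine intervalIntegral.continuous_parametric_intervalIntegral_of_continuous' ?_ u v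
  exact hg.comp_continuous (f := fun z : s × ℝ => ((z.1 : Y), z.2)) (by fun_prop)
    fun z => ⟨z.1.2, mem_univ _⟩

theorem continuousOn_matD (N : ℕ) {d : ℝ} (hd : 0 < d) :
    ContinuousOn (matD (n := n) N d) {X | 0 < X.2} := by
  refine continuousOn_const.add ?_
  refine continuousOn_pi.2 fun k => continuousOn_pi.2 fun s => ?_
  have hc := fun j => Psi_continuous hd j
  refine continuousOn_paramIntegral
    (g := fun X α => (X.1 0 - α) / srcDistSq X α * Psi d s α * Psi d k α)
    (fun X hX t => by rw [deriv_nuY_div hX]) ?_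
  have h1 := hc k
  have h2 := hc s
  refine ContinuousOn.mul (ContinuousOn.mul (ContinuousOn.div ?_
    srcDistSq_continuous.continuousOn fun z hz => (srcDistSq_pos hz.1 _).ne') ?_) ?_ <;>
  exact Continuous.continuousOn (by fun_prop)

theorem continuousOn_matA (N : ℕ) {d : ℝ} (hd : 0 < d) (i : Fin n) :
    ContinuousOn (matA (n := n) N d i) {X | 0 < X.2} := by
  refine continuousOn_pi.2 fun k => continuousOn_pi.2 fun s => ?_
  refine continuousOn_paramIntegral
    (g := fun X α => (srcDiff X α i / X.2 * deriv (Psi d s) α +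
      (-(if i = 0 then 1 else 0) + srcDiff X α i * (X.1 0 - α) / srcDistSq X α) / X.2 *
        Psi d s α) * Psi d k α)
    (fun X hX t => by rw [nuX_div hX, deriv_nuX_div hX]) ?_
  have h1 := Psi_continuous hd k
  have h2 := Psi_continuous hd s
  have h3 := deriv_Psi_continuous hd s
  have h4 : Continuous fun z : Pt n × ℝ => srcDiff z.1 z.2 i :=
    (continuous_apply i).comp srcDiff_continuous
  have h5 : ContinuousOn (fun z : Pt n × ℝ => z.1.2) ({X | 0 < X.2} ×ˢ univ) :=
    Continuous.continuousOn (by fun_prop)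
  have h6 : ContinuousOn (fun z : Pt n × ℝ => srcDiff z.1 z.2 i * (z.1.1 0 - z.2) /
      srcDistSq z.1 z.2) ({X | 0 < X.2} ×ˢ univ) :=
    ContinuousOn.div (Continuous.continuousOn (by fun_prop)) srcDistSq_continuous.continuousOn
      fun z hz => (srcDistSq_pos hz.1 _).ne'
  refine ContinuousOn.mul (ContinuousOn.add (ContinuousOn.mul (h4.continuousOn.div h5
    fun z hz => (show 0 < z.1.2 from hz.1).ne') ?_) (ContinuousOn.mul
      ((continuousOn_const.add h6).div h5 fun z hz => (show 0 < z.1.2 from hz.1).ne') ?_)) ?_ <;>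
  exact Continuous.continuousOn (by fun_prop)

theorem isCompact_OmegaBar {n : ℕ} (A a b : ℝ) : IsCompact (OmegaBar n A a b) := by
  have : OmegaBar n A a b = (univ.pi fun _ => Icc (-A) A) ×ˢ Icc a b := by
    exact Set.ext fun X => ⟨fun h => ⟨fun i _ => h.1 i, h.2⟩,
      fun h => ⟨fun i => h.1 i (mem_univ _), h.2⟩⟩
  rw [this]
  exact (isCompact_univ_pi fun _ => isCompact_Icc).prod isCompact_Icc

/-! ### Coercivity of `D_N`, bounds for the matrices, and existence of `a₀` -/

/-- The operator on `ℝᴺ` given by a matrix. -/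
def matCLM {N : ℕ} (M : Matrix (Fin N) (Fin N) ℝ) : Vec N →L[ℝ] Vec N :=
  LinearMap.toContinuousLinearMap (Matrix.toLpLin 2 2 M)

theorem matCLM_apply {N : ℕ} (M : Matrix (Fin N) (Fin N) ℝ) (v : Vec N) :
    matCLM M v = Matrix.toLpLin 2 2 M v := rfl

theorem matCLM_continuous {N : ℕ} : Continuous (matCLM (N := N)) :=
  LinearMap.continuous_of_finiteDimensional
    ((LinearMap.toContinuousLinearMap.toLinearMap : (Vec N →ₗ[ℝ] Vec N) →ₗ[ℝ] _) ∘ₗ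
      (Matrix.toLpLin 2 2).toLinearMap)

theorem matCLM_injective {N : ℕ} {M : Matrix (Fin N) (Fin N) ℝ} (hM : IsUnit M) {v : Vec N}
    (hv : matCLM M v = 0) : v = 0 := by
  have h := hM.map (Matrix.toLpLinAlgEquiv (R := ℝ) 2)
  exact (Module.End.isUnit_iff _ |>.1 h).1 (hv.trans (map_zero (Matrix.toLpLin 2 2 M)).symm)

/-- The function `|D_N(X) v|` is continuous and positive on the compact product of `Ω̄` and the unit
sphere, hence bounded below there; homogeneity gives all `v`. -/
theorem exists_coercive_matD {N : ℕ} {A d a₀ a b : ℝ} (hd : 0 < d) (h : IsFar n N A d a₀)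
    (ha : a₀ ≤ a) (hab : a < b) :
    ∃ c : ℝ, 0 < c ∧ ∀ X ∈ OmegaBar n A a b, ∀ v : Vec N, c * ‖v‖ ≤ ‖matCLM (matD N d X) v‖ := by
  have hpos : ∀ X ∈ OmegaBar n A a b, 0 < X.2 := fun X hX =>
    (zero_lt_one.trans h.1).trans_le (ha.trans hX.2.1)
  have hcomp := (isCompact_OmegaBar (n := n) A a b).prod (isCompact_sphere (0 : Vec N) 1)
  have hcont : ContinuousOn (fun z : Pt n × Vec N => ‖matCLM (matD N d z.1) z.2‖)
      (OmegaBar n A a b ×ˢ Metric.sphere (0 : Vec N) 1) := by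
    refine ContinuousOn.norm (ContinuousOn.clm_apply ?_ continuousOn_snd)
    exact matCLM_continuous.comp_continuousOn
      ((continuousOn_matD N hd).comp continuousOn_fst fun z hz => hpos _ hz.1)
  obtain ⟨c, hc, hc'⟩ := hcomp.exists_forall_le' (a := 0) hcont fun z hz => by
    refine norm_pos_iff.2 fun h0 => ?_
    have := matCLM_injective (h.2 a b ha hab z.1 hz.1) h0
    have h2 := hz.2
    rw [this] at h2
    simp at h2
  refine ⟨c, hc, fun X hX v => ?_⟩
  rcases eq_or_ne v 0 with rfl | hv
  · simp
  have hv' := norm_pos_iff.2 hv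
  have := hc' (X, ‖v‖⁻¹ • v) ⟨hX, by simp [norm_smul, hv]⟩
  simp only [map_smul, norm_smul, norm_inv, norm_norm] at this
  rwa [inv_mul_eq_div, le_div_iff₀ hv'] at this

theorem exists_bound_mat (n N : ℕ) [NeZero n] {A d a b : ℝ} (hd : 0 < d) (ha : 0 < a) :
    ∃ C : ℝ, 0 < C ∧ ∀ X ∈ OmegaBar n A a b, ‖matCLM (matD N d X)‖ ≤ C ∧
      ∀ i, ‖matCLM (matA N d i X)‖ ≤ C := by
  have hpos : OmegaBar n A a b ⊆ {X | 0 < X.2} := fun X hX => ha.trans_le hX.2.1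
  obtain ⟨C, hC⟩ := (isCompact_OmegaBar (n := n) A a b).exists_bound_of_continuousOn
    (matCLM_continuous.comp_continuousOn ((continuousOn_matD N hd).mono hpos))
  have := fun i => (isCompact_OmegaBar (n := n) A a b).exists_bound_of_continuousOn
    (matCLM_continuous.comp_continuousOn ((continuousOn_matA N hd i).mono hpos))
  choose C' hC' using this
  refine ⟨|C| + ∑ i, |C' i| + 1, by positivity, fun X hX => ⟨(hC X hX).trans ?_, fun i =>
    (hC' i X hX).trans ?_⟩⟩
  · have : 0 ≤ ∑ i, |C' i| := by positivity
    linarith [le_abs_self C]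
  · have := Finset.single_le_sum (f := fun i => |C' i|) (fun i _ => abs_nonneg _)
      (Finset.mem_univ i)
    linarith [le_abs_self (C' i), abs_nonneg C]

theorem abs_le_norm_vec {N : ℕ} (v : Vec N) (k : Fin N) : |v k| ≤ ‖v‖ :=
  PiLp.norm_apply_le v k

/-- `D_N` is a perturbation of `M_N`, whose determinant is 1, by a matrix whose entries are at most
`c / a`; the determinant is continuous. -/
theorem exists_isFar (n N : ℕ) [NeZero n] {A d : ℝ} (hA : 0 < A) (hd : 0 < d) :
    ∃ a₀, IsFar n N A d a₀ := by
  obtain ⟨B, hB⟩ := isCompact_Icc.exists_bound_of_continuousOn (s := Icc (-d) d)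
    (psiVec_continuous hd N).continuousOn
  have hB0 : 0 ≤ B := (norm_nonneg _).trans (hB 0 ⟨by linarith, hd.le⟩)
  have hdet : ∀ᶠ T : Fin N → Fin N → ℝ in nhds 0, (matM N d + Matrix.of T).det ≠ 0 := by
    refine ContinuousAt.eventually_ne ?_ ?_
    · exact Continuous.continuousAt (Continuous.matrix_det (continuous_const.add continuous_id))
    · change (matM N d + 0).det ≠ 0
      rw [add_zero, det_matM hd]
      exact one_ne_zero
  obtain ⟨ε, hε, hdet⟩ := Metric.eventually_nhds_iff.1 hdet
  set c := (A + d) * B * B * (2 * d) with hc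
  have hc0 : 0 ≤ c := by positivity
  -- The second entry forces `c / a < ε`. The first gives `a₀ > 1` and `a ≤ y ≤ y²`, so that the
  -- denominator `|𝐱 - 𝐱_α|²` is at least `a`.
  refine ⟨max 2 (c / ε + 1), lt_of_lt_of_le one_lt_two (le_max_left _ _), fun a b ha hab X hX => ?_⟩
  have ha2 : 2 ≤ a := (le_max_left _ _).trans ha
  have hac : c / ε + 1 ≤ a := (le_max_right _ _).trans ha
  have hX2 : 0 < X.2 := by linarith [hX.2.1]
  rw [Matrix.isUnit_iff_isUnit_det]
  refine isUnit_iff_ne_zero.2 (hdet (y := matAy N d X) ?_)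
  refine (dist_pi_lt_iff hε).2 fun k => (dist_pi_lt_iff hε).2 fun s => ?_
  simp only [Pi.zero_apply, dist_zero_right]
  have hbd : ‖matAy N d X k s‖ ≤ (A + d) / a * B * B * |d - -d| := by
    refine intervalIntegral.norm_integral_le_of_norm_le_const fun α hα => ?_
    rw [uIoc_of_le (by linarith)] at hα
    have hα' : α ∈ Icc (-d) d := ⟨hα.1.le, hα.2⟩
    rw [deriv_nuY_div hX2, norm_mul, norm_mul]
    have hP : ∀ j : Fin N, ‖Psi d j α‖ ≤ B := fun j =>
      (abs_le_norm_vec (psiVec N d α) j).trans (hB α hα')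
    have h1 : ‖(X.1 0 - α) / srcDistSq X α‖ ≤ (A + d) / a := by
      rw [norm_div]
      refine div_le_div₀ (by positivity) ?_ (by linarith) ?_
      · rw [Real.norm_eq_abs, abs_le]
        constructor <;> linarith [(hX.1 0).1, (hX.1 0).2, hα'.1, hα'.2]
      · rw [Real.norm_of_nonneg (srcDistSq_pos hX2 α).le]
        refine le_trans ?_ (sq_le_srcDistSq X α)
        nlinarith [hX.2.1]
    exact mul_le_mul (mul_le_mul h1 (hP s) (norm_nonneg _) (by positivity)) (hP k)
      (norm_nonneg _) (by positivity)
  refine hbd.trans_lt ?_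
  have h3 : (A + d) / a * B * B * |d - -d| = c / a := by
    rw [abs_of_pos (by linarith), hc]
    ring
  rw [h3, div_lt_iff₀ (by linarith)]
  have : c / ε < a := by linarith
  rwa [div_lt_iff₀ hε, mul_comm] at this

end

section

/-! ### The integrand of the nonlinear term -/

section ExpFactor

variable {E : Type*} [NormedAddCommGroup E] [InnerProductSpace ℝ E]

/-- The dependence on `W` of the integrand of the nonlinear term. -/
def expFactor (c₀ c₁ : ℝ) (q r W : E) : ℝ :=
  (c₁ - c₀ * inner ℝ q W) * Real.exp (inner ℝ r W)

/-- The derivative of `expFactor` in `W`. -/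
def expFactorD (c₀ c₁ : ℝ) (q r W : E) : E →L[ℝ] ℝ :=
  Real.exp (inner ℝ r W) • ((c₁ - c₀ * inner ℝ q W) • innerSL ℝ r - c₀ • innerSL ℝ q)

/-- In the application `c₀ = K`, `c₁ = ∂_α K`, `q = Ψ'(α)` and `r = Ψ(β) - Ψ(α)`. The estimates that
follow use only bounds for these four parameters, so they are uniform over all media. -/
theorem hasFDerivAt_expFactor (c₀ c₁ : ℝ) (q r W : E) :
    HasFDerivAt (expFactor c₀ c₁ q r) (expFactorD c₀ c₁ q r W) W := by
  have hq : HasFDerivAt (fun W : E => inner ℝ q W) (innerSL ℝ q) W := (innerSL ℝ q).hasFDerivAt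
  have hr : HasFDerivAt (fun W : E => inner ℝ r W) (innerSL ℝ r) W := (innerSL ℝ r).hasFDerivAt
  refine (((hq.const_mul c₀).const_sub c₁).mul hr.exp).congr_fderiv ?_
  ext V
  simp [expFactorD]
  ring

/-- For `t ≤ s` one has `e^s - e^t = e^s (1 - e^{t-s}) ≤ e^s (s - t)`. -/
theorem abs_exp_sub_exp_le {M s t : ℝ} (hs : s ≤ M) (ht : t ≤ M) :
    |Real.exp s - Real.exp t| ≤ Real.exp M * |s - t| := by
  wlog h : t ≤ s generalizing s t
  · rw [abs_sub_comm, abs_sub_comm s t]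
    exact this ht hs (le_of_not_ge h)
  rw [abs_of_nonneg (sub_nonneg.2 (Real.exp_le_exp.2 h)), abs_of_nonneg (sub_nonneg.2 h)]
  have h1 := Real.add_one_le_exp (t - s)
  have h2 : Real.exp t = Real.exp s * Real.exp (t - s) := by rw [← Real.exp_add]; congr 1; ring
  have h3 := Real.exp_le_exp.2 hs
  rw [h2]
  nlinarith [Real.exp_pos s]

theorem abs_inner_le_mul {L ρ : ℝ} {r W : E} (hr : ‖r‖ ≤ L) (hW : ‖W‖ ≤ ρ) :
    |inner ℝ r W| ≤ L * ρ :=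
  (abs_real_inner_le_norm r W).trans
    (mul_le_mul hr hW (norm_nonneg _) ((norm_nonneg _).trans hr))

variable {κ L ρ c₀ c₁ : ℝ} {q r W W' : E}

theorem abs_linFactor_le (h₀ : |c₀| ≤ κ) (h₁ : |c₁| ≤ κ) (hq : ‖q‖ ≤ L) (hW : ‖W‖ ≤ ρ) :
    |c₁ - c₀ * inner ℝ q W| ≤ κ * (1 + L * ρ) := by
  have h2 : |c₀ * inner ℝ q W| ≤ κ * (L * ρ) := by
    rw [abs_mul]
    exact mul_le_mul h₀ (abs_inner_le_mul hq hW) (abs_nonneg _) ((abs_nonneg _).trans h₀)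
  linarith [abs_sub c₁ (c₀ * inner ℝ q W)]

theorem exp_inner_le (hr : ‖r‖ ≤ L) (hW : ‖W‖ ≤ ρ) :
    Real.exp (inner ℝ r W) ≤ Real.exp (L * ρ) :=
  Real.exp_le_exp.2 ((le_abs_self _).trans (abs_inner_le_mul hr hW))

theorem abs_expFactor_le (h₀ : |c₀| ≤ κ) (h₁ : |c₁| ≤ κ) (hq : ‖q‖ ≤ L) (hr : ‖r‖ ≤ L)
    (hW : ‖W‖ ≤ ρ) : |expFactor c₀ c₁ q r W| ≤ κ * (1 + L * ρ) * Real.exp (L * ρ) := by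
  have h := abs_linFactor_le h₀ h₁ hq hW
  rw [expFactor, abs_mul, abs_of_pos (Real.exp_pos _)]
  exact mul_le_mul h (exp_inner_le hr hW) (Real.exp_pos _).le ((abs_nonneg _).trans h)

theorem norm_linFactorD_le (h₀ : |c₀| ≤ κ) (h₁ : |c₁| ≤ κ) (hq : ‖q‖ ≤ L) (hr : ‖r‖ ≤ L)
    (hW : ‖W‖ ≤ ρ) : ‖(c₁ - c₀ * inner ℝ q W) • innerSL ℝ r - c₀ • innerSL ℝ q‖ ≤
      κ * (1 + L * ρ) * L + κ * L := by
  have h := abs_linFactor_le h₀ h₁ hq hW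
  refine (norm_sub_le _ _).trans (add_le_add ?_ ?_)
  · rw [norm_smul, innerSL_apply_norm]
    exact mul_le_mul h hr (norm_nonneg _) ((abs_nonneg _).trans h)
  · rw [norm_smul, innerSL_apply_norm]
    exact mul_le_mul h₀ hq (norm_nonneg _) ((abs_nonneg _).trans h₀)

theorem norm_expFactorD_le (h₀ : |c₀| ≤ κ) (h₁ : |c₁| ≤ κ) (hq : ‖q‖ ≤ L) (hr : ‖r‖ ≤ L)
    (hW : ‖W‖ ≤ ρ) :
    ‖expFactorD c₀ c₁ q r W‖ ≤ Real.exp (L * ρ) * (κ * (1 + L * ρ) * L + κ * L) := by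
  rw [expFactorD, norm_smul, Real.norm_of_nonneg (Real.exp_pos _).le]
  exact mul_le_mul (exp_inner_le hr hW) (norm_linFactorD_le h₀ h₁ hq hr hW) (norm_nonneg _)
    (Real.exp_pos _).le

theorem norm_expFactorD_sub_le (h₀ : |c₀| ≤ κ) (h₁ : |c₁| ≤ κ) (hq : ‖q‖ ≤ L) (hr : ‖r‖ ≤ L)
    (hW : ‖W‖ ≤ ρ) (hW' : ‖W'‖ ≤ ρ) :
    ‖expFactorD c₀ c₁ q r W - expFactorD c₀ c₁ q r W'‖ ≤
      Real.exp (L * ρ) * (L * (κ * (1 + L * ρ) * L + κ * L) + κ * L * L) * ‖W - W'‖ := by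
  have hL : 0 ≤ L := (norm_nonneg _).trans hr
  have hκ : 0 ≤ κ := (abs_nonneg _).trans h₀
  have hρ : 0 ≤ ρ := (norm_nonneg _).trans hW
  set G := κ * (1 + L * ρ) * L + κ * L with hG
  have hG0 : 0 ≤ G := by positivity
  -- Each summand varies one factor: the exponential, with the bracket kept at `W`, or the bracket,
  -- with the exponential kept at `W'`. The bracket depends on `W` only through `c₀ ⟨q, W⟩`.
  have hsplit : expFactorD c₀ c₁ q r W - expFactorD c₀ c₁ q r W' =
      (Real.exp (inner ℝ r W) - Real.exp (inner ℝ r W')) •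
        ((c₁ - c₀ * inner ℝ q W) • innerSL ℝ r - c₀ • innerSL ℝ q) -
      (Real.exp (inner ℝ r W') * (c₀ * inner ℝ q (W - W'))) • innerSL ℝ r := by
    ext V
    simp [expFactorD, inner_sub_right]
    ring
  rw [hsplit]
  have h1 : |Real.exp (inner ℝ r W) - Real.exp (inner ℝ r W')| ≤
      Real.exp (L * ρ) * (L * ‖W - W'‖) := by
    refine (abs_exp_sub_exp_le ((le_abs_self _).trans (abs_inner_le_mul hr hW))
      ((le_abs_self _).trans (abs_inner_le_mul hr hW'))).trans ?_
    rw [← inner_sub_right]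
    exact mul_le_mul_of_nonneg_left (abs_inner_le_mul hr le_rfl) (Real.exp_pos _).le
  have h2 : |Real.exp (inner ℝ r W') * (c₀ * inner ℝ q (W - W'))| ≤
      Real.exp (L * ρ) * (κ * (L * ‖W - W'‖)) := by
    rw [abs_mul, abs_mul, abs_of_pos (Real.exp_pos _)]
    refine mul_le_mul (exp_inner_le hr hW') ?_ (by positivity) (Real.exp_pos _).le
    exact mul_le_mul h₀ (abs_inner_le_mul hq le_rfl) (abs_nonneg _) hκ
  calc _ ≤ Real.exp (L * ρ) * (L * ‖W - W'‖) * G +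
        Real.exp (L * ρ) * (κ * (L * ‖W - W'‖)) * L := by
        refine (norm_sub_le _ _).trans (add_le_add ?_ ?_)
        · rw [norm_smul]
          exact mul_le_mul h1 (norm_linFactorD_le h₀ h₁ hq hr hW) (norm_nonneg _) (by positivity)
        · rw [norm_smul, innerSL_apply_norm]
          exact mul_le_mul h2 hr (norm_nonneg _) (by positivity)
    _ = _ := by ring

theorem norm_sub_of_mem_segment_le {x y z : E} (hz : z ∈ segment ℝ x y) : ‖z - x‖ ≤ ‖y - x‖ := by
  obtain ⟨t, ht, rfl⟩ := (segment_eq_image' ℝ x y) ▸ hz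
  simp only [add_sub_cancel_left, norm_smul, Real.norm_of_nonneg ht.1]
  exact mul_le_of_le_one_left (norm_nonneg _) ht.2

/-- The first order Taylor formula with a Lipschitz derivative on a ball. -/
theorem taylor_of_lipschitz_deriv {f : E → ℝ} {f' : E → E →L[ℝ] ℝ} {C : ℝ}
    (hf : ∀ x, HasFDerivAt f (f' x) x)
    (hC : ∀ x y : E, ‖x‖ ≤ ρ → ‖y‖ ≤ ρ → ‖f' x - f' y‖ ≤ C * ‖x - y‖) (hC0 : 0 ≤ C)
    (hW : ‖W‖ ≤ ρ) (hW' : ‖W'‖ ≤ ρ) :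
    |f W' - f W - f' W (W' - W)| ≤ C * ‖W' - W‖ ^ 2 := by
  -- Mean value inequality for `f - f' W` on the segment, whose derivative there is at most `C ‖W' -
  -- W‖`. The optimal factor `1/2` is not needed.
  have h := (convex_segment (𝕜 := ℝ) W W').norm_image_sub_le_of_norm_hasFDerivWithin_le'
    (f := f) (f' := f') (φ := f' W) (C := C * ‖W' - W‖)
    (fun x _ => (hf x).hasFDerivWithinAt) (fun x hx => ?_) (left_mem_segment ℝ W W')
    (right_mem_segment ℝ W W')
  · rw [Real.norm_eq_abs] at h
    linarith [sq (‖W' - W‖)]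
  · have hxρ : ‖x‖ ≤ ρ := by
      have : segment ℝ W W' ⊆ Metric.closedBall 0 ρ :=
        (convex_closedBall 0 ρ).segment_subset (by simpa using hW) (by simpa using hW')
      simpa using this hx
    exact (hC x W hxρ hW).trans
      (mul_le_mul_of_nonneg_left (norm_sub_of_mem_segment_le hx) hC0)

/-- Uniform bounds for `expFactor` and its derivative on bounded sets of parameters. -/
theorem exists_expFactor_bounds (κ L ρ : ℝ) (hκ : 0 ≤ κ) (hL : 0 ≤ L) (hρ : 0 ≤ ρ) :
    ∃ C : ℝ, 0 ≤ C ∧ ∀ c₀ c₁ : ℝ, ∀ q r : E, |c₀| ≤ κ → |c₁| ≤ κ → ‖q‖ ≤ L → ‖r‖ ≤ L →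
      ∀ W W' : E, ‖W‖ ≤ ρ → ‖W'‖ ≤ ρ →
        |expFactor c₀ c₁ q r W| ≤ C ∧ ‖expFactorD c₀ c₁ q r W‖ ≤ C ∧
        ‖expFactorD c₀ c₁ q r W - expFactorD c₀ c₁ q r W'‖ ≤ C * ‖W - W'‖ ∧
        |expFactor c₀ c₁ q r W' - expFactor c₀ c₁ q r W - expFactorD c₀ c₁ q r W (W' - W)| ≤
          C * ‖W' - W‖ ^ 2 := by
  set C₁ := κ * (1 + L * ρ) * Real.exp (L * ρ)
  set C₂ := Real.exp (L * ρ) * (κ * (1 + L * ρ) * L + κ * L)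
  set C₃ := Real.exp (L * ρ) * (L * (κ * (1 + L * ρ) * L + κ * L) + κ * L * L)
  have h1 : 0 ≤ C₁ := by positivity
  have h2 : 0 ≤ C₂ := by positivity
  have h3 : 0 ≤ C₃ := by positivity
  refine ⟨C₁ + C₂ + C₃, by positivity, fun c₀ c₁ q r h₀ h₁ hq hr W W' hW hW' => ⟨?_, ?_, ?_, ?_⟩⟩
  · linarith [abs_expFactor_le h₀ h₁ hq hr hW]
  · linarith [norm_expFactorD_le h₀ h₁ hq hr hW]
  · refine (norm_expFactorD_sub_le h₀ h₁ hq hr hW hW').trans ?_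
    exact mul_le_mul_of_nonneg_right (by linarith) (norm_nonneg _)
  · refine (taylor_of_lipschitz_deriv (ρ := ρ) (fun x => hasFDerivAt_expFactor c₀ c₁ q r x)
      (fun x y hx hy => norm_expFactorD_sub_le h₀ h₁ hq hr hx hy) h3 hW hW').trans ?_
    exact mul_le_mul_of_nonneg_right (by linarith) (sq_nonneg _)

theorem expFactor_continuous : Continuous fun x : (ℝ × ℝ) × (E × E) × E =>
    expFactor x.1.1 x.1.2 x.2.1.1 x.2.1.2 x.2.2 := by
  unfold expFactor
  fun_prop

theorem expFactorD_continuous : Continuous fun x : (ℝ × ℝ) × (E × E) × E =>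
    expFactorD x.1.1 x.1.2 x.2.1.1 x.2.1.2 x.2.2 := by
  unfold expFactorD
  have h : Continuous fun v : E => innerSL ℝ v := (innerSL ℝ (E := E)).continuous
  have h₁ : Continuous fun x : (ℝ × ℝ) × (E × E) × E => innerSL ℝ x.2.1.1 := h.comp (by fun_prop)
  have h₂ : Continuous fun x : (ℝ × ℝ) × (E × E) × E => innerSL ℝ x.2.1.2 := h.comp (by fun_prop)
  fun_prop

/-- The vector valued integrand of the nonlinear term. -/
def expVec (ω c₀ c₁ : ℝ) (q r ψ W : E) : E := (ω * expFactor c₀ c₁ q r W) • ψ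

/-- The derivative of `expVec` in `W`. -/
def expVecD (ω c₀ c₁ : ℝ) (q r ψ W : E) : E →L[ℝ] E :=
  ω • (expFactorD c₀ c₁ q r W).smulRight ψ

theorem smulRight_sub_smulRight (T T' : E →L[ℝ] ℝ) (v : E) :
    T.smulRight v - T'.smulRight v = (T - T').smulRight v := by
  ext V
  simp [sub_smul]

/-- Uniform bounds for `expVec` and its derivative on bounded sets of parameters. -/
theorem exists_expVec_bounds (s κ L B ρ : ℝ) (hs : 0 ≤ s) (hκ : 0 ≤ κ) (hL : 0 ≤ L) (hB : 0 ≤ B)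
    (hρ : 0 ≤ ρ) :
    ∃ C : ℝ, 0 ≤ C ∧ ∀ ω c₀ c₁ : ℝ, ∀ q r ψ : E, |ω| ≤ s → |c₀| ≤ κ → |c₁| ≤ κ → ‖q‖ ≤ L →
      ‖r‖ ≤ L → ‖ψ‖ ≤ B → ∀ W W' : E, ‖W‖ ≤ ρ → ‖W'‖ ≤ ρ →
        ‖expVec ω c₀ c₁ q r ψ W‖ ≤ C ∧ ‖expVecD ω c₀ c₁ q r ψ W‖ ≤ C ∧
        ‖expVecD ω c₀ c₁ q r ψ W - expVecD ω c₀ c₁ q r ψ W'‖ ≤ C * ‖W - W'‖ ∧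
        ‖expVec ω c₀ c₁ q r ψ W' - expVec ω c₀ c₁ q r ψ W -
          expVecD ω c₀ c₁ q r ψ W (W' - W)‖ ≤ C * ‖W' - W‖ ^ 2 := by
  obtain ⟨C, hC0, hC⟩ := exists_expFactor_bounds (E := E) κ L ρ hκ hL hρ
  refine ⟨s * C * B, by positivity, fun ω c₀ c₁ q r ψ hω h₀ h₁ hq hr hψ W W' hW hW' => ?_⟩
  obtain ⟨h1, h2, h3, h4⟩ := hC c₀ c₁ q r h₀ h₁ hq hr W W' hW hW'
  have key : ∀ x t : ℝ, |x| ≤ C * t → 0 ≤ t → ‖(ω * x) • ψ‖ ≤ s * C * B * t := by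
    intro x t hx ht
    rw [norm_smul, norm_mul, Real.norm_eq_abs, Real.norm_eq_abs]
    calc _ ≤ s * (C * t) * B :=
          mul_le_mul (mul_le_mul hω hx (abs_nonneg _) hs) hψ (norm_nonneg _) (by positivity)
      _ = _ := by ring
  have keyD : ∀ (T : E →L[ℝ] ℝ) (t : ℝ), ‖T‖ ≤ C * t → 0 ≤ t →
      ‖ω • T.smulRight ψ‖ ≤ s * C * B * t := by
    intro T t hT ht
    rw [norm_smul, Real.norm_eq_abs, ContinuousLinearMap.norm_smulRight_apply]
    calc _ ≤ s * ((C * t) * B) :=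
          mul_le_mul hω (mul_le_mul hT hψ (norm_nonneg _) (by positivity)) (by positivity) hs
      _ = _ := by ring
  refine ⟨?_, ?_, ?_, ?_⟩
  · simpa [expVec] using key _ 1 (by simpa using h1) zero_le_one
  · simpa [expVecD] using keyD _ 1 (by simpa using h2) zero_le_one
  · have h := keyD _ _ h3 (norm_nonneg _)
    rw [← smulRight_sub_smulRight, smul_sub] at h
    exact h
  · refine le_trans (le_of_eq ?_) (key _ _ h4 (sq_nonneg _))
    rw [expVec, expVec, expVecD, _root_.smul_apply,
      ContinuousLinearMap.smulRight_apply, smul_smul, ← sub_smul, ← sub_smul]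
    congr 2
    ring

theorem expVec_continuous : Continuous fun x : (ℝ × ℝ × ℝ) × (E × E × E) × E =>
    expVec x.1.1 x.1.2.1 x.1.2.2 x.2.1.1 x.2.1.2.1 x.2.1.2.2 x.2.2 := by
  unfold expVec
  have h := (expFactor_continuous (E := E)).comp
    (f := fun x : (ℝ × ℝ × ℝ) × (E × E × E) × E => (x.1.2, (x.2.1.1, x.2.1.2.1), x.2.2))
    (by fun_prop)
  exact (Continuous.mul (by fun_prop) h).smul (by fun_prop)

theorem expVecD_continuous : Continuous fun x : (ℝ × ℝ × ℝ) × (E × E × E) × E =>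
    expVecD x.1.1 x.1.2.1 x.1.2.2 x.2.1.1 x.2.1.2.1 x.2.1.2.2 x.2.2 := by
  unfold expVecD
  have h := (expFactorD_continuous (E := E)).comp
    (f := fun x : (ℝ × ℝ × ℝ) × (E × E × E) × E => (x.1.2, (x.2.1.1, x.2.1.2.1), x.2.2))
    (by fun_prop)
  have h' : Continuous fun x : (E →L[ℝ] ℝ) × E => x.1.smulRight x.2 :=
    isBoundedBilinearMap_smulRight.continuous
  have h₁ : Continuous fun x : (ℝ × ℝ × ℝ) × (E × E × E) × E => x.2.1.2.2 := by fun_prop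
  have h₂ : Continuous fun x : (ℝ × ℝ × ℝ) × (E × E × E) × E => x.1.1 := by fun_prop
  exact h₂.smul (h'.comp (h.prodMk h₁))

end ExpFactor

end

section

/-! ### The nonlinear term as an integral over the square -/

theorem isOpen_Omega (n : ℕ) (A a b : ℝ) : IsOpen (Omega n A a b) := by
  have : Omega n A a b = (univ.pi fun _ => Ioo (-A) A) ×ˢ Ioo a b :=
    Set.ext fun X => ⟨fun h => ⟨fun i _ => h.1 i, h.2⟩, fun h => ⟨fun i => h.1 i (mem_univ _), h.2⟩⟩
  rw [this]
  exact (isOpen_set_pi finite_univ fun _ _ => isOpen_Ioo).prod isOpen_Ioo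

theorem Omega_subset_OmegaBar (n : ℕ) (A a b : ℝ) : Omega n A a b ⊆ OmegaBar n A a b :=
  fun _ hX => ⟨fun i => Ioo_subset_Icc_self (hX.1 i), Ioo_subset_Icc_self hX.2⟩

/-- The open square `(-d, d)²`. -/
def phaseSq (d : ℝ) : Set (ℝ × ℝ) := Ioo (-d) d ×ˢ Ioo (-d) d

theorem isOpen_phaseSq (d : ℝ) : IsOpen (phaseSq d) := isOpen_Ioo.prod isOpen_Ioo

theorem volume_phaseSq_lt_top (d : ℝ) : volume (phaseSq d) < ⊤ := by
  rw [phaseSq, Measure.volume_eq_prod, Measure.prod_prod, Real.volume_Ioo]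
  exact ENNReal.mul_lt_top ENNReal.ofReal_lt_top ENNReal.ofReal_lt_top

/-- The domain on which the phase function is differentiable. -/
def phaseInt (n : ℕ) (A a b d : ℝ) : Set (Pt n × (ℝ × ℝ)) := Omega n A a b ×ˢ phaseSq d

theorem isOpen_phaseInt (n : ℕ) (A a b d : ℝ) : IsOpen (phaseInt n A a b d) :=
  (isOpen_Omega n A a b).prod (isOpen_phaseSq d)

theorem phaseInt_subset (n : ℕ) (A a b d : ℝ) : phaseInt n A a b d ⊆ phaseDomain n A a b d :=
  prod_mono (Omega_subset_OmegaBar n A a b) (prod_mono Ioo_subset_Icc_self Ioo_subset_Icc_self)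

/-- The hypotheses bound the derivative of `K` within the closed domain. In the interior this is the
ordinary derivative, and the interior suffices because the integrals ignore the boundary of the
square. -/
theorem phaseDomain_mem_nhds {n : ℕ} {A a b d : ℝ} {z : Pt n × (ℝ × ℝ)}
    (hz : z ∈ phaseInt n A a b d) : phaseDomain n A a b d ∈ nhds z :=
  Filter.mem_of_superset ((isOpen_phaseInt n A a b d).mem_nhds hz) (phaseInt_subset n A a b d)

/-- The derivative of the phase function in `α`. -/
def kerD {n : ℕ} (K : Pt n → ℝ → ℝ → ℝ) (X : Pt n) (z : ℝ × ℝ) : ℝ :=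
  fderiv ℝ (fun z : Pt n × (ℝ × ℝ) => K z.1 z.2.1 z.2.2) (X, z) (0, (1, 0))

namespace IsMedium

variable {n : ℕ} {A a b d κ σ : ℝ} {K : Pt n → ℝ → ℝ → ℝ} {μs : Pt n → ℝ}
  (hM : IsMedium n A a b d κ σ K μs)

include hM

theorem abs_kerD_le {X : Pt n} (hX : X ∈ Omega n A a b) {z : ℝ × ℝ} (hz : z ∈ phaseSq d) :
    |kerD K X z| ≤ κ := by
  have hz' : (X, z) ∈ phaseInt n A a b d := ⟨hX, hz⟩
  have h := hM.K_deriv_le _ (phaseInt_subset n A a b d hz')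
  rw [fderivWithin_of_mem_nhds (phaseDomain_mem_nhds hz')] at h
  refine (ContinuousLinearMap.le_opNorm _ _).trans ((mul_le_of_le_one_right (norm_nonneg _) ?_).trans h)
  simp [Prod.norm_def]

theorem abs_K_le {X : Pt n} (hX : X ∈ Omega n A a b) {z : ℝ × ℝ} (hz : z ∈ phaseSq d) :
    |K X z.1 z.2| ≤ κ :=
  hM.K_le (X, z) (phaseInt_subset n A a b d ⟨hX, hz⟩)

theorem hasDerivAt_K {X : Pt n} (hX : X ∈ Omega n A a b) {z : ℝ × ℝ} (hz : z ∈ phaseSq d) :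
    HasDerivAt (fun α => K X α z.2) (kerD K X z) z.1 := by
  have hz' : (X, z) ∈ phaseInt n A a b d := ⟨hX, hz⟩
  have h1 := ((hM.K_contDiffOn.contDiffAt (phaseDomain_mem_nhds hz')).differentiableAt
    (by norm_num)).hasFDerivAt
  have h2 : HasDerivAt (fun α : ℝ => ((X, (α, z.2)) : Pt n × (ℝ × ℝ))) (0, (1, 0)) z.1 :=
    (hasDerivAt_const z.1 X).prodMk ((hasDerivAt_id z.1).prodMk (hasDerivAt_const z.1 z.2))
  exact HasFDerivAt.comp_hasDerivAt (f := fun α : ℝ => ((X, (α, z.2)) : Pt n × (ℝ × ℝ))) z.1 h1 h2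

theorem continuousOn_K :
    ContinuousOn (fun z : Pt n × (ℝ × ℝ) => K z.1 z.2.1 z.2.2) (phaseInt n A a b d) :=
  hM.K_contDiffOn.continuousOn.mono (phaseInt_subset n A a b d)

theorem continuousOn_kerD :
    ContinuousOn (fun z : Pt n × (ℝ × ℝ) => kerD K z.1 z.2) (phaseInt n A a b d) :=
  ((hM.K_contDiffOn.mono (phaseInt_subset n A a b d)).continuousOn_fderiv_of_isOpen
    (isOpen_phaseInt n A a b d) (by norm_num)).clm_apply continuousOn_const

theorem abs_μs_le (X : Pt n) : |μs X| ≤ σ := by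
  rw [abs_of_nonneg (hM.μs_nonneg X)]
  exact hM.μs_le X

end IsMedium

theorem exists_bound_inv_nuY (n : ℕ) [NeZero n] (A d b : ℝ) {a : ℝ} (ha : 0 < a) :
    ∃ C : ℝ, 0 ≤ C ∧ ∀ X ∈ OmegaBar n A a b, ∀ α ∈ Icc (-d) d, |(nuY X α)⁻¹| ≤ C := by
  obtain ⟨C, hC⟩ := ((isCompact_OmegaBar (n := n) A a b).prod
    (isCompact_Icc (a := -d) (b := d))).exists_bound_of_continuousOn
    (f := fun z : Pt n × ℝ => srcDist z.1 z.2 / z.1.2)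
    (srcDist_continuous.continuousOn.div (Continuous.continuousOn (by fun_prop))
      fun z hz => (ha.trans_le hz.1.2.1).ne')
  refine ⟨|C|, abs_nonneg C, fun X hX α hα => ?_⟩
  rw [nuY, inv_div]
  exact (hC (X, α) ⟨hX, hα⟩).trans (le_abs_self C)

variable {n : ℕ} [NeZero n]

/-- The integrand of the nonlinear term. -/
def nlKer {N : ℕ} (d : ℝ) (K : Pt n → ℝ → ℝ → ℝ) (μs : Pt n → ℝ) (W : Vec N) (X : Pt n)
    (z : ℝ × ℝ) : Vec N :=
  expVec (-(μs X / nuY X z.1)) (K X z.1 z.2) (kerD K X z) (psiVec' N d z.1)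
    (psiVec N d z.2 - psiVec N d z.1) (psiVec N d z.1) W

/-- The derivative in `W` of the integrand of the nonlinear term. -/
def nlKerD {N : ℕ} (d : ℝ) (K : Pt n → ℝ → ℝ → ℝ) (μs : Pt n → ℝ) (W : Vec N) (X : Pt n)
    (z : ℝ × ℝ) : Vec N →L[ℝ] Vec N :=
  expVecD (-(μs X / nuY X z.1)) (K X z.1 z.2) (kerD K X z) (psiVec' N d z.1)
    (psiVec N d z.2 - psiVec N d z.1) (psiVec N d z.1) W

/-- The derivative in `W` of the nonlinear term. -/
def nonlinD {N : ℕ} (d : ℝ) (K : Pt n → ℝ → ℝ → ℝ) (μs : Pt n → ℝ) (W : Vec N) (X : Pt n) :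
    Vec N →L[ℝ] Vec N :=
  ∫ z in phaseSq d, nlKerD d K μs W X z

/-- `C` is chosen before `K` and `μs`, so it depends on the medium only through `κ` and `σ`. -/
theorem exists_nlKer_bounds (n N : ℕ) [NeZero n] (A b κ σ ρ : ℝ) {d a : ℝ} (hd : 0 < d)
    (ha : 0 < a) (hρ : 0 ≤ ρ) :
    ∃ C : ℝ, 0 ≤ C ∧ ∀ (K : Pt n → ℝ → ℝ → ℝ) (μs : Pt n → ℝ), IsMedium n A a b d κ σ K μs →
      ∀ X ∈ Omega n A a b, ∀ z ∈ phaseSq d, ∀ W W' : Vec N, ‖W‖ ≤ ρ → ‖W'‖ ≤ ρ →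
        ‖nlKer d K μs W X z‖ ≤ C ∧ ‖nlKerD d K μs W X z‖ ≤ C ∧
        ‖nlKerD d K μs W X z - nlKerD d K μs W' X z‖ ≤ C * ‖W - W'‖ ∧
        ‖nlKer d K μs W' X z - nlKer d K μs W X z - nlKerD d K μs W X z (W' - W)‖ ≤
          C * ‖W' - W‖ ^ 2 := by
  obtain ⟨B₁, hB₁⟩ := isCompact_Icc.exists_bound_of_continuousOn (s := Icc (-d) d)
    (psiVec_continuous hd N).continuousOn
  obtain ⟨B₂, hB₂⟩ := isCompact_Icc.exists_bound_of_continuousOn (s := Icc (-d) d)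
    (psiVec'_continuous hd N).continuousOn
  have h0 : (0 : ℝ) ∈ Icc (-d) d := ⟨by linarith, hd.le⟩
  have hB₁0 : 0 ≤ B₁ := (norm_nonneg _).trans (hB₁ 0 h0)
  have hB₂0 : 0 ≤ B₂ := (norm_nonneg _).trans (hB₂ 0 h0)
  obtain ⟨Cν, hCν0, hCν⟩ := exists_bound_inv_nuY n A d b ha
  -- Absolute values, because `κ` and `σ` carry no sign hypothesis. The radius `2 * B₁ + B₂` serves
  -- both `q = Ψ'(α)` and `r = Ψ(β) - Ψ(α)`.
  obtain ⟨C, hC0, hC⟩ := exists_expVec_bounds (E := Vec N) (|σ| * Cν) |κ| (2 * B₁ + B₂) B₁ ρ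
    (by positivity) (abs_nonneg κ) (by positivity) hB₁0 hρ
  refine ⟨C, hC0, fun K μs hM X hX z hz W W' hW hW' => ?_⟩
  have hα : z.1 ∈ Icc (-d) d := Ioo_subset_Icc_self hz.1
  have hβ : z.2 ∈ Icc (-d) d := Ioo_subset_Icc_self hz.2
  have hω : |-(μs X / nuY X z.1)| ≤ |σ| * Cν := by
    rw [abs_neg, div_eq_mul_inv, abs_mul]
    exact mul_le_mul ((hM.abs_μs_le X).trans (le_abs_self σ))
      (hCν X (Omega_subset_OmegaBar n A a b hX) _ hα) (abs_nonneg _) (abs_nonneg _)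
  exact hC _ _ _ _ _ _ hω ((hM.abs_K_le hX hz).trans (le_abs_self κ))
    ((hM.abs_kerD_le hX hz).trans (le_abs_self κ)) (by linarith [hB₂ _ hα])
    ((norm_sub_le _ _).trans (by linarith [hB₁ _ hα, hB₁ _ hβ])) (hB₁ _ hα) W W' hW hW'

section Continuity

variable {A a b d κ σ : ℝ} {K : Pt n → ℝ → ℝ → ℝ} {μs : Pt n → ℝ}
  (hM : IsMedium n A a b d κ σ K μs)

include hM

theorem continuousOn_weight (ha : 0 < a) (Y : Type*) [TopologicalSpace Y] :
    ContinuousOn (fun q : (Y × Pt n) × (ℝ × ℝ) => -(μs q.1.2 / nuY q.1.2 q.2.1))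
      ((univ ×ˢ Omega n A a b) ×ˢ phaseSq d) := by
  have hpos : ∀ q : (Y × Pt n) × (ℝ × ℝ), q ∈ (univ ×ˢ Omega n A a b) ×ˢ phaseSq d →
      0 < q.1.2.2 := fun q hq => ha.trans hq.1.2.2.1
  have h1 : Continuous fun q : (Y × Pt n) × (ℝ × ℝ) => srcDist q.1.2 q.2.1 :=
    srcDist_continuous.comp (f := fun q : (Y × Pt n) × (ℝ × ℝ) => (q.1.2, q.2.1)) (by fun_prop)
  have h2 : Continuous fun q : (Y × Pt n) × (ℝ × ℝ) => μs q.1.2 :=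
    hM.μs_contDiff.continuous.comp (by fun_prop)
  refine (h2.continuousOn.div (ContinuousOn.div (Continuous.continuousOn (by fun_prop))
    h1.continuousOn fun q hq => (srcDist_pos (hpos q hq) _).ne') fun q hq => ?_).neg
  exact (div_pos (hpos q hq) (srcDist_pos (hpos q hq) _)).ne'

theorem continuousOn_nlArgs (N : ℕ) (hd : 0 < d) (ha : 0 < a) :
    ContinuousOn (fun q : (Vec N × Pt n) × (ℝ × ℝ) =>
      (((-(μs q.1.2 / nuY q.1.2 q.2.1), K q.1.2 q.2.1 q.2.2, kerD K q.1.2 q.2),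
        ((psiVec' N d q.2.1, psiVec N d q.2.2 - psiVec N d q.2.1, psiVec N d q.2.1), q.1.1)) :
        (ℝ × ℝ × ℝ) × (Vec N × Vec N × Vec N) × Vec N))
      ((univ ×ˢ Omega n A a b) ×ˢ phaseSq d) := by
  have hmaps : MapsTo (fun q : (Vec N × Pt n) × (ℝ × ℝ) => ((q.1.2, q.2) : Pt n × (ℝ × ℝ)))
      ((univ ×ˢ Omega n A a b) ×ˢ phaseSq d) (phaseInt n A a b d) := fun q hq => ⟨hq.1.2, hq.2⟩
  have h3 := psiVec_continuous hd N
  have h4 := psiVec'_continuous hd N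
  refine ContinuousOn.prodMk (ContinuousOn.prodMk (continuousOn_weight hM ha (Vec N))
    (ContinuousOn.prodMk ?_ ?_)) (Continuous.continuousOn (by fun_prop))
  · exact hM.continuousOn_K.comp (Continuous.continuousOn (by fun_prop)) hmaps
  · exact hM.continuousOn_kerD.comp (Continuous.continuousOn (by fun_prop)) hmaps

theorem continuousOn_nlKer (N : ℕ) (hd : 0 < d) (ha : 0 < a) :
    ContinuousOn (fun q : (Vec N × Pt n) × (ℝ × ℝ) => nlKer d K μs q.1.1 q.1.2 q.2)
      ((univ ×ˢ Omega n A a b) ×ˢ phaseSq d) :=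
  expVec_continuous.comp_continuousOn (continuousOn_nlArgs hM N hd ha)

theorem continuousOn_nlKerD (N : ℕ) (hd : 0 < d) (ha : 0 < a) :
    ContinuousOn (fun q : (Vec N × Pt n) × (ℝ × ℝ) => nlKerD d K μs q.1.1 q.1.2 q.2)
      ((univ ×ˢ Omega n A a b) ×ˢ phaseSq d) :=
  expVecD_continuous.comp_continuousOn (continuousOn_nlArgs hM N hd ha)

end Continuity

end

/-! ### Differentiation under the integral, and bounds and continuity of the nonlinear term -/

section

section ParamIntegral

variable {Y Z E : Type*} [TopologicalSpace Y] [TopologicalSpace Z]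
  [MeasurableSpace Z] [OpensMeasurableSpace Z] [NormedAddCommGroup E] {μ : Measure Z}

theorem integrableOn_of_continuousOn_of_bound {S : Set Z} [SecondCountableTopologyEither Z E]
    (hS : MeasurableSet S) (hμ : μ S < ⊤)
    {f : Z → E} {C : ℝ} (hf : ContinuousOn f S) (hC : ∀ z ∈ S, ‖f z‖ ≤ C) :
    IntegrableOn f S μ :=
  IntegrableOn.of_bound hμ (hf.aestronglyMeasurable hS) C
    ((ae_restrict_iff' hS).2 (Filter.Eventually.of_forall hC))

/-- Continuity of an integral which depends on a parameter, for a locally bounded integrand. -/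
theorem continuousOn_setIntegral_of_locally_bounded [NormedSpace ℝ E]
    [FirstCountableTopology Y] {S : Set Z} [SecondCountableTopologyEither Z E]
    {U : Set Y} (hU : IsOpen U) (hS : MeasurableSet S) (hS' : IsOpen S) (hμ : μ S < ⊤)
    {f : Y → Z → E} (hf : ContinuousOn (fun q : Y × Z => f q.1 q.2) (U ×ˢ S))
    (hb : ∀ x ∈ U, ∃ C, ∀ᶠ y in nhds x, ∀ z ∈ S, ‖f y z‖ ≤ C) :
    ContinuousOn (fun y => ∫ z in S, f y z ∂μ) U := by
  intro x hx
  obtain ⟨C, hC⟩ := hb x hx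
  refine (continuousAt_of_dominated (bound := fun _ => C) ?_ ?_ ?_ ?_).continuousWithinAt
  · filter_upwards [hU.mem_nhds hx] with y hy
    exact ContinuousOn.aestronglyMeasurable (hf.comp (f := fun z => (y, z)) (by fun_prop)
      fun z hz => ⟨hy, hz⟩) hS
  · filter_upwards [hC] with y hy
    -- Dominated convergence with a constant majorant, integrable because `S` has finite measure.
    exact (ae_restrict_iff' hS).2 (Filter.Eventually.of_forall hy)
  · exact integrableOn_const hμ.ne
  · refine (ae_restrict_iff' hS).2 (Filter.Eventually.of_forall fun z hz => ?_)
    have h := hf.continuousAt ((hU.prod hS').mem_nhds (show (x, z) ∈ U ×ˢ S from ⟨hx, hz⟩))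
    exact ContinuousAt.comp (f := fun y => (y, z)) h (by fun_prop)

end ParamIntegral

variable {n : ℕ} {A a b d κ σ : ℝ} {K : Pt n → ℝ → ℝ → ℝ} {μs : Pt n → ℝ}

theorem measurableSet_phaseSq (d : ℝ) : MeasurableSet (phaseSq d) :=
  (isOpen_phaseSq d).measurableSet

theorem integrableOn_nlKer [NeZero n] {N : ℕ} (hM : IsMedium n A a b d κ σ K μs) (hd : 0 < d) (ha : 0 < a)
    {X : Pt n} (hX : X ∈ Omega n A a b) (W : Vec N) :
    IntegrableOn (nlKer d K μs W X) (phaseSq d) := by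
  obtain ⟨C, -, hC⟩ := exists_nlKer_bounds n N A b κ σ ‖W‖ hd ha (norm_nonneg W)
  refine integrableOn_of_continuousOn_of_bound (measurableSet_phaseSq d) (volume_phaseSq_lt_top d)
    ?_ fun z hz => (hC K μs hM X hX z hz W W le_rfl le_rfl).1
  exact (continuousOn_nlKer hM N hd ha).comp (f := fun z => ((W, X), z)) (by fun_prop)
    fun z hz => ⟨⟨mem_univ _, hX⟩, hz⟩

theorem integrableOn_nlKerD [NeZero n] {N : ℕ} (hM : IsMedium n A a b d κ σ K μs) (hd : 0 < d) (ha : 0 < a)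
    {X : Pt n} (hX : X ∈ Omega n A a b) (W : Vec N) :
    IntegrableOn (nlKerD d K μs W X) (phaseSq d) := by
  obtain ⟨C, -, hC⟩ := exists_nlKer_bounds n N A b κ σ ‖W‖ hd ha (norm_nonneg W)
  refine integrableOn_of_continuousOn_of_bound (measurableSet_phaseSq d) (volume_phaseSq_lt_top d)
    ?_ fun z hz => (hC K μs hM X hX z hz W W le_rfl le_rfl).2.1
  exact (continuousOn_nlKerD hM N hd ha).comp (f := fun z => ((W, X), z)) (by fun_prop)
    fun z hz => ⟨⟨mem_univ _, hX⟩, hz⟩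

/-- The derivative in `α` of the source term. -/
theorem hasDerivAt_source {N : ℕ} (hM : IsMedium n A a b d κ σ K μs) (hd : 0 < d)
    {X : Pt n} (hX : X ∈ Omega n A a b) (W : Vec N) {α : ℝ} (hα : α ∈ Ioo (-d) d) :
    HasDerivAt (fun α' => Real.exp (-series d W α') *
        ∫ β in (-d)..d, K X α' β * Real.exp (series d W β))
      (∫ β in Ioo (-d) d, expFactor (K X α β) (kerD K X (α, β)) (psiVec' N d α)
        (psiVec N d β - psiVec N d α) W) α := by
  have hser : Continuous (series d W) := by
    simp only [funext (series_eq_inner d W)]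
    have := psiVec_continuous hd N
    fun_prop
  obtain ⟨B, hB⟩ := (isCompact_Icc (a := -d) (b := d)).exists_bound_of_continuousOn
    (f := fun β => Real.exp (series d W β)) (by fun_prop)
  have hvol : volume (Ioo (-d) d) < ⊤ := by simp
  have hcont : ∀ α' ∈ Ioo (-d) d, ContinuousOn (fun β => K X α' β * Real.exp (series d W β))
      (Ioo (-d) d) := fun α' hα' => ContinuousOn.mul
    (hM.continuousOn_K.comp (f := fun β => (X, (α', β))) (by fun_prop)
      fun β hβ => ⟨hX, hα', hβ⟩) (by fun_prop)
  have hcontD : ∀ α' ∈ Ioo (-d) d, ContinuousOn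
      (fun β => kerD K X (α', β) * Real.exp (series d W β)) (Ioo (-d) d) :=
    fun α' hα' => ContinuousOn.mul
      (hM.continuousOn_kerD.comp (f := fun β => (X, (α', β))) (by fun_prop)
        fun β hβ => ⟨hX, hα', hβ⟩) (by fun_prop)
  have hbd : ∀ α' ∈ Ioo (-d) d, ∀ β ∈ Ioo (-d) d,
      ‖K X α' β * Real.exp (series d W β)‖ ≤ κ * B := fun α' hα' β hβ => by
    have h1 := hM.abs_K_le (z := (α', β)) hX ⟨hα', hβ⟩
    rw [norm_mul]
    exact mul_le_mul h1 (hB β (Ioo_subset_Icc_self hβ)) (norm_nonneg _) ((abs_nonneg _).trans h1)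
  have hbdD : ∀ α' ∈ Ioo (-d) d, ∀ β ∈ Ioo (-d) d,
      ‖kerD K X (α', β) * Real.exp (series d W β)‖ ≤ κ * B := fun α' hα' β hβ => by
    have h1 := hM.abs_kerD_le (z := (α', β)) hX ⟨hα', hβ⟩
    rw [norm_mul]
    exact mul_le_mul h1 (hB β (Ioo_subset_Icc_self hβ)) (norm_nonneg _) ((abs_nonneg _).trans h1)
  have hInt := integrableOn_of_continuousOn_of_bound (μ := volume) measurableSet_Ioo hvol (hcont α hα)
    (hbd α hα)
  have key := hasDerivAt_integral_of_dominated_loc_of_deriv_le (μ := volume.restrict (Ioo (-d) d))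
    (F := fun α' β => K X α' β * Real.exp (series d W β))
    (F' := fun α' β => kerD K X (α', β) * Real.exp (series d W β))
    (bound := fun _ => κ * B) (isOpen_Ioo.mem_nhds hα)
    (by
      filter_upwards [isOpen_Ioo.mem_nhds hα] with α' hα'
      exact (hcont α' hα').aestronglyMeasurable measurableSet_Ioo)
    hInt
    ((hcontD α hα).aestronglyMeasurable measurableSet_Ioo)
    ((ae_restrict_iff' measurableSet_Ioo).2 (Filter.Eventually.of_forall
      fun β hβ α' hα' => hbdD α' hα' β hβ))
    (integrableOn_const hvol.ne)
    ((ae_restrict_iff' measurableSet_Ioo).2 (Filter.Eventually.of_forall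
      fun β hβ α' hα' => (hM.hasDerivAt_K (z := (α', β)) hX ⟨hα', hβ⟩).mul_const _))
  have hconv : ∀ α', ∫ β in (-d)..d, K X α' β * Real.exp (series d W β) =
      ∫ β in Ioo (-d) d, K X α' β * Real.exp (series d W β) := fun α' => by
    rw [intervalIntegral.integral_of_le (by linarith), integral_Ioc_eq_integral_Ioo]
  simp only [hconv]
  -- Product rule: the exponential contributes `-w'(α)` and the integral contributes `∂_α K`. Under
  -- one integral sign the exponentials combine to `e^{w(β) - w(α)}`, which gives `expFactor`.
  refine ((series_hasDerivAt hd W α).neg.exp.mul key.2).congr_deriv ?_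
  rw [← integral_const_mul, ← integral_const_mul, ← integral_add (hInt.const_mul _)
    (key.1.const_mul _)]
  refine integral_congr_ae (Filter.Eventually.of_forall fun β => ?_)
  simp only [expFactor, inner_sub_left, ← series_eq_inner, Pi.neg_apply]
  rw [sub_eq_add_neg (series d W β), Real.exp_add]
  ring

/-- After the derivative in `α` is carried out, Fubini turns each component into an integral over
the square; the endpoints have measure zero. All properties of `nonlin` are then inherited from the
smooth integrand. -/
theorem nonlin_eq_integral [NeZero n] {N : ℕ} (hM : IsMedium n A a b d κ σ K μs) (hd : 0 < d) (ha : 0 < a)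
    {X : Pt n} (hX : X ∈ Omega n A a b) (W : Vec N) :
    nonlin d K μs W X = ∫ z in phaseSq d, nlKer d K μs W X z := by
  have hint := integrableOn_nlKer hM hd ha hX W
  ext k
  have h1 : (∫ z in phaseSq d, nlKer d K μs W X z) k = ∫ z in phaseSq d, nlKer d K μs W X z k :=
    ((EuclideanSpace.proj (𝕜 := ℝ) k).integral_comp_comm hint).symm
  have hint' : IntegrableOn (fun z => nlKer d K μs W X z k) (phaseSq d) :=
    (EuclideanSpace.proj (𝕜 := ℝ) k).integrable_comp hint
  rw [h1]
  rw [phaseSq, Measure.volume_eq_prod] at hint' ⊢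
  rw [setIntegral_prod _ hint']
  change ∫ α in (-d)..d, _ = _
  rw [intervalIntegral.integral_of_le (by linarith), integral_Ioc_eq_integral_Ioo]
  refine setIntegral_congr_fun measurableSet_Ioo fun α hα => ?_
  simp only [(hasDerivAt_source hM hd hX W hα).deriv]
  rw [← integral_const_mul, ← integral_mul_const]
  rfl

/-- The pointwise bounds are integrated over a square of finite area. The Taylor estimate is
integrated as well, so no separate differentiation in `W` under the integral is required. -/
theorem exists_nonlin_bounds (n N : ℕ) [NeZero n] (A b κ σ ρ : ℝ) {d a : ℝ} (hd : 0 < d)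
    (ha : 0 < a) (hρ : 0 ≤ ρ) :
    ∃ C : ℝ, 0 ≤ C ∧ ∀ (K : Pt n → ℝ → ℝ → ℝ) (μs : Pt n → ℝ), IsMedium n A a b d κ σ K μs →
      ∀ X ∈ Omega n A a b, ∀ W W' : Vec N, ‖W‖ ≤ ρ → ‖W'‖ ≤ ρ →
        ‖nonlin d K μs W X‖ ≤ C ∧ ‖nonlinD d K μs W X‖ ≤ C ∧
        ‖nonlinD d K μs W X - nonlinD d K μs W' X‖ ≤ C * ‖W - W'‖ ∧
        ‖nonlin d K μs W' X - nonlin d K μs W X - nonlinD d K μs W X (W' - W)‖ ≤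
          C * ‖W' - W‖ ^ 2 := by
  obtain ⟨C, hC0, hC⟩ := exists_nlKer_bounds n N A b κ σ ρ hd ha hρ
  set V := volume.real (phaseSq d)
  have hV : 0 ≤ V := measureReal_nonneg
  refine ⟨C * V, by positivity, fun K μs hM X hX W W' hW hW' => ?_⟩
  have hI := integrableOn_nlKer hM hd ha hX W
  have hI' := integrableOn_nlKer hM hd ha hX W'
  have hD := integrableOn_nlKerD hM hd ha hX W
  have hD' := integrableOn_nlKerD hM hd ha hX W'
  have hlt := volume_phaseSq_lt_top d
  rw [nonlin_eq_integral hM hd ha hX, nonlin_eq_integral hM hd ha hX, nonlinD, nonlinD]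
  refine ⟨?_, ?_, ?_, ?_⟩
  · exact norm_setIntegral_le_of_norm_le_const hlt fun z hz =>
      (hC K μs hM X hX z hz W W' hW hW').1
  · exact norm_setIntegral_le_of_norm_le_const hlt fun z hz =>
      (hC K μs hM X hX z hz W W' hW hW').2.1
  · rw [← integral_sub hD hD', mul_right_comm]
    exact norm_setIntegral_le_of_norm_le_const hlt fun z hz =>
      (hC K μs hM X hX z hz W W' hW hW').2.2.1
  · have h : Integrable (fun z => nlKer d K μs W' X z - nlKer d K μs W X z)
        (volume.restrict (phaseSq d)) := hI'.sub hI
    rw [ContinuousLinearMap.integral_apply hD, ← integral_sub hI' hI, ← integral_sub h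
      (hD.apply_continuousLinearMap _), mul_right_comm]
    exact norm_setIntegral_le_of_norm_le_const hlt fun z hz =>
      (hC K μs hM X hX z hz W W' hW hW').2.2.2

theorem eventually_norm_fst_le {E Y : Type*} [NormedAddCommGroup E] [TopologicalSpace Y]
    (q : E × Y) : ∀ᶠ q' : E × Y in nhds q, ‖q'.1‖ ≤ ‖q.1‖ + 1 := by
  have h : ContinuousAt (fun q' : E × Y => ‖q'.1‖) q := by fun_prop
  filter_upwards [h.eventually_lt_const (lt_add_one ‖q.1‖)] with q' hq' using hq'.le

/-- Joint continuity serves the measurability of `y ↦ nonlinD` along a grid function. The bound on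
the integrand depends on `‖W‖` and is therefore only local in `W`. -/
theorem continuousOn_nonlinD [NeZero n] (N : ℕ) (hM : IsMedium n A a b d κ σ K μs) (hd : 0 < d)
    (ha : 0 < a) : ContinuousOn (fun q : Vec N × Pt n => nonlinD d K μs q.1 q.2)
      (univ ×ˢ Omega n A a b) := by
  have hU : IsOpen ((univ : Set (Vec N)) ×ˢ Omega n A a b) := isOpen_univ.prod (isOpen_Omega n A a b)
  refine continuousOn_setIntegral_of_locally_bounded hU (measurableSet_phaseSq d)
    (isOpen_phaseSq d) (volume_phaseSq_lt_top d) (continuousOn_nlKerD hM N hd ha) fun q hq => ?_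
  obtain ⟨C, -, hC⟩ := exists_nlKer_bounds n N A b κ σ (‖q.1‖ + 1) hd ha (by positivity)
  refine ⟨C, ?_⟩
  filter_upwards [hU.mem_nhds hq, eventually_norm_fst_le q] with q' hq' hq2 z hz
  exact (hC K μs hM q'.2 hq'.2 z hz q'.1 q'.1 hq2 hq2).2.1

theorem continuousOn_nonlin [NeZero n] (N : ℕ) (hM : IsMedium n A a b d κ σ K μs) (hd : 0 < d)
    (ha : 0 < a) : ContinuousOn (fun q : Vec N × Pt n => nonlin d K μs q.1 q.2)
      (univ ×ˢ Omega n A a b) := by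
  have hU : IsOpen ((univ : Set (Vec N)) ×ˢ Omega n A a b) := isOpen_univ.prod (isOpen_Omega n A a b)
  refine (continuousOn_setIntegral_of_locally_bounded hU (measurableSet_phaseSq d)
    (isOpen_phaseSq d) (volume_phaseSq_lt_top d) (continuousOn_nlKer hM N hd ha)
    fun q hq => ?_).congr fun q hq => nonlin_eq_integral hM hd ha hq.2 q.1
  obtain ⟨C, -, hC⟩ := exists_nlKer_bounds n N A b κ σ (‖q.1‖ + 1) hd ha (by positivity)
  refine ⟨C, ?_⟩
  filter_upwards [hU.mem_nhds hq, eventually_norm_fst_le q] with q' hq' hq2 z hz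
  exact (hC K μs hM q'.2 hq'.2 z hz q'.1 q'.1 hq2 hq2).1

end

section

/-! ### One-dimensional estimates -/

/-- The Cauchy-Schwarz inequality for integrals of real functions. -/
theorem sq_integral_mul_le {X : Type*} [MeasurableSpace X] {μ : Measure X} {f g : X → ℝ}
    (hf : Integrable (fun x => f x ^ 2) μ) (hg : Integrable (fun x => g x ^ 2) μ)
    (hfg : Integrable (fun x => f x * g x) μ) :
    (∫ x, f x * g x ∂μ) ^ 2 ≤ (∫ x, f x ^ 2 ∂μ) * ∫ x, g x ^ 2 ∂μ := by
  -- The integral of `(f + t g)²` is a nonnegative quadratic polynomial in `t`, so its discriminant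
  -- is at most zero.
  have h : ∀ t : ℝ, 0 ≤ (∫ x, g x ^ 2 ∂μ) * (t * t) + (2 * ∫ x, f x * g x ∂μ) * t +
      ∫ x, f x ^ 2 ∂μ := by
    intro t
    have h0 : 0 ≤ ∫ x, (f x + t * g x) ^ 2 ∂μ := integral_nonneg fun x => sq_nonneg _
    have h1 : ∀ x, (f x + t * g x) ^ 2 = f x ^ 2 + (2 * t * (f x * g x) + t * t * g x ^ 2) :=
      fun x => by ring
    simp only [h1] at h0
    have h2 : Integrable (fun x => 2 * t * (f x * g x)) μ := hfg.const_mul _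
    have h3 : Integrable (fun x => t * t * g x ^ 2) μ := hg.const_mul _
    have h4 : Integrable (fun x => 2 * t * (f x * g x) + t * t * g x ^ 2) μ := h2.add h3
    rw [integral_add hf h4, integral_add h2 h3, integral_const_mul, integral_const_mul] at h0
    linarith
  have := discrim_le_zero h
  rw [discrim] at this
  linarith

/-! ### Functions of `H¹(a, b)` and the one-dimensional Carleman estimate -/

section Primitive

variable {N : ℕ} {a b : ℝ} {u : ℝ → Vec N}

/-- Keeping the prescribed density `g`, rather than an existential one, is what identifies the
derivative of a constructed primitive. -/
theorem ae_hasDerivAt_of_primitive {g : ℝ → Vec N} (hg : MemLp g 2 (volume.restrict (Ioo a b)))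
    (hgu : ∀ y ∈ Icc a b, u y = u a + ∫ t in a..y, g t) :
    ∀ᵐ y ∂(volume.restrict (Ioo a b)), HasDerivAt u (g y) y := by
  rcases le_or_gt b a with hab | hab
  · simp [Ioo_eq_empty_of_le hab]
  have hi : IntervalIntegrable g volume a b := by
    rw [intervalIntegrable_iff_integrableOn_Ioo_of_le hab.le]
    exact hg.integrable (by norm_num)
  rw [ae_restrict_iff' measurableSet_Ioo]
  filter_upwards [hi.ae_hasDerivAt_integral] with y hy hyab
  have h1 := hy (by rw [uIcc_of_le hab.le]; exact Ioo_subset_Icc_self hyab) a left_mem_uIcc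
  refine (h1.const_add (u a)).congr_of_eventuallyEq ?_
  filter_upwards [Ioo_mem_nhds hyab.1 hyab.2] with z hz
  exact hgu z (Ioo_subset_Icc_self hz)

theorem IsH1.integrableOn_deriv (hu : IsH1 a b u) : IntegrableOn (deriv u) (Ioo a b) :=
  hu.memLp_deriv.integrable (by norm_num)

theorem IsH1.integrableOn_sq (hu : IsH1 a b u) : IntegrableOn (fun t => ‖u t‖ ^ 2) (Ioo a b) :=
  (memLp_two_iff_integrable_sq_norm hu.memLp.1).1 hu.memLp

theorem IsH1.integrableOn_deriv_sq (hu : IsH1 a b u) :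
    IntegrableOn (fun t => ‖deriv u t‖ ^ 2) (Ioo a b) :=
  (memLp_two_iff_integrable_sq_norm hu.memLp_deriv.1).1 hu.memLp_deriv

/-- The fundamental theorem of calculus for functions of `H¹(a, b)`. -/
theorem IsH1.sub_eq_integral (hu : IsH1 a b u) {y z : ℝ} (hy : y ∈ Icc a b) (hz : z ∈ Icc a b)
    (hyz : y ≤ z) : u z - u y = ∫ t in Ioo y z, deriv u t := by
  obtain ⟨g, hg, hgu⟩ := id hu
  have hab : a ≤ b := hy.1.trans hy.2
  have hi : ∀ x ∈ Icc a b, IntervalIntegrable g volume a x := fun x hx => by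
    rw [intervalIntegrable_iff_integrableOn_Ioo_of_le hx.1]
    have h : IntegrableOn g (Ioo a b) := hg.integrable (by norm_num)
    exact h.mono_set (Ioo_subset_Ioo_right hx.2)
  rw [hgu z hz, hgu y hy, add_sub_add_left_eq_sub,
    intervalIntegral.integral_interval_sub_left (hi z hz) (hi y hy),
    intervalIntegral.integral_of_le hyz, integral_Ioc_eq_integral_Ioo]
  refine setIntegral_congr_ae measurableSet_Ioo ?_
  have h := ae_hasDerivAt_of_primitive hg hgu
  rw [ae_restrict_iff' measurableSet_Ioo] at h
  filter_upwards [h] with t ht htyz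
  exact (ht (Ioo_subset_Ioo hy.1 hz.2 htyz)).deriv.symm

theorem IsH1.norm_sub_le (hu : IsH1 a b u) {y z : ℝ} (hy : y ∈ Icc a b) (hz : z ∈ Icc a b) :
    ‖u z - u y‖ ≤ ∫ t in Ioo a b, ‖deriv u t‖ := by
  wlog hyz : y ≤ z generalizing y z
  · rw [norm_sub_rev]
    exact this hz hy (le_of_not_ge hyz)
  rw [hu.sub_eq_integral hy hz hyz]
  refine (norm_integral_le_integral_norm _).trans ?_
  exact setIntegral_mono_set hu.integrableOn_deriv.norm
    (Filter.Eventually.of_forall fun t => norm_nonneg _)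
    (Ioo_subset_Ioo hy.1 hz.2).eventuallyLE

theorem IsH1.sq_integral_norm_deriv_le (hu : IsH1 a b u) (hab : a < b) :
    (∫ t in Ioo a b, ‖deriv u t‖) ^ 2 ≤ (b - a) * ∫ t in Ioo a b, ‖deriv u t‖ ^ 2 := by
  have h := sq_integral_mul_le (μ := volume.restrict (Ioo a b)) (f := fun _ => 1)
    (g := fun t => ‖deriv u t‖) (by simp)
    hu.integrableOn_deriv_sq (by simpa using hu.integrableOn_deriv.norm)
  simpa [hab.le] using h

/-- The embedding of `H¹(a, b)` in the space of continuous functions. -/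
theorem IsH1.norm_sq_le (hu : IsH1 a b u) (hab : a < b) {y : ℝ} (hy : y ∈ Icc a b) :
    ‖u y‖ ^ 2 ≤ 2 / (b - a) * (∫ t in Ioo a b, ‖u t‖ ^ 2) +
      2 * (b - a) * ∫ t in Ioo a b, ‖deriv u t‖ ^ 2 := by
  have hba : 0 < b - a := sub_pos.2 hab
  set T := ∫ t in Ioo a b, ‖deriv u t‖ with hT
  -- The oscillation of `u` is at most `T`; this inequality is averaged over `t ∈ (a, b)`, and `T²`
  -- is estimated by Cauchy-Schwarz.
  have hpt : ∀ t ∈ Ioo a b, ‖u y‖ ^ 2 ≤ 2 * ‖u t‖ ^ 2 + 2 * T ^ 2 := by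
    intro t ht
    have h1 := hu.norm_sub_le (Ioo_subset_Icc_self ht) hy
    have h2 : ‖u y‖ ≤ ‖u t‖ + T := by
      have := norm_add_le (u t) (u y - u t)
      rw [add_sub_cancel] at this
      linarith
    nlinarith [sq_nonneg (‖u t‖ - T), norm_nonneg (u y), norm_nonneg (u t)]
  have hint : IntegrableOn (fun t => 2 * ‖u t‖ ^ 2 + 2 * T ^ 2) (Ioo a b) :=
    (hu.integrableOn_sq.const_mul 2).add (integrableOn_const (by simp))
  have h3 := setIntegral_mono_on (integrableOn_const (by simp)) hint measurableSet_Ioo hpt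
  rw [integral_add (hu.integrableOn_sq.const_mul 2) (integrableOn_const (by simp)),
    integral_const_mul] at h3
  simp only [integral_const, MeasurableSet.univ, measureReal_restrict_apply, univ_inter,
    Real.volume_real_Ioo_of_le hab.le, smul_eq_mul] at h3
  have h4 := hu.sq_integral_norm_deriv_le hab
  rw [← hT] at h4
  have h5 : (b - a) * ‖u y‖ ^ 2 ≤ (b - a) * (2 / (b - a) * (∫ t in Ioo a b, ‖u t‖ ^ 2) +
      2 * (b - a) * ∫ t in Ioo a b, ‖deriv u t‖ ^ 2) := by
    have h6 : (b - a) * (2 / (b - a) * (∫ t in Ioo a b, ‖u t‖ ^ 2) +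
      2 * (b - a) * ∫ t in Ioo a b, ‖deriv u t‖ ^ 2) = 2 * (∫ t in Ioo a b, ‖u t‖ ^ 2) +
      2 * (b - a) * ((b - a) * ∫ t in Ioo a b, ‖deriv u t‖ ^ 2) := by
      field_simp
    rw [h6]
    nlinarith
  exact le_of_mul_le_mul_left h5 hba

/-- This is the source of the factor `1 / (2 λ)`, the whole gain of the Carleman estimate. -/
theorem integral_exp_le_inv {lam y b : ℝ} (hlam : 0 < lam) (hyb : y ≤ b) :
    ∫ t in Ioo y b, Real.exp (-lam * (t - y)) ^ 2 ≤ 1 / (2 * lam) := by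
  rw [← integral_Ioc_eq_integral_Ioo, ← intervalIntegral.integral_of_le hyb]
  have hD : ∀ t ∈ uIcc y b, HasDerivAt (fun t => -(Real.exp (-lam * (t - y)) ^ 2 / (2 * lam)))
      (Real.exp (-lam * (t - y)) ^ 2) t := fun t _ => by
    have h1 : HasDerivAt (fun t => Real.exp (-lam * (t - y)))
        (Real.exp (-lam * (t - y)) * (-lam * 1)) t :=
      (((hasDerivAt_id t).sub_const y).const_mul (-lam)).exp
    refine ((h1.fun_pow 2).div_const (2 * lam)).fun_neg.congr_deriv ?_
    field_simp
    norm_num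
    ring
  rw [intervalIntegral.integral_eq_sub_of_hasDerivAt hD
    (Continuous.intervalIntegrable (by fun_prop) _ _)]
  simp only [sub_self, mul_zero, Real.exp_zero, one_pow]
  have : 0 ≤ Real.exp (-lam * (b - y)) ^ 2 / (2 * lam) := by positivity
  linarith

/-- A substitute for the preceding bound that survives at `λ = 0`, where the weighted estimate
becomes the Poincaré inequality. -/
theorem integral_exp_le_length {lam y a b : ℝ} (hlam : 0 ≤ lam) (hay : a ≤ y) (hyb : y ≤ b) :
    ∫ t in Ioo y b, Real.exp (-lam * (t - y)) ^ 2 ≤ b - a := by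
  have h : ∀ t ∈ Ioo y b, Real.exp (-lam * (t - y)) ^ 2 ≤ 1 := fun t ht => by
    refine pow_le_one₀ (Real.exp_pos _).le (Real.exp_le_one_iff.2 ?_)
    nlinarith [ht.1]
  have h2 := setIntegral_mono_on (μ := volume) (s := Ioo y b)
    ((Continuous.integrableOn_Icc (by fun_prop)).mono_set Ioo_subset_Icc_self)
    (integrableOn_const (by simp)) measurableSet_Ioo h
  simp only [integral_const, MeasurableSet.univ, measureReal_restrict_apply, univ_inter,
    Real.volume_real_Ioo_of_le hyb, smul_eq_mul, mul_one] at h2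
  linarith

theorem IsH1.integrableOn_weighted (hu : IsH1 a b u) (lam : ℝ) :
    IntegrableOn (fun t => (Real.exp (lam * t) * ‖deriv u t‖) ^ 2) (Ioo a b) := by
  simp only [mul_pow]
  have hc : Continuous fun t => Real.exp (lam * t) ^ 2 := by fun_prop
  obtain ⟨C, hC⟩ := (isCompact_Icc (a := a) (b := b)).exists_bound_of_continuousOn hc.continuousOn
  refine hu.integrableOn_deriv_sq.bdd_mul (c := C) hc.aestronglyMeasurable ?_
  exact (ae_restrict_iff' measurableSet_Ioo).2
    (Filter.Eventually.of_forall fun t ht => hC t (Ioo_subset_Icc_self ht))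

/-- The pointwise Carleman estimate for functions which vanish at the right end point. -/
theorem IsH1.weighted_norm_sq_le (hu : IsH1 a b u) (hb : u b = 0) (lam : ℝ) {y : ℝ}
    (hy : y ∈ Icc a b) :
    (Real.exp (lam * y) * ‖u y‖) ^ 2 ≤ (∫ t in Ioo y b, Real.exp (-lam * (t - y)) ^ 2) *
      ∫ t in Ioo a b, (Real.exp (lam * t) * ‖deriv u t‖) ^ 2 := by
  have hbI : b ∈ Icc a b := ⟨hy.1.trans hy.2, le_rfl⟩
  have hsub : Ioo y b ⊆ Ioo a b := Ioo_subset_Ioo_left hy.1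
  have h1 : ‖u y‖ ≤ ∫ t in Ioo y b, ‖deriv u t‖ := by
    have := hu.sub_eq_integral hy hbI hy.2
    rw [hb, zero_sub] at this
    rw [← norm_neg, this]
    exact norm_integral_le_integral_norm _
  have hW := (hu.integrableOn_weighted lam).mono_set hsub
  have hp : ∀ t, Real.exp (lam * y) * ‖deriv u t‖ =
      Real.exp (-lam * (t - y)) * (Real.exp (lam * t) * ‖deriv u t‖) := fun t => by
    rw [← mul_assoc, ← Real.exp_add]
    congr 2
    ring
  -- The weight at `y` is split into the weight at `t` and the decaying kernel `e^{-λ(t-y)}`, which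
  -- are separated by Cauchy-Schwarz.
  have h2 : Real.exp (lam * y) * ‖u y‖ ≤ ∫ t in Ioo y b, Real.exp (-lam * (t - y)) *
      (Real.exp (lam * t) * ‖deriv u t‖) := by
    simp only [← hp]
    rw [integral_const_mul]
    exact mul_le_mul_of_nonneg_left h1 (Real.exp_pos _).le
  refine (pow_le_pow_left₀ (by positivity) h2 2).trans ?_
  refine (sq_integral_mul_le ?_ hW ?_).trans ?_
  · exact (Continuous.integrableOn_Icc (by fun_prop)).mono_set Ioo_subset_Icc_self
  · simp only [← hp]
    exact (hu.integrableOn_deriv.mono_set hsub).norm.const_mul _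
  · refine mul_le_mul_of_nonneg_left ?_ (integral_nonneg fun t => sq_nonneg _)
    exact setIntegral_mono_set (hu.integrableOn_weighted lam)
      (Filter.Eventually.of_forall fun t => sq_nonneg _) hsub.eventuallyLE

end Primitive

/-! ### Square integrable functions -/

section L2

variable {X E : Type*} [MeasurableSpace X] {μ : Measure X} [NormedAddCommGroup E]
  [InnerProductSpace ℝ E]

theorem inner_toLp {f g : X → E} (hf : MemLp f 2 μ) (hg : MemLp g 2 μ) :
    inner ℝ (hf.toLp f) (hg.toLp g) = ∫ x, inner ℝ (f x) (g x) ∂μ := by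
  rw [L2.inner_def]
  refine integral_congr_ae ?_
  filter_upwards [hf.coeFn_toLp, hg.coeFn_toLp] with x h1 h2
  rw [h1, h2]

theorem norm_toLp_sq {f : X → E} (hf : MemLp f 2 μ) :
    ‖hf.toLp f‖ ^ 2 = ∫ x, ‖f x‖ ^ 2 ∂μ := by
  rw [← real_inner_self_eq_norm_sq, inner_toLp]
  simp only [real_inner_self_eq_norm_sq]

theorem memLp_clm_apply {B : X → E →L[ℝ] E} (hB : AEStronglyMeasurable B μ) {C : ℝ}
    (hC : ∀ᵐ x ∂μ, ‖B x‖ ≤ C) {f : X → E} (hf : MemLp f 2 μ) :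
    MemLp (fun x => B x (f x)) 2 μ := by
  refine MemLp.of_le_mul (c := C) hf ((continuous_fst.clm_apply continuous_snd).comp_aestronglyMeasurable (hB.prodMk hf.1)) ?_
  filter_upwards [hC] with x hx
  exact (B x).le_of_opNorm_le hx (f x)

/-- Multiplication of square integrable functions by a bounded operator valued function. -/
def mulLp (B : X → E →L[ℝ] E) (hB : AEStronglyMeasurable B μ) (C : ℝ)
    (hC : ∀ᵐ x ∂μ, ‖B x‖ ≤ C) : Lp E 2 μ →L[ℝ] Lp E 2 μ :=
  LinearMap.mkContinuous
    { toFun := fun f => (memLp_clm_apply hB hC (Lp.memLp f)).toLp _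
      map_add' := fun f g => by
        rw [← MemLp.toLp_add]
        refine MemLp.toLp_congr _ _ ?_
        filter_upwards [Lp.coeFn_add f g] with x hx
        rw [hx, Pi.add_apply, map_add, Pi.add_apply]
      map_smul' := fun c f => by
        rw [RingHom.id_apply, ← MemLp.toLp_const_smul]
        refine MemLp.toLp_congr _ _ ?_
        filter_upwards [Lp.coeFn_smul c f] with x hx
        rw [hx, Pi.smul_apply, map_smul, Pi.smul_apply] } C fun f => by
    refine Lp.norm_le_mul_norm_of_ae_le_mul ?_
    filter_upwards [(memLp_clm_apply hB hC (Lp.memLp f)).coeFn_toLp, hC] with x hx hx'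
    simp only [LinearMap.coe_mk, AddHom.coe_mk]
    rw [hx]
    exact (B x).le_of_opNorm_le hx' _

open scoped Classical in
/-- Multiplication by an operator valued function; zero if the function is not bounded. -/
def mulOp (μ : Measure X) (B : X → E →L[ℝ] E) : Lp E 2 μ →L[ℝ] Lp E 2 μ :=
  if h : AEStronglyMeasurable B μ ∧ ∃ C : ℝ, ∀ᵐ x ∂μ, ‖B x‖ ≤ C then
    mulLp B h.1 h.2.choose h.2.choose_spec else 0

/-- With the default value 0, `mulOp` can be written before boundedness is known. Its other
properties rest on this description, whatever bound was chosen in the definition. -/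
theorem coeFn_mulOp {B : X → E →L[ℝ] E} (hB : AEStronglyMeasurable B μ) {C : ℝ}
    (hC : ∀ᵐ x ∂μ, ‖B x‖ ≤ C) (f : Lp E 2 μ) :
    mulOp μ B f =ᵐ[μ] fun x => B x (f x) := by
  have h : AEStronglyMeasurable B μ ∧ ∃ C : ℝ, ∀ᵐ x ∂μ, ‖B x‖ ≤ C := ⟨hB, C, hC⟩
  rw [mulOp, dif_pos h]
  exact (memLp_clm_apply hB h.2.choose_spec (Lp.memLp f)).coeFn_toLp

theorem norm_mulOp_le {B : X → E →L[ℝ] E} (hB : AEStronglyMeasurable B μ) {C : ℝ} (hC0 : 0 ≤ C)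
    (hC : ∀ᵐ x ∂μ, ‖B x‖ ≤ C) : ‖mulOp μ B‖ ≤ C := by
  refine ContinuousLinearMap.opNorm_le_bound _ hC0 fun f => ?_
  refine Lp.norm_le_mul_norm_of_ae_le_mul ?_
  filter_upwards [coeFn_mulOp hB hC f, hC] with x hx hx'
  rw [hx]
  exact (B x).le_of_opNorm_le hx' _

theorem mulOp_sub {B B' : X → E →L[ℝ] E} (hB : AEStronglyMeasurable B μ)
    (hB' : AEStronglyMeasurable B' μ) {C : ℝ} (hC : ∀ᵐ x ∂μ, ‖B x‖ ≤ C)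
    (hC' : ∀ᵐ x ∂μ, ‖B' x‖ ≤ C) : mulOp μ B - mulOp μ B' = mulOp μ (B - B') := by
  have hC2 : ∀ᵐ x ∂μ, ‖(B - B') x‖ ≤ C + C := by
    filter_upwards [hC, hC'] with x h h' using (norm_sub_le _ _).trans (add_le_add h h')
  ext1 f
  refine Lp.ext ?_
  filter_upwards [Lp.coeFn_sub (mulOp μ B f) (mulOp μ B' f), coeFn_mulOp hB hC f,
    coeFn_mulOp hB' hC' f, coeFn_mulOp (hB.sub hB') hC2 f] with x h1 h2 h3 h4
  rw [sub_apply, h1, Pi.sub_apply, h2, h3, h4, Pi.sub_apply, sub_apply]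

open scoped Classical in
/-- A square integrable function as an element of `L₂`; zero for other functions. -/
def lpOf (μ : Measure X) (f : X → E) : Lp E 2 μ := if h : MemLp f 2 μ then h.toLp f else 0

theorem coeFn_lpOf {f : X → E} (hf : MemLp f 2 μ) : lpOf μ f =ᵐ[μ] f := by
  rw [lpOf, dif_pos hf]
  exact hf.coeFn_toLp

theorem norm_le_of_ae_bound [IsFiniteMeasure μ] {f : Lp E 2 μ} {C : ℝ} (hC0 : 0 ≤ C)
    (hC : ∀ᵐ x ∂μ, ‖f x‖ ≤ C) : ‖f‖ ≤ Real.sqrt (μ.real univ) * C := by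
  have h : ‖f‖ ^ 2 = ∫ x, ‖f x‖ ^ 2 ∂μ := by
    rw [← norm_toLp_sq (Lp.memLp f), Lp.toLp_coeFn]
  rw [← Real.sqrt_sq hC0, ← Real.sqrt_mul measureReal_nonneg]
  refine Real.le_sqrt_of_sq_le ?_
  rw [h, ← smul_eq_mul, ← integral_const]
  refine integral_mono_of_nonneg (Filter.Eventually.of_forall fun x => sq_nonneg _)
    (integrable_const _) ?_
  filter_upwards [hC] with x hx using pow_le_pow_left₀ (norm_nonneg _) hx 2

end L2

end

section

/-! ### The semi-discrete spaces -/

/-- The measure on the interval `(a, b)`. -/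
abbrev ivl (a b : ℝ) : Measure ℝ := volume.restrict (Ioo a b)

theorem sqrt_sum_norm_add_sq_le {ι G : Type*} [Fintype ι] [SeminormedAddCommGroup G] (f g : ι → G) :
    Real.sqrt (∑ i, ‖f i + g i‖ ^ 2) ≤
      Real.sqrt (∑ i, ‖f i‖ ^ 2) + Real.sqrt (∑ i, ‖g i‖ ^ 2) := by
  have h := norm_add_le (WithLp.toLp 2 f : PiLp 2 fun _ : ι => G) (WithLp.toLp 2 g)
  simpa only [PiLp.norm_eq_of_L2, PiLp.add_apply] using h

/-- The condition says that `f` is orthogonal to all constants, an intersection of kernels of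
continuous functionals. -/
theorem isClosed_integral_eq_zero {X E : Type*} [MeasurableSpace X] {μ : Measure X}
    [IsFiniteMeasure μ] [NormedAddCommGroup E] [InnerProductSpace ℝ E] [CompleteSpace E] :
    IsClosed {f : Lp E 2 μ | ∫ x, f x ∂μ = 0} := by
  have h : {f : Lp E 2 μ | ∫ x, f x ∂μ = 0} =
      ⋂ c : E, {f : Lp E 2 μ | inner ℝ (indicatorConstLp 2 MeasurableSet.univ
        (measure_ne_top μ univ) c) f = 0} := by
    ext f
    simp only [mem_ofPred_eq, mem_iInter, L2.inner_indicatorConstLp_eq_inner_setIntegral,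
      Measure.restrict_univ]
    exact ⟨fun h c => by rw [h, inner_zero_right], fun h => inner_self_eq_zero.1 (h _)⟩
  rw [h]
  exact isClosed_iInter fun c => isClosed_eq (by fun_prop) continuous_const

variable {n m N : ℕ} {A a b : ℝ}

/-- The functions whose norms in `L₂(a, b)` make up the norm of `H_N^{1,h}`. -/
def h1Fun (A : ℝ) (W : GridFn n m N) (q : intNodes n m × Fin n × Fin 3) : ℝ → Vec N :=
  match q.2.2 with
  | 0 => W q.1
  | 1 => fd A q.2.1 W q.1
  | 2 => deriv (W q.1)

theorem memLp_h1Fun {W : GridFn n m N} (hW : W ∈ H1h n m N A a b)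
    (q : intNodes n m × Fin n × Fin 3) : MemLp (h1Fun A W q) 2 (ivl a b) := by
  obtain ⟨p, k, j⟩ := q
  fin_cases j
  · exact (hW.1 p p.2).memLp
  · exact hW.2.1 p p.2 k
  · exact (hW.1 p p.2).memLp_deriv

/-- The parts of an element of `H_N^{1,h}` as elements of `L₂(a, b)`. -/
def h1Part {W : GridFn n m N} (hW : W ∈ H1h n m N A a b) (q : intNodes n m × Fin n × Fin 3) :
    Lp (Vec N) 2 (ivl a b) := (memLp_h1Fun hW q).toLp _

theorem h1Part_add {W V : GridFn n m N} (hW : W ∈ H1h n m N A a b) (hV : V ∈ H1h n m N A a b)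
    (q : intNodes n m × Fin n × Fin 3) :
    h1Part (add_mem hW hV) q = h1Part hW q + h1Part hV q := by
  rw [h1Part, h1Part, h1Part, ← MemLp.toLp_add]
  refine MemLp.toLp_congr _ _ ?_
  obtain ⟨p, k, j⟩ := q
  fin_cases j
  · exact Filter.EventuallyEq.rfl
  · exact Filter.Eventually.of_forall fun y => congrFun (fd_add A k W V p) y
  · filter_upwards [(hW.1 p p.2).ae_differentiableAt, (hV.1 p p.2).ae_differentiableAt]
      with y h1 h2
    exact deriv_add h1 h2

theorem h1Part_smul (c : ℝ) {W : GridFn n m N} (hW : W ∈ H1h n m N A a b)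
    (q : intNodes n m × Fin n × Fin 3) :
    h1Part (Submodule.smul_mem _ c hW) q = c • h1Part hW q := by
  rw [h1Part, h1Part, ← MemLp.toLp_const_smul]
  refine MemLp.toLp_congr _ _ ?_
  obtain ⟨p, k, j⟩ := q
  fin_cases j
  · exact Filter.EventuallyEq.rfl
  · exact Filter.Eventually.of_forall fun y => congrFun (fd_smul A k c W p) y
  · filter_upwards [(hW.1 p p.2).ae_differentiableAt] with y h1
    exact deriv_const_smul c h1

/-- The norm is thereby Euclidean over a finite family in `L₂`, which yields the triangle inequality
and homogeneity on all of `H1h`. As in the definition, values and derivatives in `y` are counted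
once for each `k`. -/
theorem h1Norm_eq {W : GridFn n m N} (hW : W ∈ H1h n m N A a b) :
    h1Norm A a b W = Real.sqrt (∑ q, ‖h1Part hW q‖ ^ 2) := by
  rw [h1Norm]
  congr 1
  simp only [Fintype.sum_prod_type, h1Part, norm_toLp_sq, Fin.sum_univ_three]
  rw [← Finset.sum_coe_sort]
  refine Finset.sum_congr rfl fun p _ => Finset.sum_congr rfl fun k _ => ?_
  have h0 := (memLp_two_iff_integrable_sq_norm (memLp_h1Fun hW (p, k, 0)).1).1
    (memLp_h1Fun hW (p, k, 0))
  have h1 := (memLp_two_iff_integrable_sq_norm (memLp_h1Fun hW (p, k, 1)).1).1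
    (memLp_h1Fun hW (p, k, 1))
  have h2 := (memLp_two_iff_integrable_sq_norm (memLp_h1Fun hW (p, k, 2)).1).1
    (memLp_h1Fun hW (p, k, 2))
  have h01 : Integrable (fun y => ‖h1Fun A W (p, k, 0) y‖ ^ 2 + ‖h1Fun A W (p, k, 1) y‖ ^ 2)
    (ivl a b) := h0.add h1
  rw [← integral_add h0 h1, ← integral_add h01 h2]
  rfl

theorem h1Norm_nonneg (W : GridFn n m N) : 0 ≤ h1Norm A a b W := Real.sqrt_nonneg _

theorem norm_h1Part_le {W : GridFn n m N} (hW : W ∈ H1h n m N A a b)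
    (q : intNodes n m × Fin n × Fin 3) : ‖h1Part hW q‖ ≤ h1Norm A a b W := by
  rw [h1Norm_eq hW]
  refine Real.le_sqrt_of_sq_le ?_
  exact Finset.single_le_sum (f := fun q => ‖h1Part hW q‖ ^ 2) (fun _ _ => sq_nonneg _)
    (Finset.mem_univ q)

theorem h1Norm_add_le {W V : GridFn n m N} (hW : W ∈ H1h n m N A a b)
    (hV : V ∈ H1h n m N A a b) : h1Norm A a b (W + V) ≤ h1Norm A a b W + h1Norm A a b V := by
  rw [h1Norm_eq hW, h1Norm_eq hV, h1Norm_eq (add_mem hW hV)]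
  simp only [h1Part_add hW hV]
  exact sqrt_sum_norm_add_sq_le _ _

theorem h1Norm_smul (c : ℝ) {W : GridFn n m N} (hW : W ∈ H1h n m N A a b) :
    h1Norm A a b (c • W) = |c| * h1Norm A a b W := by
  rw [h1Norm_eq hW, h1Norm_eq (Submodule.smul_mem _ c hW)]
  simp only [h1Part_smul c hW, norm_smul, mul_pow, ← Finset.mul_sum]
  rw [Real.sqrt_mul (sq_nonneg _), Real.sqrt_sq (norm_nonneg _), Real.norm_eq_abs]

/-- The constant of the embedding of `H¹(a, b)` in the space of continuous functions. -/
def supConst (a b : ℝ) : ℝ := Real.sqrt (2 / (b - a) + 2 * (b - a))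

theorem supConst_nonneg (a b : ℝ) : 0 ≤ supConst a b := Real.sqrt_nonneg _

theorem norm_apply_le_h1Norm [NeZero n] (hab : a < b) {W : GridFn n m N}
    (hW : W ∈ H1h n m N A a b) {p : Node n m} (hp : p ∈ intNodes n m) {y : ℝ}
    (hy : y ∈ Icc a b) : ‖W p y‖ ≤ supConst a b * h1Norm A a b W := by
  have hba : 0 < b - a := sub_pos.2 hab
  have h := (hW.1 p hp).norm_sq_le hab hy
  have h0 := norm_h1Part_le hW (⟨p, hp⟩, 0, 0)
  have h2 := norm_h1Part_le hW (⟨p, hp⟩, 0, 2)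
  have h0' := pow_le_pow_left₀ (norm_nonneg _) h0 2
  have h2' := pow_le_pow_left₀ (norm_nonneg _) h2 2
  rw [h1Part, norm_toLp_sq] at h0' h2'
  change ∫ t in Ioo a b, ‖W p t‖ ^ 2 ≤ _ at h0'
  change ∫ t in Ioo a b, ‖deriv (W p) t‖ ^ 2 ≤ _ at h2'
  rw [supConst, ← Real.sqrt_sq (h1Norm_nonneg (A := A) (a := a) (b := b) W),
    ← Real.sqrt_mul (by positivity)]
  refine Real.le_sqrt_of_sq_le (h.trans ?_)
  rw [add_mul]
  exact add_le_add (mul_le_mul_of_nonneg_left h0' (by positivity))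
    (mul_le_mul_of_nonneg_left h2' (by positivity))

namespace H10

theorem fn_mem (v : H10 n m N A a b) : v.fn ∈ H1h n m N A a b := v.2.1

theorem fn_eq_zero_of_boundary (v : H10 n m N A a b) {p : Node n m} (hp : p ∉ intNodes n m)
    (y : ℝ) : v.fn p y = 0 := by
  by_cases hy : y ∈ Icc a b
  · exact v.2.2 p y hy (Or.inl hp)
  · exact v.2.1.2.2 p y hy

theorem fn_left (v : H10 n m N A a b) (hab : a ≤ b) (p : Node n m) : v.fn p a = 0 :=
  v.2.2 p a ⟨le_rfl, hab⟩ (Or.inr (Or.inl rfl))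

theorem fn_right (v : H10 n m N A a b) (hab : a ≤ b) (p : Node n m) : v.fn p b = 0 :=
  v.2.2 p b ⟨hab, le_rfl⟩ (Or.inr (Or.inr rfl))

theorem norm_fn_le_of_interior (v : H10 n m N A a b) {y M : ℝ} (hM : 0 ≤ M)
    (h : ∀ p ∈ intNodes n m, ‖v.fn p y‖ ≤ M) (p : Node n m) : ‖v.fn p y‖ ≤ M := by
  by_cases hp : p ∈ intNodes n m
  · exact h p hp
  · rw [v.fn_eq_zero_of_boundary hp, norm_zero]
    exact hM

/-- A neighbour of an interior node may be a boundary node, but there `v` vanishes. This makes the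
`x`-differences lower order terms, at the price `1/h`. -/
theorem norm_fd_le (v : H10 n m N A a b) (hA : 0 < meshStep A m) {y M : ℝ} (hM : 0 ≤ M)
    (h : ∀ p ∈ intNodes n m, ‖v.fn p y‖ ≤ M) (k : Fin n) (p : Node n m) :
    ‖fd A k v.fn p y‖ ≤ 1 / meshStep A m * M := by
  have h' := v.norm_fn_le_of_interior hM h
  rw [fd, norm_smul, Real.norm_of_nonneg (by positivity)]
  calc _ ≤ 1 / (2 * meshStep A m) * (M + M) :=
        mul_le_mul_of_nonneg_left ((norm_sub_le _ _).trans (add_le_add (h' _) (h' _)))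
          (by positivity)
    _ = _ := by field_simp; ring

variable [NeZero n]

/-- The parts of an element of `H_{N,0}^{1,h}`, as operators. -/
def partL (q : intNodes n m × Fin n × Fin 3) :
    H10 n m N A a b →L[ℝ] Lp (Vec N) 2 (ivl a b) :=
  LinearMap.mkContinuous
    { toFun := fun v => h1Part v.fn_mem q
      map_add' := fun u v => h1Part_add u.fn_mem v.fn_mem q
      map_smul' := fun c v => h1Part_smul c v.fn_mem q } 1 fun v => by
    rw [one_mul, norm_eq]
    exact norm_h1Part_le v.fn_mem q

theorem norm_partL_le (q : intNodes n m × Fin n × Fin 3) :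
    ‖partL (n := n) (m := m) (N := N) (A := A) (a := a) (b := b) q‖ ≤ 1 :=
  LinearMap.mkContinuous_norm_le _ zero_le_one _

theorem coeFn_partL (q : intNodes n m × Fin n × Fin 3) (v : H10 n m N A a b) :
    partL q v =ᵐ[ivl a b] h1Fun A v.fn q :=
  (memLp_h1Fun v.fn_mem q).coeFn_toLp

theorem norm_fn_apply_le (hab : a < b) (v : H10 n m N A a b) {p : Node n m}
    (hp : p ∈ intNodes n m) {y : ℝ} (hy : y ∈ Icc a b) :
    ‖v.fn p y‖ ≤ supConst a b * ‖v‖ := by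
  rw [norm_eq]
  exact norm_apply_le_h1Norm hab v.fn_mem hp hy

/-- The Poincaré inequality: the norm is controlled by the derivatives in `y`. -/
theorem norm_sq_le_deriv (hab : a < b) (hA : 0 < meshStep A m) :
    ∃ C : ℝ, 0 < C ∧ ∀ v : H10 n m N A a b,
      ‖v‖ ^ 2 ≤ C * ∑ p ∈ intNodes n m, ∫ t in Ioo a b, ‖deriv (v.fn p) t‖ ^ 2 := by
  have hba : 0 < b - a := sub_pos.2 hab
  set h := 1 / meshStep A m with hh
  have hh0 : 0 < h := by positivity
  -- For each node and each `k`, values and differences contribute `(b - a)` and `h² (b - a)` times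
  -- `S`, integrated over length `b - a`; the derivative contributes the inner 1. The last 1 keeps
  -- the constant positive on a grid without interior nodes.
  refine ⟨(intNodes n m).card * n * ((b - a) * ((b - a) + h ^ 2 * (b - a)) + 1) + 1,
    by positivity, fun v => ?_⟩
  set T : Node n m → ℝ := fun p => ∫ t in Ioo a b, ‖deriv (v.fn p) t‖ ^ 2 with hT
  have hT0 : ∀ p, 0 ≤ T p := fun p => integral_nonneg fun t => sq_nonneg _
  set S := ∑ p ∈ intNodes n m, T p with hS
  have hS0 : 0 ≤ S := Finset.sum_nonneg fun p _ => hT0 p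
  have hTS : ∀ p ∈ intNodes n m, T p ≤ S := fun p hp =>
    Finset.single_le_sum (f := T) (fun p _ => hT0 p) hp
  have hsup : ∀ y ∈ Ioo a b, ∀ p ∈ intNodes n m, ‖v.fn p y‖ ≤ Real.sqrt ((b - a) * S) := by
    intro y hy p hp
    refine Real.le_sqrt_of_sq_le ?_
    -- The Carleman estimate with `λ = 0`.
    have h1 := (v.isH1 hp).weighted_norm_sq_le (v.fn_right hab.le p) 0 (Ioo_subset_Icc_self hy)
    simp only [zero_mul, Real.exp_zero, one_mul] at h1
    refine h1.trans (mul_le_mul ?_ (hTS p hp) (hT0 p) hba.le)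
    exact integral_exp_le_length le_rfl hy.1.le hy.2.le
  have hsq : Real.sqrt ((b - a) * S) ^ 2 = (b - a) * S := Real.sq_sqrt (by positivity)
  rw [norm_eq, h1Norm, Real.sq_sqrt (Finset.sum_nonneg fun p _ => Finset.sum_nonneg fun k _ =>
    integral_nonneg fun y => by positivity)]
  have hpk : ∀ p ∈ intNodes n m, ∀ k : Fin n, ∫ y in Ioo a b,
      (‖v.fn p y‖ ^ 2 + ‖fd A k v.fn p y‖ ^ 2 + ‖deriv (v.fn p) y‖ ^ 2) ≤
      ((b - a) * ((b - a) + h ^ 2 * (b - a)) + 1) * S := by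
    intro p hp k
    have hpt : ∀ y ∈ Ioo a b, ‖v.fn p y‖ ^ 2 + ‖fd A k v.fn p y‖ ^ 2 + ‖deriv (v.fn p) y‖ ^ 2 ≤
        ((b - a) * S + h ^ 2 * ((b - a) * S)) + ‖deriv (v.fn p) y‖ ^ 2 := by
      intro y hy
      have h1 := pow_le_pow_left₀ (norm_nonneg _) (hsup y hy p hp) 2
      have h2 := pow_le_pow_left₀ (norm_nonneg _)
        (v.norm_fd_le hA (Real.sqrt_nonneg _) (hsup y hy) k p) 2
      rw [hsq] at h1
      rw [mul_pow, hsq] at h2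
      linarith
    have hint : IntegrableOn (fun y => ((b - a) * S + h ^ 2 * ((b - a) * S)) +
        ‖deriv (v.fn p) y‖ ^ 2) (Ioo a b) :=
      (integrableOn_const (by simp)).add (v.isH1 hp).integrableOn_deriv_sq
    have hint' : IntegrableOn (fun y => ‖v.fn p y‖ ^ 2 + ‖fd A k v.fn p y‖ ^ 2 +
        ‖deriv (v.fn p) y‖ ^ 2) (Ioo a b) := by
      simpa only [← dens_self] using v.integrable_dens v hp k
    refine (setIntegral_mono_on hint' hint measurableSet_Ioo hpt).trans ?_
    have hconst : IntegrableOn (fun _ : ℝ => (b - a) * S + h ^ 2 * ((b - a) * S)) (Ioo a b) :=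
      integrableOn_const (by simp)
    rw [integral_add hconst (v.isH1 hp).integrableOn_deriv_sq]
    simp only [integral_const, MeasurableSet.univ, measureReal_restrict_apply, univ_inter,
      Real.volume_real_Ioo_of_le hab.le, smul_eq_mul]
    have := hTS p hp
    simp only [hT] at this
    nlinarith
  refine (Finset.sum_le_sum fun p hp => Finset.sum_le_sum fun k _ => hpk p hp k).trans ?_
  simp only [Finset.sum_const, Finset.card_univ, Fintype.card_fin, nsmul_eq_mul]
  nlinarith

end H10

end

/-! ### Completeness of `H_{N,0}^{1,h}` -/

section

namespace H10

variable {n m N : ℕ} {A a b : ℝ}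

/-- The function with given derivatives over the interior nodes. -/
def primFn (a b : ℝ) (g : intNodes n m → ℝ → Vec N) : GridFn n m N := fun p y =>
  open scoped Classical in
  if h : p ∈ intNodes n m ∧ y ∈ Icc a b then ∫ t in a..y, g ⟨p, h.1⟩ t else 0

theorem primFn_apply {g : intNodes n m → ℝ → Vec N} {p : Node n m} (hp : p ∈ intNodes n m) {y : ℝ}
    (hy : y ∈ Icc a b) : primFn a b g p y = ∫ t in a..y, g ⟨p, hp⟩ t := by
  rw [primFn, dif_pos ⟨hp, hy⟩]

theorem primFn_primitive (hab : a < b) {g : intNodes n m → ℝ → Vec N} {p : Node n m}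
    (hp : p ∈ intNodes n m) : ∀ y ∈ Icc a b,
      primFn a b g p y = primFn a b g p a + ∫ t in a..y, g ⟨p, hp⟩ t := fun y hy => by
  rw [primFn_apply hp hy, primFn_apply hp (left_mem_Icc.2 hab.le), intervalIntegral.integral_same,
    zero_add]

theorem primFn_memLp (hab : a < b) {g : intNodes n m → ℝ → Vec N}
    (hg : ∀ p, MemLp (g p) 2 (ivl a b)) (p : Node n m) : MemLp (primFn a b g p) 2 (ivl a b) := by
  by_cases hp : p ∈ intNodes n m
  · exact IsH1.memLp ⟨g ⟨p, hp⟩, hg _, primFn_primitive hab hp⟩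
  · have : primFn a b g p = 0 := by
      funext y
      simp [primFn, hp]
    rw [this]
    exact MemLp.zero

/-- The element of `H_{N,0}^{1,h}` with given derivatives over the interior nodes. -/
def prim (hab : a < b) (g : intNodes n m → ℝ → Vec N) (hg : ∀ p, MemLp (g p) 2 (ivl a b))
    (h0 : ∀ p, ∫ t, g p t ∂(ivl a b) = 0) : H10 n m N A a b :=
  ⟨primFn a b g, ⟨fun p hp => ⟨g ⟨p, hp⟩, hg _, primFn_primitive hab hp⟩,
    fun p _ k => ((primFn_memLp hab hg (Function.update p k (p k + 1))).sub
      (primFn_memLp hab hg (Function.update p k (p k - 1)))).const_smul (1 / (2 * meshStep A m)),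
    fun p y hy => by rw [primFn, dif_neg fun h => hy h.2]⟩, fun p y hy hpy => by
      by_cases hp : p ∈ intNodes n m
      · rw [primFn_apply hp hy]
        rcases hpy with h | h | h
        · exact absurd hp h
        · rw [h, intervalIntegral.integral_same]
          rfl
        · rw [h, intervalIntegral.integral_of_le hab.le, integral_Ioc_eq_integral_Ioo, h0]
          rfl
      · rw [primFn, dif_neg fun h => hp h.1]
        rfl⟩

variable [NeZero n]

/-- The family of the derivatives in `y` over the interior nodes. -/
def derivL : H10 n m N A a b →L[ℝ] (intNodes n m → Lp (Vec N) 2 (ivl a b)) :=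
  ContinuousLinearMap.pi fun p => partL (p, 0, 2)

theorem norm_le_derivL (hab : a < b) (hA : 0 < meshStep A m) :
    ∃ C : NNReal, ∀ v : H10 n m N A a b, ‖v‖ ≤ C * ‖derivL v‖ := by
  obtain ⟨C, hC0, hC⟩ := norm_sq_le_deriv (n := n) (m := m) (N := N) hab hA
  refine ⟨Real.toNNReal (Real.sqrt (C * (intNodes n m).card)), fun v => ?_⟩
  rw [Real.coe_toNNReal _ (Real.sqrt_nonneg _), ← Real.sqrt_sq (norm_nonneg (derivL v)),
    ← Real.sqrt_mul (by positivity)]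
  refine Real.le_sqrt_of_sq_le ((hC v).trans ?_)
  rw [mul_assoc]
  refine mul_le_mul_of_nonneg_left ?_ hC0.le
  rw [← nsmul_eq_mul, ← Finset.sum_const]
  refine Finset.sum_le_sum fun p hp => ?_
  have h := norm_toLp_sq (v.isH1 hp).memLp_deriv
  rw [← h]
  exact pow_le_pow_left₀ (norm_nonneg _) (norm_le_pi_norm (derivL v) ⟨p, hp⟩) 2

theorem integral_derivL (hab : a < b) (v : H10 n m N A a b) (p : intNodes n m) :
    ∫ t, derivL v p t ∂(ivl a b) = 0 := by
  have h1 : derivL v p =ᵐ[ivl a b] deriv (v.fn p) := coeFn_partL (p, 0, 2) v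
  rw [integral_congr_ae h1]
  have h2 := (v.isH1 p.2).sub_eq_integral (left_mem_Icc.2 hab.le) (right_mem_Icc.2 hab.le) hab.le
  rw [v.fn_right hab.le, v.fn_left hab.le, sub_zero] at h2
  exact h2.symm

/-- A function of `L₂(a, b)` is the derivative of an `H¹` function vanishing at both ends exactly
when its mean is zero; its primitive from `a` is that function. -/
theorem range_derivL (hab : a < b) :
    range (derivL (n := n) (m := m) (N := N) (A := A) (a := a) (b := b)) =
      ⋂ p, {g | ∫ t, g p t ∂(ivl a b) = 0} := by
  ext g
  simp only [mem_range, mem_iInter, mem_ofPred_eq]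
  refine ⟨?_, fun h => ?_⟩
  · rintro ⟨v, rfl⟩ p
    exact integral_derivL hab v p
  · refine ⟨prim hab (fun p => g p) (fun p => Lp.memLp (g p)) h, ?_⟩
    funext p
    refine Lp.ext ?_
    refine (coeFn_partL (p, 0, 2) _).trans ?_
    filter_upwards [ae_hasDerivAt_of_primitive (Lp.memLp (g p)) (primFn_primitive
      (g := fun p => g p) hab p.2)]
      with y hy using hy.deriv

/-- The space `H_{N,0}^{1,h}` is complete. -/
theorem completeSpace (hab : a < b) (hA : 0 < meshStep A m) : CompleteSpace (H10 n m N A a b) := by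
  obtain ⟨C, hC⟩ := norm_le_derivL (n := n) (m := m) (N := N) hab hA
  -- By the Poincaré inequality `derivL` is bounded below, so completeness of the space amounts to
  -- completeness of its range, a closed set of mean-zero families.
  have hind : IsUniformInducing (derivL (n := n) (m := m) (N := N) (A := A) (a := a) (b := b)) :=
    (AddMonoidHomClass.antilipschitz_of_bound derivL hC).isUniformInducing
      derivL.uniformContinuous
  rw [completeSpace_iff_isComplete_range hind, range_derivL hab]
  exact (isClosed_iInter fun p => isClosed_integral_eq_zero.preimage
    (continuous_apply p)).isComplete

end H10

end

section

/-! ### The residual as an element of `L₂` -/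

/-- Bounds for the coefficients and the nonlinear term of the system, the latter on the ball of
radius `ρ`, and their continuity. -/
structure SysBounds (n : ℕ) [NeZero n] (N : ℕ) (A a b d ρ C : ℝ) (K : Pt n → ℝ → ℝ → ℝ)
    (μs : Pt n → ℝ) : Prop where
  matD_le : ∀ X ∈ Omega n A a b, ‖matCLM (matD N d X)‖ ≤ C
  matA_le : ∀ X ∈ Omega n A a b, ∀ i, ‖matCLM (matA N d i X)‖ ≤ C
  matD_cont : ContinuousOn (fun X => matCLM (matD N d X)) (Omega n A a b)
  matA_cont : ∀ i, ContinuousOn (fun X => matCLM (matA N d i X)) (Omega n A a b)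
  nonlin_le : ∀ X ∈ Omega n A a b, ∀ W : Vec N, ‖W‖ ≤ ρ → ‖nonlin d K μs W X‖ ≤ C
  nonlinD_le : ∀ X ∈ Omega n A a b, ∀ W : Vec N, ‖W‖ ≤ ρ → ‖nonlinD d K μs W X‖ ≤ C
  nonlinD_sub_le : ∀ X ∈ Omega n A a b, ∀ W W' : Vec N, ‖W‖ ≤ ρ → ‖W'‖ ≤ ρ →
    ‖nonlinD d K μs W X - nonlinD d K μs W' X‖ ≤ C * ‖W - W'‖
  taylor : ∀ X ∈ Omega n A a b, ∀ W W' : Vec N, ‖W‖ ≤ ρ → ‖W'‖ ≤ ρ →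
    ‖nonlin d K μs W' X - nonlin d K μs W X - nonlinD d K μs W X (W' - W)‖ ≤ C * ‖W' - W‖ ^ 2
  nonlin_cont : ContinuousOn (fun q : Vec N × Pt n => nonlin d K μs q.1 q.2)
    (univ ×ˢ Omega n A a b)
  nonlinD_cont : ContinuousOn (fun q : Vec N × Pt n => nonlinD d K μs q.1 q.2)
    (univ ×ˢ Omega n A a b)

/-- One constant, fixed before `K` and `μs`, gathers all that the later estimates need to know about
the medium. Neither the grid nor `λ` enters it. -/
theorem exists_sysBounds (n N : ℕ) [NeZero n] (A b κ σ : ℝ) {d a ρ : ℝ} (hd : 0 < d) (ha : 0 < a)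
    (hρ : 0 ≤ ρ) : ∃ C : ℝ, 0 < C ∧ ∀ (K : Pt n → ℝ → ℝ → ℝ) (μs : Pt n → ℝ),
      IsMedium n A a b d κ σ K μs → SysBounds n N A a b d ρ C K μs := by
  obtain ⟨C₁, hC₁, h₁⟩ := exists_bound_mat n N (A := A) (b := b) hd ha
  obtain ⟨C₂, hC₂, h₂⟩ := exists_nonlin_bounds n N A b κ σ ρ hd ha hρ
  have hsub := Omega_subset_OmegaBar n A a b
  have hpos : Omega n A a b ⊆ {X | 0 < X.2} := fun X hX => ha.trans hX.2.1
  have hle₁ : C₁ ≤ C₁ + C₂ := by linarith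
  have hle₂ : C₂ ≤ C₁ + C₂ := by linarith
  refine ⟨C₁ + C₂, by linarith, fun K μs hM => ⟨fun X hX => ?_, fun X hX i => ?_, ?_, fun i => ?_,
    fun X hX W hW => ?_, fun X hX W hW => ?_, fun X hX W W' hW hW' => ?_,
    fun X hX W W' hW hW' => ?_, ?_, ?_⟩⟩
  · exact (h₁ X (hsub hX)).1.trans hle₁
  · exact ((h₁ X (hsub hX)).2 i).trans hle₁
  · exact matCLM_continuous.comp_continuousOn ((continuousOn_matD N hd).mono hpos)
  · exact matCLM_continuous.comp_continuousOn ((continuousOn_matA N hd i).mono hpos)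
  · exact (h₂ K μs hM X hX W W hW hW).1.trans hle₂
  · exact (h₂ K μs hM X hX W W hW hW).2.1.trans hle₂
  · exact (h₂ K μs hM X hX W W' hW hW').2.2.1.trans
      (mul_le_mul_of_nonneg_right hle₂ (norm_nonneg _))
  · exact (h₂ K μs hM X hX W W' hW hW').2.2.2.trans
      (mul_le_mul_of_nonneg_right hle₂ (sq_nonneg _))
  · exact continuousOn_nonlin N hM hd ha
  · exact continuousOn_nonlinD N hM hd ha

theorem meshStep_pos {A : ℝ} {m : ℕ} (hA : 0 < A) (hm : 0 < m) : 0 < meshStep A m := by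
  have : (0 : ℝ) < m := Nat.cast_pos.2 hm
  unfold meshStep
  positivity

theorem gridPt_mem_Omega {n m : ℕ} {A a b : ℝ} (hA : 0 < A) (hm : 0 < m) {p : Node n m}
    (hp : p ∈ intNodes n m) {y : ℝ} (hy : y ∈ Ioo a b) : gridPt A p y ∈ Omega n A a b := by
  refine ⟨fun i => ?_, hy⟩
  have hi := Finset.mem_Ioo.1 (Fintype.mem_piFinset.1 hp i)
  have h0 : (0 : ℝ) < (p i : ℕ) := Nat.cast_pos.2 hi.1
  have h1 : ((p i : ℕ) : ℝ) < m := Nat.cast_lt.2 hi.2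
  have hs := meshStep_pos hA hm
  have hms : m * meshStep A m = 2 * A := by
    have : (m : ℝ) ≠ 0 := (Nat.cast_pos.2 hm).ne'
    unfold meshStep
    field_simp
  change -A < -A + (p i : ℕ) * meshStep A m ∧ -A + (p i : ℕ) * meshStep A m < A
  constructor <;> nlinarith

theorem gridPt_continuous {n m : ℕ} (A : ℝ) (p : Node n m) : Continuous (gridPt A p) :=
  continuous_const.prodMk continuous_id

/-- The weighted function `exp (λ y) B(y)` is measurable and bounded by `exp (λ b) C`. -/
def WeightBdd {F : Type*} [NormedAddCommGroup F] [NormedSpace ℝ F] (a b lam C : ℝ) (B : ℝ → F) :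
    Prop :=
  AEStronglyMeasurable (fun y => Real.exp (lam * y) • B y) (ivl a b) ∧
    ∀ᵐ y ∂(ivl a b), ‖Real.exp (lam * y) • B y‖ ≤ Real.exp (lam * b) * C

theorem weightBdd {F : Type*} [NormedAddCommGroup F] [NormedSpace ℝ F] {a b C lam : ℝ}
    (hlam : 0 ≤ lam) {B : ℝ → F} (hB : ContinuousOn B (Ioo a b)) (hC : ∀ y ∈ Ioo a b, ‖B y‖ ≤ C) :
    WeightBdd a b lam C B := by
  constructor
  · exact (ContinuousOn.smul (by fun_prop) hB).aestronglyMeasurable measurableSet_Ioo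
  · refine (ae_restrict_iff' measurableSet_Ioo).2 (Filter.Eventually.of_forall fun y hy => ?_)
    rw [norm_smul, Real.norm_of_nonneg (Real.exp_pos _).le]
    refine mul_le_mul (Real.exp_le_exp.2 (mul_le_mul_of_nonneg_left hy.2.le hlam)) (hC y hy)
      (norm_nonneg _) (Real.exp_pos _).le

variable {n m N : ℕ} [NeZero n] {A a b d : ℝ}

/-- Multiplication by the weighted matrix `D_N`. -/
def wD (N : ℕ) (A a b d lam : ℝ) (p : Node n m) :
    Lp (Vec N) 2 (ivl a b) →L[ℝ] Lp (Vec N) 2 (ivl a b) :=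
  mulOp (ivl a b) fun y => Real.exp (lam * y) • matCLM (matD N d (gridPt A p y))

/-- Multiplication by the weighted matrix `A_i`. -/
def wA (N : ℕ) (A a b d lam : ℝ) (i : Fin n) (p : Node n m) :
    Lp (Vec N) 2 (ivl a b) →L[ℝ] Lp (Vec N) 2 (ivl a b) :=
  mulOp (ivl a b) fun y => Real.exp (lam * y) • matCLM (matA N d i (gridPt A p y))

/-- Multiplication by the weighted derivative of the nonlinear term. -/
def wF (A a b d lam : ℝ) (K : Pt n → ℝ → ℝ → ℝ) (μs : Pt n → ℝ) (W : GridFn n m N)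
    (p : Node n m) : Lp (Vec N) 2 (ivl a b) →L[ℝ] Lp (Vec N) 2 (ivl a b) :=
  mulOp (ivl a b) fun y => Real.exp (lam * y) • nonlinD d K μs (W p y) (gridPt A p y)

/-- The weighted nonlinear term over the node `p`. -/
def wN (A a b d lam : ℝ) (K : Pt n → ℝ → ℝ → ℝ) (μs : Pt n → ℝ) (W : GridFn n m N)
    (p : Node n m) : Lp (Vec N) 2 (ivl a b) :=
  lpOf (ivl a b) fun y => Real.exp (lam * y) • nonlin d K μs (W p y) (gridPt A p y)

/-- The weighted residual over the node `p`. -/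
def wRes (d lam : ℝ) (K : Pt n → ℝ → ℝ → ℝ) (μs : Pt n → ℝ) {W : GridFn n m N}
    (hW : W ∈ H1h n m N A a b) (p : intNodes n m) : Lp (Vec N) 2 (ivl a b) :=
  wD N A a b d lam p.1 (h1Part hW (p, 0, 2)) +
    ∑ i, wA N A a b d lam i p.1 (h1Part hW (p, i, 1)) + wN A a b d lam K μs W p

/-- The derivative of the weighted residual over the node `p`. -/
def opT (A a b d lam : ℝ) (K : Pt n → ℝ → ℝ → ℝ) (μs : Pt n → ℝ) (W : GridFn n m N)
    (p : intNodes n m) : H10 n m N A a b →L[ℝ] Lp (Vec N) 2 (ivl a b) :=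
  (wD N A a b d lam p.1).comp (H10.partL (p, 0, 2)) +
    ∑ i, (wA N A a b d lam i p.1).comp (H10.partL (p, i, 1)) +
    (wF A a b d lam K μs W p).comp (H10.partL (p, 0, 0))

/-- The values of `W` over the interior nodes do not exceed `ρ`. -/
def SupLe (a b ρ : ℝ) (W : GridFn n m N) : Prop :=
  ∀ p ∈ intNodes n m, ∀ y ∈ Ioo a b, ‖W p y‖ ≤ ρ

section Estimates

variable {ρ C lam : ℝ} {K : Pt n → ℝ → ℝ → ℝ} {μs : Pt n → ℝ}
  (hS : SysBounds n N A a b d ρ C K μs) (hA : 0 < A) (hm : 0 < m) (hlam : 0 ≤ lam)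

include hS hA hm hlam

theorem wD_bound {p : Node n m} (hp : p ∈ intNodes n m) :
    WeightBdd a b lam C fun y => matCLM (matD N d (gridPt A p y)) :=
  weightBdd (B := fun y => matCLM (matD N d (gridPt A p y))) hlam
    (hS.matD_cont.comp (gridPt_continuous A p).continuousOn fun _ hy => gridPt_mem_Omega hA hm hp hy)
    fun _ hy => hS.matD_le _ (gridPt_mem_Omega hA hm hp hy)

theorem wA_bound {p : Node n m} (hp : p ∈ intNodes n m) (i : Fin n) :
    WeightBdd a b lam C fun y => matCLM (matA N d i (gridPt A p y)) :=
  weightBdd (B := fun y => matCLM (matA N d i (gridPt A p y))) hlam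
    ((hS.matA_cont i).comp (gridPt_continuous A p).continuousOn
      fun _ hy => gridPt_mem_Omega hA hm hp hy)
    fun _ hy => hS.matA_le _ (gridPt_mem_Omega hA hm hp hy) i

theorem wF_bound {W : GridFn n m N} (hW : W ∈ H1h n m N A a b) (hWρ : SupLe a b ρ W)
    {p : Node n m} (hp : p ∈ intNodes n m) :
    WeightBdd a b lam C fun y => nonlinD d K μs (W p y) (gridPt A p y) :=
  weightBdd (B := fun y => nonlinD d K μs (W p y) (gridPt A p y)) hlam
    (hS.nonlinD_cont.comp (((hW.1 p hp).continuousOn.mono Ioo_subset_Icc_self).prodMk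
      (gridPt_continuous A p).continuousOn) fun _ hy => ⟨mem_univ _, gridPt_mem_Omega hA hm hp hy⟩)
    fun y hy => hS.nonlinD_le _ (gridPt_mem_Omega hA hm hp hy) _ (hWρ p hp y hy)

theorem wN_bound {W : GridFn n m N} (hW : W ∈ H1h n m N A a b) (hWρ : SupLe a b ρ W)
    {p : Node n m} (hp : p ∈ intNodes n m) :
    WeightBdd a b lam C fun y => nonlin d K μs (W p y) (gridPt A p y) := by
  have hc : ContinuousOn (fun y => nonlin d K μs (W p y) (gridPt A p y)) (Ioo a b) :=
    ContinuousOn.comp (f := fun y => (W p y, gridPt A p y)) hS.nonlin_cont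
      (((hW.1 p hp).continuousOn.mono Ioo_subset_Icc_self).prodMk
        (gridPt_continuous A p).continuousOn)
      fun _ hy => ⟨mem_univ _, gridPt_mem_Omega hA hm hp hy⟩
  have hb : ∀ y ∈ Ioo a b, ‖nonlin d K μs (W p y) (gridPt A p y)‖ ≤ C := fun y hy =>
    hS.nonlin_le _ (gridPt_mem_Omega hA hm hp hy) _ (hWρ p hp y hy)
  exact weightBdd hlam hc hb

theorem coeFn_wN {W : GridFn n m N} (hW : W ∈ H1h n m N A a b) (hWρ : SupLe a b ρ W)
    {p : Node n m} (hp : p ∈ intNodes n m) : wN A a b d lam K μs W p =ᵐ[ivl a b]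
      fun y => Real.exp (lam * y) • nonlin d K μs (W p y) (gridPt A p y) := by
  have h := wN_bound hS hA hm hlam hW hWρ hp
  exact coeFn_lpOf (MemLp.of_bound h.1 _ h.2)

/-- The link between the operators on `L₂`, where calculus is done, and the pointwise residual that
defines the functional. -/
theorem coeFn_wRes {W : GridFn n m N} (hW : W ∈ H1h n m N A a b) (hWρ : SupLe a b ρ W)
    (p : intNodes n m) : wRes d lam K μs hW p =ᵐ[ivl a b]
      fun y => Real.exp (lam * y) • residual A d K μs W p y := by
  have hD := wD_bound hS hA hm hlam p.2
  have hAi := wA_bound hS hA hm hlam p.2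
  have h1 := coeFn_mulOp hD.1 hD.2 (h1Part hW (p, 0, 2))
  have h2 := fun i => coeFn_mulOp (hAi i).1 (hAi i).2 (h1Part hW (p, i, 1))
  have h3 := coeFn_wN hS hA hm hlam hW hWρ p.2
  have h4 : h1Part hW (p, 0, 2) =ᵐ[ivl a b] deriv (W p) := (memLp_h1Fun hW (p, 0, 2)).coeFn_toLp
  have h5 : ∀ i, h1Part hW (p, i, 1) =ᵐ[ivl a b] fd A i W p :=
    fun i => (memLp_h1Fun hW (p, i, 1)).coeFn_toLp
  have h6 := Lp.coeFn_add (wD N A a b d lam p.1 (h1Part hW (p, 0, 2)) +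
    ∑ i, wA N A a b d lam i p.1 (h1Part hW (p, i, 1))) (wN A a b d lam K μs W p)
  have h7 := Lp.coeFn_add (wD N A a b d lam p.1 (h1Part hW (p, 0, 2)))
    (∑ i, wA N A a b d lam i p.1 (h1Part hW (p, i, 1)))
  have h8 := Lp.coeFn_finsetSum Finset.univ
    (fun i => wA N A a b d lam i p.1 (h1Part hW (p, i, 1)))
  filter_upwards [h1, h3, h4, h6, h7, h8, ae_all_iff.2 h2, ae_all_iff.2 h5] with
    y h1 h3 h4 h6 h7 h8 h2 h5
  rw [wRes, h6, Pi.add_apply, h7, Pi.add_apply, h8, h3, wD, h1, h4, residual, smul_add, smul_add,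
    Finset.smul_sum, Finset.sum_apply]
  congr 2
  refine Finset.sum_congr rfl fun i _ => ?_
  rw [wA, h2, h5]
  rfl

end Estimates

end

/-! ### First order expansion of the weighted residual -/

section

section Hilbert

variable {E F : Type*} [NormedAddCommGroup E] [NormedSpace ℝ E] [NormedAddCommGroup F]
  [InnerProductSpace ℝ F]

/-- The bound is asked only for `‖v‖ ≤ 1`, where the perturbed function stays in the enlarged ball.
-/
theorem hasFDerivAt_zero_of_quadratic {f : E → F} {f' : E →L[ℝ] F} {C : ℝ}
    (h : ∀ v : E, ‖v‖ ≤ 1 → ‖f v - f 0 - f' v‖ ≤ C * ‖v‖ ^ 2) : HasFDerivAt f f' 0 := by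
  rw [hasFDerivAt_iff_isLittleO_nhds_zero]
  simp only [zero_add]
  refine Asymptotics.IsBigO.trans_isLittleO (g := fun v : E => ‖v‖ ^ 2)
    (Asymptotics.IsBigO.of_bound C ?_) (Asymptotics.isLittleO_norm_pow_id one_lt_two)
  filter_upwards [Metric.closedBall_mem_nhds (0 : E) one_pos] with v hv
  rw [Real.norm_of_nonneg (sq_nonneg _)]
  exact h v (by simpa using hv)

theorem norm_inner_comp_sub_le {r₁ r₂ : F} {T₁ T₂ : E →L[ℝ] F} {B B' s t : ℝ}
    (hT₁ : ‖T₁‖ ≤ B) (hr₂ : ‖r₂‖ ≤ B') (hr : ‖r₁ - r₂‖ ≤ s) (hT : ‖T₁ - T₂‖ ≤ t) :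
    ‖(innerSL ℝ r₁).comp T₁ - (innerSL ℝ r₂).comp T₂‖ ≤ s * B + B' * t := by
  have h : (innerSL ℝ r₁).comp T₁ - (innerSL ℝ r₂).comp T₂ =
      (innerSL ℝ (r₁ - r₂)).comp T₁ + (innerSL ℝ r₂).comp (T₁ - T₂) := by
    ext v
    simp
  rw [h]
  refine (norm_add_le _ _).trans (add_le_add ?_ ?_)
  · refine (ContinuousLinearMap.opNorm_comp_le _ _).trans ?_
    rw [innerSL_apply_norm]
    exact mul_le_mul hr hT₁ (norm_nonneg _) ((norm_nonneg _).trans hr)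
  · refine (ContinuousLinearMap.opNorm_comp_le _ _).trans ?_
    rw [innerSL_apply_norm]
    exact mul_le_mul hr₂ hT (norm_nonneg _) ((norm_nonneg _).trans hr₂)

theorem norm_comp_le_of_le_one {G : Type*} [NormedAddCommGroup G] [NormedSpace ℝ G]
    {T : F →L[ℝ] G} {P : E →L[ℝ] F} {B : ℝ} (hT : ‖T‖ ≤ B) (hP : ‖P‖ ≤ 1) : ‖T.comp P‖ ≤ B := by
  refine (ContinuousLinearMap.opNorm_comp_le _ _).trans ?_
  exact (mul_le_of_le_one_right (norm_nonneg _) hP).trans hT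

end Hilbert

variable {n m N : ℕ} [NeZero n] {A a b d : ℝ}

theorem residual_norm_sq_of_coeFn {r : Lp (Vec N) 2 (ivl a b)} {f : ℝ → Vec N}
    (h : r =ᵐ[ivl a b] f) : ‖r‖ ^ 2 = ∫ y in Ioo a b, ‖f y‖ ^ 2 := by
  rw [← Lp.toLp_coeFn r (Lp.memLp r), norm_toLp_sq]
  refine integral_congr_ae ?_
  filter_upwards [h] with y hy
  rw [hy]

/-- `wRes` depends on a proof that `W` lies in the space, so equal functions cannot simply be
rewritten inside it. -/
theorem wRes_congr (d lam : ℝ) (K : Pt n → ℝ → ℝ → ℝ) (μs : Pt n → ℝ) {W V : GridFn n m N}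
    (hW : W ∈ H1h n m N A a b) (hV : V ∈ H1h n m N A a b) (h : W = V) (p : intNodes n m) :
    wRes d lam K μs hW p = wRes d lam K μs hV p := by
  subst h
  rfl

/-- The terms with `D_N` and `A_i` are linear in `W` and cancel, leaving the Taylor remainder of the
nonlinear term. -/
theorem wRes_add_sub_eq {lam : ℝ} {K : Pt n → ℝ → ℝ → ℝ} {μs : Pt n → ℝ} {W : GridFn n m N} (hW : W ∈ H1h n m N A a b) (v : H10 n m N A a b)
    (p : intNodes n m) :
    wRes d lam K μs (add_mem hW v.fn_mem) p - wRes d lam K μs hW p - opT A a b d lam K μs W p v =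
      wN A a b d lam K μs (W + v.fn) p - wN A a b d lam K μs W p -
        wF A a b d lam K μs W p (H10.partL (p, 0, 0) v) := by
  have hpart : ∀ q, H10.partL q v = h1Part v.fn_mem q := fun q => rfl
  simp only [wRes, opT, h1Part_add hW v.fn_mem, map_add, Finset.sum_add_distrib,
    add_apply, ContinuousLinearMap.comp_apply, sum_apply, hpart]
  abel

theorem norm_taylor_le {ρ C : ℝ} {K : Pt n → ℝ → ℝ → ℝ} {μs : Pt n → ℝ}
    (hS : SysBounds n N A a b d ρ C K μs) (hA : 0 < A) (hm : 0 < m) {W : GridFn n m N} (hWρ : SupLe a b ρ W) {v : H10 n m N A a b}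
    (hvρ : SupLe a b ρ (W + v.fn)) {p : Node n m} (hp : p ∈ intNodes n m) {y : ℝ}
    (hy : y ∈ Ioo a b) :
    ‖nonlin d K μs (W p y + v.fn p y) (gridPt A p y) - nonlin d K μs (W p y) (gridPt A p y) -
      nonlinD d K μs (W p y) (gridPt A p y) (v.fn p y)‖ ≤ C * ‖v.fn p y‖ ^ 2 := by
  have h := hS.taylor _ (gridPt_mem_Omega hA hm hp hy) (W p y) (W p y + v.fn p y)
    (hWρ p hp y hy) (hvρ p hp y hy)
  rwa [add_sub_cancel_left] at h

section Estimates

variable {ρ C lam : ℝ} {K : Pt n → ℝ → ℝ → ℝ} {μs : Pt n → ℝ}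
  (hS : SysBounds n N A a b d ρ C K μs) (hA : 0 < A) (hm : 0 < m) (hlam : 0 ≤ lam)

include hS hA hm hlam

theorem J_eq {W : GridFn n m N} (hW : W ∈ H1h n m N A a b) (hWρ : SupLe a b ρ W) :
    J A a b d K μs lam W = ∑ p, ‖wRes d lam K μs hW p‖ ^ 2 := by
  rw [J, l2NormSq, ← Finset.sum_coe_sort]
  refine Finset.sum_congr rfl fun p _ => ?_
  rw [residual_norm_sq_of_coeFn (coeFn_wRes hS hA hm hlam hW hWρ p)]

/-- There are `n + 2` summands: one for `D_N`, `n` for the `A_i` and one for the nonlinear term.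
Each composes a multiplication with a projection of norm at most 1. -/
theorem norm_opT_le (hC : 0 ≤ C) {W : GridFn n m N} (hW : W ∈ H1h n m N A a b)
    (hWρ : SupLe a b ρ W) (p : intNodes n m) :
    ‖opT A a b d lam K μs W p‖ ≤ (n + 2) * (Real.exp (lam * b) * C) := by
  have hE : 0 ≤ Real.exp (lam * b) * C := by positivity
  have hD := wD_bound hS hA hm hlam p.2
  have hF := wF_bound hS hA hm hlam hW hWρ p.2
  have h1 := norm_comp_le_of_le_one (norm_mulOp_le hD.1 hE hD.2)
    (H10.norm_partL_le (N := N) (A := A) (a := a) (b := b) (p, 0, 2))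
  have h2 := norm_comp_le_of_le_one (norm_mulOp_le hF.1 hE hF.2)
    (H10.norm_partL_le (N := N) (A := A) (a := a) (b := b) (p, 0, 0))
  have h3 : ‖∑ i, (wA N A a b d lam i p.1).comp
      (H10.partL (N := N) (A := A) (a := a) (b := b) (p, i, 1))‖ ≤
      ∑ i : Fin n, Real.exp (lam * b) * C := by
    refine norm_sum_le_of_le (E := H10 n m N A a b →L[ℝ] Lp (Vec N) 2 (ivl a b)) _ fun i _ => ?_
    have hAi := wA_bound hS hA hm hlam p.2 i
    exact norm_comp_le_of_le_one (norm_mulOp_le hAi.1 hE hAi.2) (H10.norm_partL_le (p, i, 1))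
  rw [Finset.sum_const, Finset.card_univ, Fintype.card_fin, nsmul_eq_mul] at h3
  rw [opT]
  refine norm_add₃_le.trans ((add_le_add (add_le_add h1 h3) h2).trans (le_of_eq ?_))
  ring

theorem norm_wN_le (hC : 0 ≤ C) {W : GridFn n m N} (hW : W ∈ H1h n m N A a b)
    (hWρ : SupLe a b ρ W) {p : Node n m} (hp : p ∈ intNodes n m) :
    ‖wN A a b d lam K μs W p‖ ≤
      Real.sqrt ((ivl a b).real univ) * (Real.exp (lam * b) * C) := by
  refine norm_le_of_ae_bound (by positivity) ?_
  filter_upwards [coeFn_wN hS hA hm hlam hW hWρ hp, (wN_bound hS hA hm hlam hW hWρ hp).2]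
    with y h1 h2
  rw [h1]
  exact h2

theorem norm_wRes_le (hC : 0 ≤ C) {W : GridFn n m N} (hW : W ∈ H1h n m N A a b)
    (hWρ : SupLe a b ρ W) {R : ℝ} (hR : h1Norm A a b W ≤ R) (p : intNodes n m) :
    ‖wRes d lam K μs hW p‖ ≤ (Real.exp (lam * b) * C) * ((n + 1) * R) +
      Real.sqrt ((ivl a b).real univ) * (Real.exp (lam * b) * C) := by
  have hE : 0 ≤ Real.exp (lam * b) * C := by positivity
  have hD := wD_bound hS hA hm hlam p.2
  have hpart := fun q => (norm_h1Part_le hW q).trans hR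
  have h1 : ‖wD N A a b d lam p.1 (h1Part hW (p, 0, 2))‖ ≤ (Real.exp (lam * b) * C) * R :=
    (ContinuousLinearMap.le_opNorm _ _).trans
      (mul_le_mul (norm_mulOp_le hD.1 hE hD.2) (hpart _) (norm_nonneg _) hE)
  have h3 : ‖∑ i, wA N A a b d lam i p.1 (h1Part hW (p, i, 1))‖ ≤
      ∑ i : Fin n, (Real.exp (lam * b) * C) * R := by
    refine norm_sum_le_of_le _ fun i _ => ?_
    have hAi := wA_bound hS hA hm hlam p.2 i
    exact (ContinuousLinearMap.le_opNorm _ _).trans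
      (mul_le_mul (norm_mulOp_le hAi.1 hE hAi.2) (hpart _) (norm_nonneg _) hE)
  rw [Finset.sum_const, Finset.card_univ, Fintype.card_fin, nsmul_eq_mul] at h3
  rw [wRes]
  refine norm_add₃_le.trans ((add_le_add (add_le_add h1 h3)
    (norm_wN_le hS hA hm hlam hC hW hWρ p.2)).trans (le_of_eq ?_))
  ring

theorem coeFn_wRes_add_sub {W : GridFn n m N} (hW : W ∈ H1h n m N A a b)
    (hWρ : SupLe a b ρ W) (v : H10 n m N A a b) (hvρ : SupLe a b ρ (W + v.fn))
    (p : intNodes n m) :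
    wRes d lam K μs (add_mem hW v.fn_mem) p - wRes d lam K μs hW p - opT A a b d lam K μs W p v
      =ᵐ[ivl a b] fun y => Real.exp (lam * y) •
        (nonlin d K μs (W p y + v.fn p y) (gridPt A p.1 y) - nonlin d K μs (W p y) (gridPt A p.1 y) -
          nonlinD d K μs (W p y) (gridPt A p.1 y) (v.fn p y)) := by
  rw [wRes_add_sub_eq]
  have hF := wF_bound hS hA hm hlam hW hWρ p.2
  filter_upwards [Lp.coeFn_sub (wN A a b d lam K μs (W + v.fn) p - wN A a b d lam K μs W p)
      (wF A a b d lam K μs W p (H10.partL (p, 0, 0) v)),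
    Lp.coeFn_sub (wN A a b d lam K μs (W + v.fn) p) (wN A a b d lam K μs W p),
    coeFn_wN hS hA hm hlam hW hWρ p.2,
    coeFn_wN hS hA hm hlam (add_mem hW v.fn_mem) hvρ p.2,
    coeFn_mulOp hF.1 hF.2 (H10.partL (p, 0, 0) v), H10.coeFn_partL (p, 0, 0) v]
    with y h1 h2 h3 h4 h5 h6
  rw [h1, Pi.sub_apply, h2, Pi.sub_apply, h3, h4, wF, h5, h6, smul_sub, smul_sub]
  rfl

/-- The pointwise remainder is at most `C |v(y)|²`. The embedding into continuous functions replaces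
it by a multiple of `‖v‖²`, after which the `L₂` norm costs only the length of the interval. -/
theorem norm_wRes_add_sub_le (hC : 0 ≤ C) (hab : a < b) {W : GridFn n m N}
    (hW : W ∈ H1h n m N A a b) (hWρ : SupLe a b ρ W) (v : H10 n m N A a b)
    (hvρ : SupLe a b ρ (W + v.fn)) (p : intNodes n m) :
    ‖wRes d lam K μs (add_mem hW v.fn_mem) p - wRes d lam K μs hW p -
        opT A a b d lam K μs W p v‖ ≤
      Real.sqrt ((ivl a b).real univ) * (Real.exp (lam * b) * (C * supConst a b ^ 2)) *
        ‖v‖ ^ 2 := by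
  rw [mul_assoc]
  refine norm_le_of_ae_bound (by positivity) ?_
  filter_upwards [coeFn_wRes_add_sub hS hA hm hlam hW hWρ v hvρ p,
    ae_restrict_mem measurableSet_Ioo] with y h1 hy
  rw [h1, norm_smul, Real.norm_of_nonneg (Real.exp_pos _).le, mul_assoc]
  refine mul_le_mul (Real.exp_le_exp.2 (mul_le_mul_of_nonneg_left hy.2.le hlam)) ?_
    (norm_nonneg _) (Real.exp_pos _).le
  refine (norm_taylor_le hS hA hm hWρ hvρ p.2 hy).trans ?_
  rw [mul_assoc, ← mul_pow]
  exact mul_le_mul_of_nonneg_left (pow_le_pow_left₀ (norm_nonneg _)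
    (v.norm_fn_apply_le hab p.2 (Ioo_subset_Icc_self hy)) 2) hC

/-- Only the multiplication by `nonlinD` depends on the base point. -/
theorem norm_opT_sub_le (hC : 0 ≤ C) {W V : GridFn n m N} (hW : W ∈ H1h n m N A a b)
    (hWρ : SupLe a b ρ W) (hV : V ∈ H1h n m N A a b) (hVρ : SupLe a b ρ V) {M : ℝ} (hM : 0 ≤ M)
    (p : intNodes n m) (hWV : ∀ y ∈ Ioo a b, ‖W p y - V p y‖ ≤ M) :
    ‖opT A a b d lam K μs W p - opT A a b d lam K μs V p‖ ≤ Real.exp (lam * b) * (C * M) := by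
  have hF := wF_bound hS hA hm hlam hW hWρ p.2
  have hF' := wF_bound hS hA hm hlam hV hVρ p.2
  have h : opT A a b d lam K μs W p - opT A a b d lam K μs V p =
      (wF A a b d lam K μs W p - wF A a b d lam K μs V p).comp (H10.partL (p, 0, 0)) := by
    rw [opT, opT, add_sub_add_left_eq_sub, ContinuousLinearMap.sub_comp]
  rw [h]
  refine norm_comp_le_of_le_one ?_ (H10.norm_partL_le (p, 0, 0))
  rw [wF, wF, mulOp_sub hF.1 hF'.1 hF.2 hF'.2]
  refine norm_mulOp_le (hF.1.sub hF'.1) (by positivity) ?_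
  filter_upwards [ae_restrict_mem measurableSet_Ioo] with y hy
  rw [Pi.sub_apply, ← smul_sub, norm_smul, Real.norm_of_nonneg (Real.exp_pos _).le]
  refine mul_le_mul (Real.exp_le_exp.2 (mul_le_mul_of_nonneg_left hy.2.le hlam)) ?_
    (norm_nonneg _) (Real.exp_pos _).le
  exact (hS.nonlinD_sub_le _ (gridPt_mem_Omega hA hm p.2 hy) _ _ (hWρ p p.2 y hy)
    (hVρ p p.2 y hy)).trans (mul_le_mul_of_nonneg_left (hWV y hy) hC)

end Estimates

end

section

/-! ### The derivative of the functional -/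

theorem norm_le_of_norm_sub_le {E : Type*} [SeminormedAddCommGroup E] {x y : E} {s t : ℝ}
    (hxy : ‖x - y‖ ≤ s) (hy : ‖y‖ ≤ t) : ‖x‖ ≤ s + t := by
  have h := norm_add_le (x - y) y
  rw [sub_add_cancel] at h
  exact h.trans (add_le_add hxy hy)

theorem norm_sum_two_smul_sub_le {ι E : Type*} [Fintype ι] [NormedAddCommGroup E]
    [NormedSpace ℝ E] {S T : ι → E →L[ℝ] ℝ} {t : ℝ} (h : ∀ i, ‖S i - T i‖ ≤ t) :
    ‖∑ i, (2 : ℝ) • S i - ∑ i, (2 : ℝ) • T i‖ ≤ Fintype.card ι * (2 * t) := by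
  rw [← Finset.sum_sub_distrib]
  have hs : ‖∑ i, ((2 : ℝ) • S i - (2 : ℝ) • T i)‖ ≤ ∑ _i : ι, 2 * t := by
    refine norm_sum_le_of_le _ fun i _ => ?_
    have h2 : (2 : ℝ) • S i - (2 : ℝ) • T i = (2 : ℝ) • (S i - T i) := (smul_sub _ _ _).symm
    rw [h2]
    refine (ContinuousLinearMap.opNorm_smul_le _ _).trans ?_
    rw [Real.norm_of_nonneg zero_le_two]
    exact mul_le_mul_of_nonneg_left (h i) zero_le_two
  rwa [Finset.sum_const, Finset.card_univ, nsmul_eq_mul] at hs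

variable {n m N : ℕ} [NeZero n] {A a b d : ℝ}

/-- The derivative of `J_λ`. -/
def gradF (d lam : ℝ) (K : Pt n → ℝ → ℝ → ℝ) (μs : Pt n → ℝ) {W : GridFn n m N}
    (hW : W ∈ H1h n m N A a b) : H10 n m N A a b →L[ℝ] ℝ :=
  ∑ p, (2 : ℝ) • (innerSL ℝ (wRes d lam K μs hW p)).comp (opT A a b d lam K μs W p)

theorem supLe_of_h1Norm_le (hab : a < b) {W : GridFn n m N} (hW : W ∈ H1h n m N A a b) {R R' : ℝ}
    (hR : h1Norm A a b W ≤ R) (hRR' : R ≤ R') : SupLe a b (supConst a b * R') W := fun _ hp _ hy =>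
  (norm_apply_le_h1Norm hab hW hp (Ioo_subset_Icc_self hy)).trans
    (mul_le_mul_of_nonneg_left (hR.trans hRR') (supConst_nonneg a b))

/-- The radius `R + 1` leaves room around the ball, so that differentiability also holds at points
with norm exactly `R`. -/
theorem supLe_add (hab : a < b) {W : GridFn n m N} (hW : W ∈ H1h n m N A a b) {R : ℝ}
    (hR : h1Norm A a b W ≤ R) {v : H10 n m N A a b} (hv : ‖v‖ ≤ 1) :
    SupLe a b (supConst a b * (R + 1)) (W + v.fn) := by
  refine supLe_of_h1Norm_le hab (add_mem hW v.fn_mem) ?_ le_rfl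
  rw [H10.norm_eq] at hv
  exact (h1Norm_add_le hW v.fn_mem).trans (add_le_add hR hv)

section Derivative

variable {C R lam : ℝ} {K : Pt n → ℝ → ℝ → ℝ} {μs : Pt n → ℝ}
  (hS : SysBounds n N A a b d (supConst a b * (R + 1)) C K μs) (hA : 0 < A) (hm : 0 < m)
  (hlam : 0 ≤ lam) (hC : 0 ≤ C) (hab : a < b)

include hS hA hm hlam hC hab

/-- Near `v = 0` the functional is a finite sum of squared norms of residuals, each differentiable
by its quadratic remainder estimate. -/
theorem hasFDerivAt_J {W : GridFn n m N} (hW : W ∈ H1h n m N A a b) (hR : h1Norm A a b W ≤ R) :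
    HasFDerivAt (fun v : H10 n m N A a b => J A a b d K μs lam (W + v.fn))
      (gradF d lam K μs hW) 0 := by
  have hWρ := supLe_of_h1Norm_le hab hW hR (le_add_of_nonneg_right zero_le_one)
  have h0 : ∀ p, wRes d lam K μs (add_mem hW (0 : H10 n m N A a b).fn_mem) p =
      wRes d lam K μs hW p := fun p => wRes_congr d lam K μs _ _ (add_zero W) p
  have h1 : ∀ p, HasFDerivAt (fun v : H10 n m N A a b => wRes d lam K μs (add_mem hW v.fn_mem) p)
      (opT A a b d lam K μs W p) 0 := fun p => by
    refine hasFDerivAt_zero_of_quadratic (C := Real.sqrt ((ivl a b).real univ) *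
      (Real.exp (lam * b) * (C * supConst a b ^ 2))) fun v hv => ?_
    rw [h0]
    exact norm_wRes_add_sub_le hS hA hm hlam hC hab hW hWρ v (supLe_add hab hW hR hv) p
  have h2 : HasFDerivAt (fun v : H10 n m N A a b =>
      ∑ p, ‖wRes d lam K μs (add_mem hW v.fn_mem) p‖ ^ 2) (gradF d lam K μs hW) 0 := by
    refine HasFDerivAt.fun_sum fun p _ => ?_
    refine (h1 p).norm_sq.congr_fderiv ?_
    rw [h0, ← Nat.cast_smul_eq_nsmul ℝ]
    rfl
  refine h2.congr_of_eventuallyEq ?_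
  filter_upwards [Metric.closedBall_mem_nhds (0 : H10 n m N A a b) one_pos] with v hv
  exact J_eq hS hA hm hlam (add_mem hW v.fn_mem) (supLe_add hab hW hR (by simpa using hv))

end Derivative

theorem exists_lipschitz_gradF (n m N : ℕ) [NeZero n] {C R lam : ℝ} (hab : a < b) (hC : 0 ≤ C)
    (hR0 : 0 ≤ R) (hA : 0 < A) (hm : 0 < m) (hlam : 0 ≤ lam) :
    ∃ L : ℝ, 0 < L ∧ ∀ (K : Pt n → ℝ → ℝ → ℝ) (μs : Pt n → ℝ),
      SysBounds n N A a b d (supConst a b * (R + 1)) C K μs →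
      ∀ (W : GridFn n m N) (hW : W ∈ H1h n m N A a b) (v : H10 n m N A a b),
        h1Norm A a b W ≤ R → h1Norm A a b (W + v.fn) ≤ R → ‖v‖ ≤ 2 * R →
        ‖gradF d lam K μs (add_mem hW v.fn_mem) - gradF d lam K μs hW‖ ≤ L * ‖v‖ := by
  set E := Real.exp (lam * b) with hE
  have hE0 : 0 < E := Real.exp_pos _
  set s := Real.sqrt ((ivl a b).real univ) with hs
  have hs0 : 0 ≤ s := Real.sqrt_nonneg _
  have hS0 := supConst_nonneg a b
  set B := (n + 2) * (E * C) with hB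
  set Q := s * (E * (C * supConst a b ^ 2)) with hQ
  set B' := (E * C) * ((n + 1) * R) + s * (E * C) with hB'
  have hB0 : 0 ≤ B := by positivity
  have hQ0 : 0 ≤ Q := by positivity
  have hB'0 : 0 ≤ B' := by positivity
  -- The derivative pairs the residual with its linearization. `B + Q * (2 * R)` is a Lipschitz
  -- constant of the residual and `B` bounds the linearization; `B'` bounds the residual and the
  -- last factor is a Lipschitz constant of the linearization.
  set L₁ := (B + Q * (2 * R)) * B + B' * (E * (C * supConst a b)) with hL₁
  have hL₁0 : 0 ≤ L₁ := by positivity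
  refine ⟨(intNodes n m).card * (2 * L₁) + 1, by positivity, fun K μs hS W hW v hR hR' hv => ?_⟩
  have hWρ := supLe_of_h1Norm_le hab hW hR (le_add_of_nonneg_right zero_le_one)
  have hVρ := supLe_of_h1Norm_le hab (add_mem hW v.fn_mem) hR' (le_add_of_nonneg_right zero_le_one)
  have hp : ∀ p : intNodes n m,
      ‖(innerSL ℝ (wRes d lam K μs (add_mem hW v.fn_mem) p)).comp
          (opT A a b d lam K μs (W + v.fn) p) -
        (innerSL ℝ (wRes d lam K μs hW p)).comp (opT A a b d lam K μs W p)‖ ≤ L₁ * ‖v‖ := by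
    intro p
    have h1 := norm_opT_le hS hA hm hlam hC (add_mem hW v.fn_mem) hVρ p
    have h1' := norm_opT_le hS hA hm hlam hC hW hWρ p
    have h2 := norm_wRes_le hS hA hm hlam hC hW hWρ hR p
    have h3 : ‖wRes d lam K μs (add_mem hW v.fn_mem) p - wRes d lam K μs hW p‖ ≤
        (B + Q * (2 * R)) * ‖v‖ := by
      have h4 := norm_wRes_add_sub_le hS hA hm hlam hC hab hW hWρ v hVρ p
      have h5 := (opT A a b d lam K μs W p).le_of_opNorm_le h1' v
      -- One factor `‖v‖` is at most the diameter `2 R`, so the quadratic remainder becomes linear.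
      have h6 : Q * ‖v‖ ^ 2 ≤ Q * (2 * R) * ‖v‖ := by
        have := mul_le_mul_of_nonneg_left (mul_le_mul_of_nonneg_right hv (norm_nonneg v)) hQ0
        linarith [mul_assoc Q (2 * R) ‖v‖, sq ‖v‖ ▸ this]
      refine (norm_le_of_norm_sub_le h4 h5).trans ?_
      rw [add_mul]
      linarith
    have h8 := norm_opT_sub_le hS hA hm hlam hC (add_mem hW v.fn_mem) hVρ hW hWρ
      (M := supConst a b * ‖v‖) (by positivity) p fun y hy => by
        have := v.norm_fn_apply_le hab p.2 (Ioo_subset_Icc_self hy)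
        simpa using this
    refine (norm_inner_comp_sub_le h1 h2 h3 h8).trans (le_of_eq ?_)
    rw [hL₁]
    ring
  refine (norm_sum_two_smul_sub_le hp).trans ?_
  rw [Fintype.card_coe]
  nlinarith [norm_nonneg v]

end

section

/-! ### Strict convexity -/

section Square

variable {X E : Type*} [MeasurableSpace X] {μ : Measure X} [IsFiniteMeasure μ]
  [NormedAddCommGroup E] [InnerProductSpace ℝ E]

theorem half_integral_sq_le {f : Lp E 2 μ} {u : X → ℝ} {k : ℝ} (hu0 : ∀ x, 0 ≤ u x)
    (hu : Integrable (fun x => u x ^ 2) μ) (h : ∀ᵐ x ∂μ, u x ≤ ‖f x‖ + k) :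
    (∫ x, u x ^ 2 ∂μ) / 2 ≤ ‖f‖ ^ 2 + μ.real univ * k ^ 2 := by
  have hf : Integrable (fun x => ‖f x‖ ^ 2) μ :=
    (memLp_two_iff_integrable_sq_norm (Lp.memLp f).1).1 (Lp.memLp f)
  have hfn : ‖f‖ ^ 2 = ∫ x, ‖f x‖ ^ 2 ∂μ := by
    rw [← norm_toLp_sq (Lp.memLp f), Lp.toLp_coeFn]
  have h1 : ∫ x, u x ^ 2 ∂μ ≤ ∫ x, (2 * ‖f x‖ ^ 2 + 2 * k ^ 2) ∂μ := by
    refine integral_mono_ae hu ((hf.const_mul 2).add (integrable_const _)) ?_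
    filter_upwards [h] with x hx
    nlinarith [pow_le_pow_left₀ (hu0 x) hx 2, sq_nonneg (‖f x‖ - k)]
  rw [integral_add (hf.const_mul 2) (integrable_const _), integral_const_mul, ← hfn,
    integral_const, smul_eq_mul] at h1
  linarith

/-- The product of the norms is bounded by a constant times a third function `f₀`, which is to be
the unweighted residual. Cauchy-Schwarz with the constant function 1 then gives the `L₂` norm of
`f₀`. -/
theorem abs_inner_le_of_ae_bound {f g f₀ : Lp E 2 μ} {D : ℝ} (hD : 0 ≤ D)
    (h : ∀ᵐ x ∂μ, ‖f x‖ * ‖g x‖ ≤ D * ‖f₀ x‖) :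
    |inner ℝ f g| ≤ D * (Real.sqrt (μ.real univ) * ‖f₀‖) := by
  have hf₀ : Integrable (fun x => ‖f₀ x‖ ^ 2) μ :=
    (memLp_two_iff_integrable_sq_norm (Lp.memLp f₀).1).1 (Lp.memLp f₀)
  have hf₀' : Integrable (fun x => ‖f₀ x‖) μ :=
    ((Lp.memLp f₀).integrable one_le_two).norm
  have hfn : ‖f₀‖ ^ 2 = ∫ x, ‖f₀ x‖ ^ 2 ∂μ := by
    rw [← norm_toLp_sq (Lp.memLp f₀), Lp.toLp_coeFn]
  have h1 : ∫ x, ‖f₀ x‖ ∂μ ≤ Real.sqrt (μ.real univ) * ‖f₀‖ := by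
    have h2 := sq_integral_mul_le (μ := μ) (f := fun _ => 1) (g := fun x => ‖f₀ x‖) (by simp) hf₀
      (by simpa using hf₀')
    rw [← hfn] at h2
    refine abs_le_of_sq_le_sq' ?_ (by positivity) |>.2
    rw [mul_pow, Real.sq_sqrt measureReal_nonneg]
    simpa using h2
  rw [L2.inner_def]
  refine (abs_integral_le_integral_abs).trans (le_trans ?_ (mul_le_mul_of_nonneg_left h1 hD))
  rw [← integral_const_mul]
  refine integral_mono_ae (L2.integrable_inner f g).abs (hf₀'.const_mul D) ?_
  filter_upwards [h] with x hx
  exact (abs_real_inner_le_norm _ _).trans hx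

/-- Here `t` is the linearized increment of the residual. The gap in convexity splits into a square
and a pairing with the quadratic remainder. -/
theorem norm_sq_sub_norm_sq_sub (r₁ r₂ t : E) : ‖r₂‖ ^ 2 - ‖r₁‖ ^ 2 - 2 * inner ℝ r₁ t =
    ‖r₂ - r₁‖ ^ 2 + 2 * inner ℝ r₁ (r₂ - r₁ - t) := by
  rw [norm_sub_sq_real, inner_sub_right, inner_sub_right, real_inner_self_eq_norm_sq,
    real_inner_comm r₁ r₂]
  ring

end Square

variable {n m N : ℕ} [NeZero n] {A a b d : ℝ}

/-- The square of the weighted norm of the derivatives in `y`. -/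
def weightedDerivSq (lam : ℝ) (v : H10 n m N A a b) : ℝ :=
  ∑ p ∈ intNodes n m, ∫ t in Ioo a b, (Real.exp (lam * t) * ‖deriv (v.fn p) t‖) ^ 2

theorem weightedDerivSq_nonneg (lam : ℝ) (v : H10 n m N A a b) : 0 ≤ weightedDerivSq lam v :=
  Finset.sum_nonneg fun _ _ => integral_nonneg fun _ => sq_nonneg _

/-- The Carleman estimate for the operator `d/dy` on functions which vanish at `y = b`. -/
theorem exp_mul_norm_fn_le (hab : a < b) {lam : ℝ} (hlam : 0 < lam) (v : H10 n m N A a b)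
    {p : Node n m} (hp : p ∈ intNodes n m) {y : ℝ} (hy : y ∈ Ioo a b) :
    Real.exp (lam * y) * ‖v.fn p y‖ ≤ Real.sqrt (weightedDerivSq lam v / (2 * lam)) := by
  refine Real.le_sqrt_of_sq_le ?_
  refine ((v.isH1 hp).weighted_norm_sq_le (v.fn_right hab.le p) lam
    (Ioo_subset_Icc_self hy)).trans ?_
  rw [div_eq_inv_mul, ← one_div]
  refine mul_le_mul (integral_exp_le_inv hlam hy.2.le) ?_
    (integral_nonneg fun _ => sq_nonneg _) (by positivity)
  exact Finset.single_le_sum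
    (f := fun p => ∫ t in Ioo a b, (Real.exp (lam * t) * ‖deriv (v.fn p) t‖) ^ 2)
    (fun _ _ => integral_nonneg fun _ => sq_nonneg _) hp

theorem exp_mul_sum_le_weightedDerivSq {lam : ℝ} (hlam : 0 ≤ lam) (v : H10 n m N A a b) :
    Real.exp (2 * lam * a) * ∑ p ∈ intNodes n m, ∫ t in Ioo a b, ‖deriv (v.fn p) t‖ ^ 2 ≤
      weightedDerivSq lam v := by
  rw [weightedDerivSq, Finset.mul_sum]
  refine Finset.sum_le_sum fun p hp => ?_
  rw [← integral_const_mul]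
  refine setIntegral_mono_on ((v.isH1 hp).integrableOn_deriv_sq.const_mul _)
    ((v.isH1 hp).integrableOn_weighted lam) measurableSet_Ioo fun t ht => ?_
  rw [mul_pow, ← Real.exp_nat_mul]
  refine mul_le_mul_of_nonneg_right (Real.exp_le_exp.2 ?_) (sq_nonneg _)
  push_cast
  nlinarith [ht.1]

section Convexity

variable {ρ C c : ℝ} {K : Pt n → ℝ → ℝ → ℝ} {μs : Pt n → ℝ}
  (hS : SysBounds n N A a b d ρ C K μs) (hA : 0 < A) (hm : 0 < m) (hC : 0 ≤ C)

include hS hA hm hC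

/-- Taylor's formula together with `‖v‖ ≤ 2 ρ`, which makes the quadratic term linear. -/
theorem norm_nonlin_sub_le {W : GridFn n m N} (hWρ : SupLe a b ρ W) {v : H10 n m N A a b}
    (hvρ : SupLe a b ρ (W + v.fn)) {p : Node n m} (hp : p ∈ intNodes n m) {y : ℝ}
    (hy : y ∈ Ioo a b) :
    ‖nonlin d K μs (W p y + v.fn p y) (gridPt A p y) - nonlin d K μs (W p y) (gridPt A p y)‖ ≤
      (C + C * (2 * ρ)) * ‖v.fn p y‖ := by
  have h1 := norm_taylor_le hS hA hm hWρ hvρ hp hy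
  have h2 : ‖nonlinD d K μs (W p y) (gridPt A p y) (v.fn p y)‖ ≤ C * ‖v.fn p y‖ :=
    ContinuousLinearMap.le_of_opNorm_le _
      (hS.nonlinD_le _ (gridPt_mem_Omega hA hm hp hy) _ (hWρ p hp y hy)) _
  have h3 : ‖v.fn p y‖ ≤ 2 * ρ := by
    have h4 := norm_sub_le (W p y + v.fn p y) (W p y)
    rw [add_sub_cancel_left] at h4
    have h5 := hWρ p hp y hy
    have h6 : ‖W p y + v.fn p y‖ ≤ ρ := hvρ p hp y hy
    linarith
  refine (norm_le_of_norm_sub_le h1 h2).trans ?_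
  have h7 := mul_le_mul_of_nonneg_left (mul_le_mul_of_nonneg_right h3 (norm_nonneg (v.fn p y))) hC
  nlinarith

/-- The difference of the two systems is solved for `D_N v_y`. The remaining terms involve only the
values of `v` at height `y`, whose neighbours on the grid also obey the bound `M`. -/
theorem norm_deriv_le_residual_sub (hc : ∀ X ∈ Omega n A a b, ∀ w : Vec N,
      c * ‖w‖ ≤ ‖matCLM (matD N d X) w‖) {W : GridFn n m N} (hWρ : SupLe a b ρ W)
    {v : H10 n m N A a b} (hvρ : SupLe a b ρ (W + v.fn)) {p : Node n m} (hp : p ∈ intNodes n m)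
    {y : ℝ} (hy : y ∈ Ioo a b) (hWd : DifferentiableAt ℝ (W p) y)
    (hvd : DifferentiableAt ℝ (v.fn p) y) {M : ℝ} (hρ : 0 ≤ ρ)
    (hM : ∀ q ∈ intNodes n m, ‖v.fn q y‖ ≤ M) :
    c * ‖deriv (v.fn p) y‖ ≤
      ‖residual A d K μs (W + v.fn) p y - residual A d K μs W p y‖ +
        (n * (C * (1 / meshStep A m)) + (C + C * (2 * ρ))) * M := by
  have hX := gridPt_mem_Omega hA hm hp hy
  have hM0 : 0 ≤ M := (norm_nonneg _).trans (hM p hp)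
  have heq : residual A d K μs (W + v.fn) p y - residual A d K μs W p y =
      matCLM (matD N d (gridPt A p y)) (deriv (v.fn p) y) +
        (∑ i : Fin n, matCLM (matA N d i (gridPt A p y)) (fd A i v.fn p y) +
        (nonlin d K μs (W p y + v.fn p y) (gridPt A p y) -
          nonlin d K μs (W p y) (gridPt A p y))) := by
    have hd : deriv (W p + v.fn p) y = deriv (W p) y + deriv (v.fn p) y := deriv_add hWd hvd
    simp only [residual, matCLM_apply, hd, fd_add, Pi.add_apply, map_add, Finset.sum_add_distrib]
    abel
  have h1 : ‖∑ i : Fin n, matCLM (matA N d i (gridPt A p y)) (fd A i v.fn p y)‖ ≤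
      ∑ _i : Fin n, C * (1 / meshStep A m * M) := by
    refine norm_sum_le_of_le _ fun i _ => ?_
    exact (ContinuousLinearMap.le_of_opNorm_le _ (hS.matA_le _ hX i) _).trans
      (mul_le_mul_of_nonneg_left (v.norm_fd_le (meshStep_pos hA hm) hM0 hM i p) hC)
  rw [Finset.sum_const, Finset.card_univ, Fintype.card_fin, nsmul_eq_mul] at h1
  have h2 := (norm_nonlin_sub_le hS hA hm hC hWρ hvρ hp hy).trans
    (mul_le_mul_of_nonneg_left (hM p hp) (by positivity))
  have h3 := norm_add_le_of_le h1 h2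
  refine (hc _ hX _).trans ?_
  rw [heq]
  refine (norm_le_add_norm_add _ _).trans (add_le_add le_rfl (h3.trans (le_of_eq ?_)))
  ring

theorem half_weighted_deriv_le (hc0 : 0 ≤ c) (hc : ∀ X ∈ Omega n A a b, ∀ w : Vec N,
      c * ‖w‖ ≤ ‖matCLM (matD N d X) w‖) (hρ : 0 ≤ ρ) {lam : ℝ} (hlam : 0 ≤ lam)
    {W : GridFn n m N} (hW : W ∈ H1h n m N A a b) (hWρ : SupLe a b ρ W) (v : H10 n m N A a b)
    (hvρ : SupLe a b ρ (W + v.fn)) (p : intNodes n m) {M : ℝ}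
    (hM : ∀ q ∈ intNodes n m, ∀ y ∈ Ioo a b, Real.exp (lam * y) * ‖v.fn q y‖ ≤ M) :
    c ^ 2 / 2 * ∫ t in Ioo a b, (Real.exp (lam * t) * ‖deriv (v.fn p) t‖) ^ 2 ≤
      ‖wRes d lam K μs (add_mem hW v.fn_mem) p - wRes d lam K μs hW p‖ ^ 2 +
        (ivl a b).real univ * ((n * (C * (1 / meshStep A m)) + (C + C * (2 * ρ))) * M) ^ 2 := by
  have hint := ((v.isH1 p.2).integrableOn_weighted lam).const_mul (c ^ 2)
  have key := half_integral_sq_le (μ := ivl a b)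
    (f := wRes d lam K μs (add_mem hW v.fn_mem) p - wRes d lam K μs hW p)
    (u := fun t => c * (Real.exp (lam * t) * ‖deriv (v.fn p) t‖))
    (k := (n * (C * (1 / meshStep A m)) + (C + C * (2 * ρ))) * M)
    (fun t => by positivity) (by simpa only [mul_pow] using hint) ?_
  · simp only [mul_pow _ (Real.exp _ * _), integral_const_mul] at key
    linarith
  filter_upwards [coeFn_wRes hS hA hm hlam hW hWρ p,
    coeFn_wRes hS hA hm hlam (add_mem hW v.fn_mem) hvρ p,
    Lp.coeFn_sub (wRes d lam K μs (add_mem hW v.fn_mem) p) (wRes d lam K μs hW p),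
    (hW.1 p p.2).ae_differentiableAt, (v.isH1 p.2).ae_differentiableAt,
    ae_restrict_mem measurableSet_Ioo] with y h1 h2 h3 hWd hvd hy
  rw [h3, Pi.sub_apply, h1, h2, ← smul_sub, norm_smul, Real.norm_of_nonneg (Real.exp_pos _).le]
  have hE := Real.exp_pos (lam * y)
  -- At height `y` the weighted bound `M` means `‖v‖ ≤ M e^{-λy}`; multiplying by the weight
  -- restores `M`.
  have h4 := norm_deriv_le_residual_sub hS hA hm hC hc hWρ hvρ p.2 hy hWd hvd
    (M := M / Real.exp (lam * y)) hρ fun q hq => by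
      rw [le_div_iff₀ hE, mul_comm]
      exact hM q hq y hy
  calc c * (Real.exp (lam * y) * ‖deriv (v.fn p) y‖)
      = Real.exp (lam * y) * (c * ‖deriv (v.fn p) y‖) := by ring
    _ ≤ _ := mul_le_mul_of_nonneg_left h4 hE.le
    _ = _ := by
      field_simp

/-- Both copies of the weight are moved onto the remainder, where `e^{2λy} |v|² ≤ M²`. The residual
is left with weight 1 (`λ = 0`), so its norm does not grow with `λ`; otherwise the gain `1/λ` would
be lost. -/
theorem abs_inner_remainder_le {lam : ℝ} (hlam : 0 ≤ lam)
    {W : GridFn n m N} (hW : W ∈ H1h n m N A a b) (hWρ : SupLe a b ρ W) (v : H10 n m N A a b)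
    (hvρ : SupLe a b ρ (W + v.fn)) (p : intNodes n m) {M : ℝ}
    (hM : ∀ q ∈ intNodes n m, ∀ y ∈ Ioo a b, Real.exp (lam * y) * ‖v.fn q y‖ ≤ M) :
    |inner ℝ (wRes d lam K μs hW p) (wRes d lam K μs (add_mem hW v.fn_mem) p -
        wRes d lam K μs hW p - opT A a b d lam K μs W p v)| ≤
      C * M ^ 2 * (Real.sqrt ((ivl a b).real univ) * ‖wRes d 0 K μs hW p‖) := by
  refine abs_inner_le_of_ae_bound (by positivity) ?_
  filter_upwards [coeFn_wRes hS hA hm hlam hW hWρ p, coeFn_wRes hS hA hm le_rfl hW hWρ p,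
    coeFn_wRes_add_sub hS hA hm hlam hW hWρ v hvρ p, ae_restrict_mem measurableSet_Ioo]
    with y h1 h2 h3 hy
  rw [h1, h2, h3, zero_mul, Real.exp_zero, one_smul, norm_smul, norm_smul,
    Real.norm_of_nonneg (Real.exp_pos _).le]
  have h4 := norm_taylor_le hS hA hm hWρ hvρ p.2 hy
  have h5 := pow_le_pow_left₀ (by positivity) (hM p p.2 y hy) 2
  have hE := Real.exp_pos (lam * y)
  have h6 := mul_le_mul_of_nonneg_left h4 (sq_nonneg (Real.exp (lam * y)))
  have h7 := mul_le_mul_of_nonneg_left h5 hC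
  have h8 : Real.exp (lam * y) ^ 2 * ‖nonlin d K μs (W p y + v.fn p y) (gridPt A p.1 y) -
      nonlin d K μs (W p y) (gridPt A p.1 y) -
      nonlinD d K μs (W p y) (gridPt A p.1 y) (v.fn p y)‖ ≤ C * M ^ 2 := by
    refine h6.trans (le_trans (le_of_eq ?_) h7)
    ring
  refine le_trans (le_of_eq ?_)
    (mul_le_mul_of_nonneg_right h8 (norm_nonneg (residual A d K μs W p y)))
  ring

end Convexity

theorem J_sub_sub_gradF_eq {ρ C lam : ℝ} {K : Pt n → ℝ → ℝ → ℝ} {μs : Pt n → ℝ}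
    (hS : SysBounds n N A a b d ρ C K μs) (hA : 0 < A) (hm : 0 < m) (hlam : 0 ≤ lam)
    {W : GridFn n m N} (hW : W ∈ H1h n m N A a b) (hWρ : SupLe a b ρ W) (v : H10 n m N A a b)
    (hvρ : SupLe a b ρ (W + v.fn)) :
    J A a b d K μs lam (W + v.fn) - J A a b d K μs lam W - gradF d lam K μs hW v =
      ∑ p, (‖wRes d lam K μs (add_mem hW v.fn_mem) p - wRes d lam K μs hW p‖ ^ 2 +
        2 * inner ℝ (wRes d lam K μs hW p) (wRes d lam K μs (add_mem hW v.fn_mem) p -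
          wRes d lam K μs hW p - opT A a b d lam K μs W p v)) := by
  rw [J_eq hS hA hm hlam hW hWρ, J_eq hS hA hm hlam (add_mem hW v.fn_mem) hvρ, gradF,
    sum_apply, ← Finset.sum_sub_distrib, ← Finset.sum_sub_distrib]
  refine Finset.sum_congr rfl fun p _ => ?_
  exact norm_sq_sub_norm_sq_sub _ _ _

theorem exists_convexity (n m N : ℕ) [NeZero n] {C c CP R : ℝ} (hA : 0 < A) (hm : 0 < m)
    (hab : a < b) (hC : 0 ≤ C) (hc : 0 < c) (hCP : 0 < CP) (hR0 : 0 ≤ R)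
    (hcoer : ∀ X ∈ Omega n A a b, ∀ w : Vec N, c * ‖w‖ ≤ ‖matCLM (matD N d X) w‖)
    (hP : ∀ v : H10 n m N A a b,
      ‖v‖ ^ 2 ≤ CP * ∑ p ∈ intNodes n m, ∫ t in Ioo a b, ‖deriv (v.fn p) t‖ ^ 2) :
    ∃ lam₁ : ℝ, 1 ≤ lam₁ ∧ ∀ (K : Pt n → ℝ → ℝ → ℝ) (μs : Pt n → ℝ),
      SysBounds n N A a b d (supConst a b * (R + 1)) C K μs →
      ∀ lam : ℝ, lam₁ ≤ lam →
      ∀ (W : GridFn n m N) (hW : W ∈ H1h n m N A a b) (v : H10 n m N A a b),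
        h1Norm A a b W ≤ R → h1Norm A a b (W + v.fn) ≤ R →
        c ^ 2 / (4 * CP) * Real.exp (2 * lam * a) * ‖v‖ ^ 2 ≤
          J A a b d K μs lam (W + v.fn) - J A a b d K μs lam W - gradF d lam K μs hW v := by
  have hS0 := supConst_nonneg a b
  set ρ := supConst a b * (R + 1) with hρ
  have hρ0 : 0 ≤ ρ := by positivity
  set s := Real.sqrt ((ivl a b).real univ) with hs
  set vol := (ivl a b).real univ with hvol
  have hvol0 : 0 ≤ vol := measureReal_nonneg
  have hs0 : 0 ≤ s := Real.sqrt_nonneg _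
  have hmesh := meshStep_pos hA hm
  set κ₁ := n * (C * (1 / meshStep A m)) + (C + C * (2 * ρ)) with hκ₁
  set B := (Real.exp (0 * b) * C) * ((n + 1) * R) + s * (Real.exp (0 * b) * C) with hB
  have hB0 : 0 ≤ B := by positivity
  set Q := vol * κ₁ ^ 2 + 2 * (C * (s * B)) with hQ
  have hQ0 : 0 ≤ Q := by positivity
  set k : ℝ := ((intNodes n m).card : ℝ) with hk
  have hk0 : 0 ≤ k := Nat.cast_nonneg _
  -- Over all `k` nodes the errors total `k Q M² = k Q T / (2λ)`. This choice makes them at most `c²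
  -- T / 4`, half of the main term `c² T / 2`.
  refine ⟨1 + 2 * k * Q / c ^ 2, le_add_of_nonneg_right (by positivity),
    fun K μs hS lam hlam W hW v hR hR' => ?_⟩
  have hlam1 : 0 < lam := lt_of_lt_of_le (by positivity) hlam
  have hWρ := supLe_of_h1Norm_le hab hW hR (le_add_of_nonneg_right zero_le_one)
  have hVρ := supLe_of_h1Norm_le hab (add_mem hW v.fn_mem) hR' (le_add_of_nonneg_right zero_le_one)
  have hT0 := weightedDerivSq_nonneg lam v
  set T := weightedDerivSq lam v with hT
  set M := Real.sqrt (T / (2 * lam)) with hM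
  have hMsq : M ^ 2 = T / (2 * lam) := Real.sq_sqrt (by positivity)
  have hMv : ∀ q ∈ intNodes n m, ∀ y ∈ Ioo a b, Real.exp (lam * y) * ‖v.fn q y‖ ≤ M :=
    fun q hq y hy => exp_mul_norm_fn_le hab hlam1 v hq hy
  have hterm : ∀ p : intNodes n m,
      c ^ 2 / 2 * (∫ t in Ioo a b, (Real.exp (lam * t) * ‖deriv (v.fn p) t‖) ^ 2) - Q * M ^ 2 ≤
      ‖wRes d lam K μs (add_mem hW v.fn_mem) p - wRes d lam K μs hW p‖ ^ 2 +
        2 * inner ℝ (wRes d lam K μs hW p) (wRes d lam K μs (add_mem hW v.fn_mem) p -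
          wRes d lam K μs hW p - opT A a b d lam K μs W p v) := by
    intro p
    have h1 := half_weighted_deriv_le hS hA hm hC hc.le hcoer hρ0 hlam1.le hW hWρ v hVρ p hMv
    have h2 := abs_inner_remainder_le hS hA hm hC hlam1.le hW hWρ v hVρ p hMv
    have h3 := norm_wRes_le hS hA hm le_rfl hC hW hWρ hR p
    have h4 := mul_le_mul_of_nonneg_left (mul_le_mul_of_nonneg_left h3 hs0)
      (mul_nonneg hC (sq_nonneg M))
    have h5 := (abs_le.1 (h2.trans h4)).1
    have h6 : Q * M ^ 2 = vol * (κ₁ * M) ^ 2 + 2 * (C * M ^ 2 * (s * B)) := by rw [hQ]; ring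
    linarith
  rw [J_sub_sub_gradF_eq hS hA hm hlam1.le hW hWρ v hVρ]
  refine le_trans ?_ (Finset.sum_le_sum fun p _ => hterm p)
  have hsum : ∑ p : intNodes n m, ∫ t in Ioo a b, (Real.exp (lam * t) * ‖deriv (v.fn p) t‖) ^ 2 =
      T := Finset.sum_coe_sort (intNodes n m)
        (fun p => ∫ t in Ioo a b, (Real.exp (lam * t) * ‖deriv (v.fn p) t‖) ^ 2)
  rw [Finset.sum_sub_distrib, ← Finset.mul_sum, hsum, Finset.sum_const, Finset.card_univ,
    Fintype.card_coe, nsmul_eq_mul, hMsq]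
  have h1 : k * (Q * (T / (2 * lam))) ≤ c ^ 2 / 4 * T := by
    have h2 : 2 * k * Q ≤ c ^ 2 * lam := by
      have h3 : 2 * k * Q / c ^ 2 ≤ lam := by linarith
      rw [div_le_iff₀ (by positivity)] at h3
      linarith
    have h4 : k * (Q * (T / (2 * lam))) = 2 * k * Q * (T / (4 * lam)) := by
      field_simp
      ring
    have h5 : c ^ 2 / 4 * T = c ^ 2 * lam * (T / (4 * lam)) := by
      field_simp
    rw [h4, h5]
    exact mul_le_mul_of_nonneg_right h2 (by positivity)
  -- The weight is at least `e^{λa}`, and the Poincaré inequality passes from the derivatives to the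
  -- full norm. Neither `R` nor `σ` enters this constant.
  have h2 : c ^ 2 / (4 * CP) * Real.exp (2 * lam * a) * ‖v‖ ^ 2 ≤ c ^ 2 / 4 * T := by
    have h3 := mul_le_mul_of_nonneg_left (exp_mul_sum_le_weightedDerivSq hlam1.le v)
      (by positivity : 0 ≤ c ^ 2 / 4)
    refine le_trans ?_ h3
    have h4 := mul_le_mul_of_nonneg_left (hP v)
      (by positivity : 0 ≤ c ^ 2 / (4 * CP) * Real.exp (2 * lam * a))
    refine h4.trans (le_of_eq ?_)
    field_simp
  linarith

end

section

/-! ### Minimization -/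

/-- A strongly convex differentiable function on a closed convex set of a complete space has a
unique minimizer, which satisfies the variational inequality. -/
theorem exists_minimizer_of_stronglyConvex {V : Type*} [NormedAddCommGroup V] [NormedSpace ℝ V]
    [CompleteSpace V] {S : Set V} (hSc : IsClosed S) (hSconv : Convex ℝ S) (hSne : S.Nonempty)
    {f : V → ℝ} {f' : V → V →L[ℝ] ℝ} (hf : ∀ u ∈ S, HasFDerivAt f (f' u) u)
    (hf0 : ∀ u ∈ S, 0 ≤ f u) {c : ℝ} (hc : 0 < c)
    (hconv : ∀ u ∈ S, ∀ w ∈ S, c * ‖w - u‖ ^ 2 ≤ f w - f u - f' u (w - u)) :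
    ∃ u ∈ S, IsMinOn f S u ∧ (∀ w ∈ S, IsMinOn f S w → w = u) ∧ ∀ w ∈ S, 0 ≤ f' u (w - u) := by
  have hbdd : BddBelow (f '' S) := ⟨0, by rintro _ ⟨u, hu, rfl⟩; exact hf0 u hu⟩
  set I := sInf (f '' S) with hI
  have hIle : ∀ u ∈ S, I ≤ f u := fun u hu => csInf_le hbdd (mem_image_of_mem f hu)
  -- Convexity is used at the midpoint `z`, towards both `u` and `w`. The first order terms cancel,
  -- and `f z ≥ I`.
  have hmid : ∀ u ∈ S, ∀ w ∈ S, c / 2 * ‖u - w‖ ^ 2 ≤ f u + f w - 2 * I := by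
    intro u hu w hw
    set z : V := (1 / 2 : ℝ) • u + (1 / 2 : ℝ) • w with hz
    have hzS : z ∈ S := hSconv hu hw (by norm_num) (by norm_num) (by norm_num)
    have h1 := hconv z hzS u hu
    have h2 := hconv z hzS w hw
    have e1 : u - z = (1 / 2 : ℝ) • (u - w) := by rw [hz]; module
    have e2 : w - z = -((1 / 2 : ℝ) • (u - w)) := by rw [hz]; module
    rw [e1] at h1
    rw [e2, map_neg, norm_neg] at h2
    rw [norm_smul, Real.norm_of_nonneg (by norm_num)] at h1 h2
    have h3 := hIle z hzS
    nlinarith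
  have hseq : ∀ k : ℕ, ∃ u ∈ S, f u < I + 1 / ((k : ℝ) + 1) := fun k => by
    obtain ⟨_, ⟨u, hu, rfl⟩, hlt⟩ := exists_lt_of_csInf_lt (hSne.image f)
      (lt_add_of_pos_right I (by positivity : 0 < 1 / ((k : ℝ) + 1)))
    exact ⟨u, hu, hlt⟩
  choose x hxS hx using hseq
  have hlim : Filter.Tendsto (fun k : ℕ => 1 / ((k : ℝ) + 1)) Filter.atTop (nhds 0) :=
    tendsto_one_div_add_atTop_nhds_zero_nat
  have hcauchy : CauchySeq x := by
    refine Metric.cauchySeq_iff'.2 fun ε hε => ?_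
    -- For `k ≥ k₀` the right side of `hmid` is below `2 / (k₀ + 1)`, which must not exceed `c ε² /
    -- 2`.
    obtain ⟨k₀, hk₀⟩ := exists_nat_one_div_lt (by positivity : 0 < c * ε ^ 2 / 4)
    refine ⟨k₀, fun k hk => ?_⟩
    rw [dist_eq_norm]
    have h1 := hmid _ (hxS k) _ (hxS k₀)
    have h2 : 1 / ((k : ℝ) + 1) ≤ 1 / ((k₀ : ℝ) + 1) := Nat.one_div_le_one_div hk
    refine lt_of_pow_lt_pow_left₀ 2 hε.le ?_
    have h3 := hx k
    have h4 := hx k₀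
    have h5 : c / 2 * ‖x k - x k₀‖ ^ 2 < c / 2 * ε ^ 2 := by linarith
    exact lt_of_mul_lt_mul_left h5 (by positivity)
  obtain ⟨u, hu⟩ := cauchySeq_tendsto_of_complete hcauchy
  have huS : u ∈ S := hSc.mem_of_tendsto hu (Filter.Eventually.of_forall hxS)
  have hfu : f u ≤ I := by
    have h1 := (hf u huS).continuousAt.tendsto.comp hu
    have h2 := hlim.const_add I
    rw [add_zero] at h2
    exact le_of_tendsto_of_tendsto' h1 h2 fun k => (hx k).le
  have hmin : IsMinOn f S u := fun w hw => hfu.trans (hIle w hw)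
  -- At a minimizer the derivative is nonnegative along every segment that stays in `S`.
  have hvar : ∀ w ∈ S, 0 ≤ f' u (w - u) := fun w hw =>
    hmin.localize.hasFDerivWithinAt_nonneg (hf u huS).hasFDerivWithinAt
      (sub_mem_posTangentConeAt_of_segment_subset (hSconv.segment_subset huS hw))
  refine ⟨u, huS, hmin, fun w hw hwmin => ?_, hvar⟩
  have h1 := hconv u huS w hw
  have h2 := hvar w hw
  have h3 : f w ≤ f u := hwmin huS
  have h4 : ‖w - u‖ ^ 2 ≤ 0 := by
    by_contra h
    push Not at h
    nlinarith [mul_pos hc h]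
  have h5 : ‖w - u‖ = 0 := by
    have := sq_nonneg ‖w - u‖
    exact pow_eq_zero_iff two_ne_zero |>.1 (le_antisymm h4 this)
  exact sub_eq_zero.1 (norm_eq_zero.1 h5)

variable {n m N : ℕ} [NeZero n] {A a b d : ℝ}

theorem H10.norm_h1Norm_sub_le {W : GridFn n m N} (hW : W ∈ H1h n m N A a b)
    (u v : H10 n m N A a b) :
    h1Norm A a b (W + u.fn) ≤ h1Norm A a b (W + v.fn) + ‖u - v‖ := by
  have h := h1Norm_add_le (add_mem hW v.fn_mem) (u - v).fn_mem
  have e : W + v.fn + (u - v).fn = W + u.fn := by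
    rw [add_assoc, ← H10.fn_add, add_sub_cancel]
  rwa [e, ← H10.norm_eq] at h

theorem H10.continuous_h1Norm_add {W : GridFn n m N} (hW : W ∈ H1h n m N A a b) :
    Continuous fun v : H10 n m N A a b => h1Norm A a b (W + v.fn) := by
  refine LipschitzWith.continuous (K := 1) (LipschitzWith.of_le_add fun u v => ?_)
  rw [dist_eq_norm]
  exact H10.norm_h1Norm_sub_le hW u v

/-- The translations which carry an element of the ball into the ball. -/
def ballShift (R : ℝ) (P W : GridFn n m N) : Set (H10 n m N A a b) :=
  {v | W + v.fn ∈ Bbar A a b R P}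

theorem mem_ballShift {R : ℝ} {P W : GridFn n m N} (hW : W ∈ Bbar A a b R P)
    {v : H10 n m N A a b} : v ∈ ballShift R P W ↔ h1Norm A a b (W + v.fn) ≤ R := by
  refine ⟨fun h => h.2.2, fun h => ⟨add_mem hW.1 v.fn_mem, fun p y hy hp => ?_, h⟩⟩
  have h1 : v.fn p y = 0 := v.2.2 p y hy hp
  rw [Pi.add_apply, Pi.add_apply, hW.2.1 p y hy hp, h1, add_zero]

theorem isClosed_ballShift {R : ℝ} {P W : GridFn n m N} (hW : W ∈ Bbar A a b R P) :
    IsClosed (ballShift R P W : Set (H10 n m N A a b)) := by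
  have h : (ballShift R P W : Set (H10 n m N A a b)) =
      {v | h1Norm A a b (W + v.fn) ≤ R} := Set.ext fun v => mem_ballShift hW
  rw [h]
  exact isClosed_le (H10.continuous_h1Norm_add hW.1) continuous_const

theorem convex_ballShift {R : ℝ} {P W : GridFn n m N} (hW : W ∈ Bbar A a b R P) :
    Convex ℝ (ballShift R P W : Set (H10 n m N A a b)) := by
  intro u hu v hv s t hs ht hst
  rw [mem_ballShift hW] at hu hv ⊢
  have e : W + (s • u + t • v).fn = s • (W + u.fn) + t • (W + v.fn) := by
    rw [H10.fn_add, H10.fn_smul, H10.fn_smul, smul_add, smul_add, add_add_add_comm, ← add_smul,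
      hst, one_smul]
  rw [e]
  refine (h1Norm_add_le (Submodule.smul_mem _ s (add_mem hW.1 u.fn_mem))
    (Submodule.smul_mem _ t (add_mem hW.1 v.fn_mem))).trans ?_
  rw [h1Norm_smul s (add_mem hW.1 u.fn_mem), h1Norm_smul t (add_mem hW.1 v.fn_mem),
    abs_of_nonneg hs, abs_of_nonneg ht]
  have h1 := mul_le_mul_of_nonneg_left hu hs
  have h2 := mul_le_mul_of_nonneg_left hv ht
  have h3 : s * R + t * R = R := by rw [← add_mul, hst, one_mul]
  linarith

theorem add_bdiff {R : ℝ} {P W V : GridFn n m N} (hV : V ∈ Bbar A a b R P)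
    (hW : W ∈ Bbar A a b R P) : W + (bdiff hV hW).fn = V :=
  add_sub_cancel W V

theorem norm_bdiff {R : ℝ} {P W V : GridFn n m N} (hV : V ∈ Bbar A a b R P)
    (hW : W ∈ Bbar A a b R P) : ‖bdiff hV hW‖ = h1Norm A a b (V - W) :=
  H10.norm_eq _

theorem J_nonneg (K : Pt n → ℝ → ℝ → ℝ) (μs : Pt n → ℝ) (lam : ℝ) (W : GridFn n m N) :
    0 ≤ J A a b d K μs lam W :=
  Finset.sum_nonneg fun _ _ => integral_nonneg fun _ => sq_nonneg _

/-- Existence and uniqueness of the minimizer of a functional on the ball with strong convexity. -/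
theorem exists_minimizer_on_ball (hab : a < b) (hA : 0 < meshStep A m) {R : ℝ}
    {P : GridFn n m N} (hne : (Bbar A a b R P).Nonempty) {K : Pt n → ℝ → ℝ → ℝ} {μs : Pt n → ℝ}
    {lam c : ℝ} (hc : 0 < c)
    (hderiv : ∀ W ∈ Bbar A a b R P,
      HasFDerivAt (fun v : H10 n m N A a b => J A a b d K μs lam (W + v.fn))
        (dJ A a b d K μs lam W) 0)
    (hconv : ∀ (W : GridFn n m N) (hW : W ∈ Bbar A a b R P) (V : GridFn n m N)
      (hV : V ∈ Bbar A a b R P), c * ‖bdiff hV hW‖ ^ 2 ≤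
        J A a b d K μs lam V - J A a b d K μs lam W - dJ A a b d K μs lam W (bdiff hV hW)) :
    ∃ (Wmin : GridFn n m N) (hmin : Wmin ∈ Bbar A a b R P),
      IsMinOn (J A a b d K μs lam) (Bbar A a b R P) Wmin ∧
      (∀ W ∈ Bbar A a b R P, IsMinOn (J A a b d K μs lam) (Bbar A a b R P) W → W = Wmin) ∧
      ∀ (W : GridFn n m N) (hW : W ∈ Bbar A a b R P),
        0 ≤ dJ A a b d K μs lam Wmin (bdiff hW hmin) := by
  obtain ⟨W₀, hW₀⟩ := hne
  have : CompleteSpace (H10 n m N A a b) := H10.completeSpace hab hA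
  -- A fixed `W₀` in the ball identifies the ball with the set of its shifts, a closed convex subset
  -- of the Hilbert space; differences do not depend on `W₀`.
  have hbd : ∀ (u w : H10 n m N A a b) (hu : u ∈ ballShift R P W₀) (hw : w ∈ ballShift R P W₀),
      bdiff hw hu = w - u := fun u w hu hw =>
    Subtype.ext (add_sub_add_left_eq_sub w.fn u.fn W₀)
  have hder : ∀ u ∈ (ballShift R P W₀ : Set (H10 n m N A a b)),
      HasFDerivAt (fun v : H10 n m N A a b => J A a b d K μs lam (W₀ + v.fn))
        (dJ A a b d K μs lam (W₀ + u.fn)) u := by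
    intro u hu
    have h1 := hderiv _ hu
    rw [← sub_self u] at h1
    -- Differentiability is given at the origin of each base point; translation by `u` turns the
    -- base point `W₀ + u` into the point `u` over `W₀`.
    have h2 := (hasFDerivAt_comp_sub u).2 h1
    refine h2.congr_of_eventuallyEq (Filter.Eventually.of_forall fun v => ?_)
    change J A a b d K μs lam (W₀ + v.fn) = J A a b d K μs lam (W₀ + u.fn + (v - u).fn)
    rw [add_assoc, ← H10.fn_add, add_sub_cancel]
  have hne' : (ballShift R P W₀ : Set (H10 n m N A a b)).Nonempty :=
    ⟨0, (mem_ballShift hW₀).2 (by have := hW₀.2.2; rwa [← add_zero W₀] at this)⟩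
  obtain ⟨u, hu, hmin, huniq, hvar⟩ := exists_minimizer_of_stronglyConvex
    (isClosed_ballShift hW₀) (convex_ballShift hW₀) hne'
    (f := fun v : H10 n m N A a b => J A a b d K μs lam (W₀ + v.fn))
    (f' := fun v => dJ A a b d K μs lam (W₀ + v.fn)) hder (fun v _ => J_nonneg K μs lam _) hc
    (fun v hv w hw => by
      have := hconv _ hv _ hw
      rwa [hbd v w hv hw] at this)
  have hshift : ∀ (W : GridFn n m N) (hW : W ∈ Bbar A a b R P),
      bdiff hW hW₀ ∈ (ballShift R P W₀ : Set (H10 n m N A a b)) := fun W hW => by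
    rw [ballShift, mem_ofPred_eq, add_bdiff]
    exact hW
  refine ⟨W₀ + u.fn, hu, fun W hW => ?_, fun W hW hWmin => ?_, fun W hW => ?_⟩
  · have := hmin (hshift W hW)
    simpa only [mem_ofPred_eq, add_bdiff] using this
  · have h1 := huniq _ (hshift W hW) fun v hv => by
      simp only [mem_ofPred_eq, add_bdiff]
      exact hWmin hv
    rw [← h1, add_bdiff]
  · have h1 := hvar _ (hshift W hW)
    have h2 : bdiff hW hu = bdiff hW hW₀ - u := Subtype.ext (sub_add_eq_sub_sub W W₀ u.fn)
    rwa [h2]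

end

section

/-! ### Constants which do not depend on the grid -/

/-- A maximum over finitely many grids, legitimate because enlarging a constant preserves the
property. -/
theorem exists_uniform_bound {Q : ℕ → ℝ → Prop} (hmono : ∀ m x y, x ≤ y → Q m x → Q m y)
    (h : ∀ m, 0 < m → ∃ x, Q m x) (M : ℕ) : ∃ x, 1 ≤ x ∧ ∀ m, 0 < m → m ≤ M → Q m x := by
  induction M with
  | zero => exact ⟨1, le_rfl, fun m hm hm0 => absurd hm0 (not_le.2 hm)⟩
  | succ M ih =>
    obtain ⟨x, hx1, hx⟩ := ih
    obtain ⟨y, hy⟩ := h (M + 1) M.succ_pos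
    refine ⟨max x y, hx1.trans (le_max_left _ _), fun m hm hmM => ?_⟩
    rcases Nat.le_succ_iff.1 hmM with h1 | rfl
    · exact hmono m x _ (le_max_left _ _) (hx m hm h1)
    · exact hmono _ y _ (le_max_right _ _) hy

/-- Since `h = 2A / m`, a lower bound for the step is an upper bound for `m`. -/
theorem le_floor_of_le_meshStep {A h₀ : ℝ} (hh₀ : 0 < h₀) {m : ℕ} (hm : 0 < m)
    (h : h₀ ≤ meshStep A m) : m ≤ ⌊2 * A / h₀⌋₊ := by
  refine Nat.le_floor ?_
  have hm' : (0 : ℝ) < m := Nat.cast_pos.2 hm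
  rw [meshStep, le_div_iff₀ hm'] at h
  rw [le_div_iff₀ hh₀]
  linarith

variable {n m N : ℕ} [NeZero n] {A a b d : ℝ}

/-- The gradient of `J_λ`: the representative of its derivative in `H_{N,0}^{1,h}`. -/
def gradJ [CompleteSpace (H10 n m N A a b)] (d lam : ℝ) (K : Pt n → ℝ → ℝ → ℝ) (μs : Pt n → ℝ)
    (W : GridFn n m N) : H10 n m N A a b :=
  open scoped Classical in
  if hW : W ∈ H1h n m N A a b then
    (InnerProductSpace.toDual ℝ (H10 n m N A a b)).symm (gradF d lam K μs hW) else 0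

theorem gradJ_eq [CompleteSpace (H10 n m N A a b)] (d lam : ℝ) (K : Pt n → ℝ → ℝ → ℝ)
    (μs : Pt n → ℝ) {W : GridFn n m N} (hW : W ∈ H1h n m N A a b) : gradJ d lam K μs W =
      (InnerProductSpace.toDual ℝ (H10 n m N A a b)).symm (gradF d lam K μs hW) :=
  dif_pos hW

/-- The Riesz representation theorem, available because the space is complete. -/
theorem innerSL_gradJ [CompleteSpace (H10 n m N A a b)] (d lam : ℝ) (K : Pt n → ℝ → ℝ → ℝ)
    (μs : Pt n → ℝ) {W : GridFn n m N} (hW : W ∈ H1h n m N A a b) :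
    innerSL ℝ (gradJ d lam K μs W : H10 n m N A a b) = gradF d lam K μs hW := by
  ext v
  rw [gradJ_eq d lam K μs hW]
  exact InnerProductSpace.toDual_symm_apply (E := H10 n m N A a b)

theorem gradF_congr (d lam : ℝ) (K : Pt n → ℝ → ℝ → ℝ) (μs : Pt n → ℝ) {W V : GridFn n m N}
    (hW : W ∈ H1h n m N A a b) (hV : V ∈ H1h n m N A a b) (h : W = V) :
    gradF d lam K μs hW = gradF d lam K μs hV := by
  subst h
  rfl

theorem norm_bdiff_le {R : ℝ} {P W V : GridFn n m N} (hV : V ∈ Bbar A a b R P)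
    (hW : W ∈ Bbar A a b R P) : ‖bdiff hV hW‖ ≤ 2 * R := by
  have h1 := h1Norm_add_le hV.1 (Submodule.smul_mem _ (-1) hW.1)
  rw [h1Norm_smul (-1) hW.1, abs_neg, abs_one, one_mul, neg_one_smul, ← sub_eq_add_neg] at h1
  rw [norm_bdiff]
  linarith [hV.2.2, hW.2.2]

theorem norm_gradJ_sub_le [CompleteSpace (H10 n m N A a b)] {lam L R : ℝ}
    {K : Pt n → ℝ → ℝ → ℝ} {μs : Pt n → ℝ}
    (hL : ∀ (W : GridFn n m N) (hW : W ∈ H1h n m N A a b) (v : H10 n m N A a b),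
        h1Norm A a b W ≤ R → h1Norm A a b (W + v.fn) ≤ R → ‖v‖ ≤ 2 * R →
        ‖gradF d lam K μs (add_mem hW v.fn_mem) - gradF d lam K μs hW‖ ≤ L * ‖v‖)
    {P W₁ W₂ : GridFn n m N} (h₁ : W₁ ∈ Bbar A a b R P) (h₂ : W₂ ∈ Bbar A a b R P) :
    ‖(gradJ d lam K μs W₁ : H10 n m N A a b) - gradJ d lam K μs W₂‖ ≤
      L * h1Norm A a b (W₁ - W₂) := by
  rw [gradJ_eq d lam K μs h₁.1, gradJ_eq d lam K μs h₂.1, ← map_sub, LinearIsometryEquiv.norm_map,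
    ← norm_bdiff h₁ h₂, ← gradF_congr d lam K μs (add_mem h₂.1 (bdiff h₁ h₂).fn_mem) h₁.1
      (add_bdiff h₁ h₂)]
  exact hL W₂ h₂.1 _ h₂.2.2 (by rw [add_bdiff]; exact h₁.2.2) (norm_bdiff_le h₁ h₂)

/-- The Fréchet derivative of the functional and its Lipschitz continuity. -/
theorem exists_lipschitz_gradient (n N : ℕ) [NeZero n] (κ σ : ℝ) {A d a b h₀ R lam : ℝ}
    (hA : 0 < A) (hd : 0 < d) (ha : 0 < a) (hab : a < b) (hh₀ : 0 < h₀) (hR : 0 < R)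
    (hlam : 0 ≤ lam) :
    ∃ C₄ : ℝ, 0 < C₄ ∧ ∀ m : ℕ, 1 < m → h₀ ≤ meshStep A m →
      ∀ (K : Pt n → ℝ → ℝ → ℝ) (μs : Pt n → ℝ), IsMedium n A a b d κ σ K μs →
      ∀ P : GridFn n m N, ∃ G : GridFn n m N → H10 n m N A a b,
        (∀ W ∈ Bbar A a b R P,
          HasFDerivAt (fun v : H10 n m N A a b => J A a b d K μs lam (W + v.fn))
            (innerSL ℝ (G W)) 0) ∧
        ∀ W₁ ∈ Bbar A a b R P, ∀ W₂ ∈ Bbar A a b R P,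
          ‖G W₁ - G W₂‖ ≤ C₄ * h1Norm A a b (W₁ - W₂) := by
  have hS0 := supConst_nonneg a b
  obtain ⟨C, hC, hsys⟩ := exists_sysBounds n N A b κ σ hd ha
    (by positivity : 0 ≤ supConst a b * (R + 1))
  obtain ⟨L, hL1, hL⟩ := exists_uniform_bound (Q := fun m L => ∀ (K : Pt n → ℝ → ℝ → ℝ)
      (μs : Pt n → ℝ), SysBounds n N A a b d (supConst a b * (R + 1)) C K μs →
      ∀ (W : GridFn n m N) (hW : W ∈ H1h n m N A a b) (v : H10 n m N A a b),
        h1Norm A a b W ≤ R → h1Norm A a b (W + v.fn) ≤ R → ‖v‖ ≤ 2 * R →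
        ‖gradF d lam K μs (add_mem hW v.fn_mem) - gradF d lam K μs hW‖ ≤ L * ‖v‖)
    (fun m x y hxy hx K μs hS W hW v h1 h2 h3 => (hx K μs hS W hW v h1 h2 h3).trans
      (mul_le_mul_of_nonneg_right hxy (norm_nonneg v)))
    (fun m hm => (exists_lipschitz_gradF n m N hab hC.le hR.le hA hm hlam).imp fun _ h => h.2)
    ⌊2 * A / h₀⌋₊
  refine ⟨L, one_pos.trans_le hL1, fun m hm hmesh K μs hM P => ?_⟩
  have hm0 := zero_lt_one.trans hm
  have : CompleteSpace (H10 n m N A a b) := H10.completeSpace hab (meshStep_pos hA hm0)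
  refine ⟨gradJ d lam K μs, fun W hW => ?_, fun W₁ h₁ W₂ h₂ => ?_⟩
  · rw [innerSL_gradJ d lam K μs hW.1]
    exact hasFDerivAt_J (hsys K μs hM) hA hm0 hlam hC.le hab hW.1 hW.2.2
  · exact norm_gradJ_sub_le
      (hL m hm0 (le_floor_of_le_meshStep hh₀ hm0 hmesh) K μs (hsys K μs hM)) h₁ h₂

/-- The strict convexity of the functional, and its consequences for minimizers. -/
theorem exists_convexity_constants {n N : ℕ} [NeZero n] (κ : ℝ) {A d a₀ a b h₀ : ℝ}
    (hA : 0 < A) (hd : 0 < d) (hfar : IsFar n N A d a₀) (ha : a₀ ≤ a) (hab : a < b)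
    (hh₀ : 0 < h₀) :
    ∃ C₃ : ℝ, 0 < C₃ ∧ ∀ R σ : ℝ, 0 < R → ∃ lam₁ : ℝ, 1 ≤ lam₁ ∧
      ∀ m : ℕ, 1 < m → h₀ ≤ meshStep A m →
      ∀ (K : Pt n → ℝ → ℝ → ℝ) (μs : Pt n → ℝ), IsMedium n A a b d κ σ K μs →
      ∀ P : GridFn n m N, ∀ lam : ℝ, lam₁ ≤ lam →
        (∀ W ∈ Bbar A a b R P,
          HasFDerivAt (fun v : H10 n m N A a b => J A a b d K μs lam (W + v.fn))
            (dJ A a b d K μs lam W) 0) ∧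
        ∀ (W₁ : GridFn n m N) (h₁ : W₁ ∈ Bbar A a b R P)
          (W₂ : GridFn n m N) (h₂ : W₂ ∈ Bbar A a b R P),
          C₃ * Real.exp (2 * lam * a) * ‖bdiff h₂ h₁‖ ^ 2 ≤
            J A a b d K μs lam W₂ - J A a b d K μs lam W₁ -
              dJ A a b d K μs lam W₁ (bdiff h₂ h₁) := by
  have ha0 : 0 < a := by linarith [hfar.1]
  obtain ⟨c, hc, hcoer⟩ := exists_coercive_matD hd hfar ha hab
  obtain ⟨CP, hCP1, hCP⟩ := exists_uniform_bound (Q := fun m C => ∀ v : H10 n m N A a b,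
      ‖v‖ ^ 2 ≤ C * ∑ p ∈ intNodes n m, ∫ t in Ioo a b, ‖deriv (v.fn p) t‖ ^ 2)
    (fun m x y hxy hx v => (hx v).trans (mul_le_mul_of_nonneg_right hxy
      (Finset.sum_nonneg fun _ _ => integral_nonneg fun _ => sq_nonneg _)))
    (fun m hm => (H10.norm_sq_le_deriv hab (meshStep_pos hA hm)).imp fun _ h => h.2)
    ⌊2 * A / h₀⌋₊
  have hCP0 : 0 < CP := one_pos.trans_le hCP1
  -- This constant is fixed before `R` and `σ`: it comes from the coercivity of `D_N` and the
  -- Poincaré inequality alone.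
  refine ⟨c ^ 2 / (4 * CP), by positivity, fun R σ hR => ?_⟩
  have hS0 := supConst_nonneg a b
  obtain ⟨C, hC, hsys⟩ := exists_sysBounds n N A b κ σ hd ha0
    (by positivity : 0 ≤ supConst a b * (R + 1))
  -- The premise on `m` is repeated inside the property because `CP` is a Poincaré constant only for
  -- those grids; for larger `m` the property is vacuous and any value will do.
  obtain ⟨lam₁, hlam₁, hconv⟩ := exists_uniform_bound (Q := fun m lam₁ => m ≤ ⌊2 * A / h₀⌋₊ →
      ∀ (K : Pt n → ℝ → ℝ → ℝ) (μs : Pt n → ℝ),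
      SysBounds n N A a b d (supConst a b * (R + 1)) C K μs → ∀ lam : ℝ, lam₁ ≤ lam →
      ∀ (W : GridFn n m N) (hW : W ∈ H1h n m N A a b) (v : H10 n m N A a b),
        h1Norm A a b W ≤ R → h1Norm A a b (W + v.fn) ≤ R →
        c ^ 2 / (4 * CP) * Real.exp (2 * lam * a) * ‖v‖ ^ 2 ≤
          J A a b d K μs lam (W + v.fn) - J A a b d K μs lam W - gradF d lam K μs hW v)
    (fun m x y hxy hx hm K μs hS lam hlam => hx hm K μs hS lam (hxy.trans hlam))
    (fun m hm => by
      by_cases hmM : m ≤ ⌊2 * A / h₀⌋₊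
      · obtain ⟨lam₁, -, h⟩ := exists_convexity n m N hA hm hab hC.le hc hCP0 hR.le
          (fun X hX => hcoer X (Omega_subset_OmegaBar n A a b hX)) (hCP m hm hmM)
        exact ⟨lam₁, fun _ => h⟩
      · exact ⟨0, fun h => absurd h hmM⟩)
    ⌊2 * A / h₀⌋₊
  refine ⟨lam₁, hlam₁, fun m hm hmesh K μs hM P lam hlam => ?_⟩
  have hm0 := zero_lt_one.trans hm
  have hmM := le_floor_of_le_meshStep hh₀ hm0 hmesh
  have hlam0 : 0 ≤ lam := by linarith
  have hder : ∀ W (hW : W ∈ Bbar A a b R P),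
      HasFDerivAt (fun v : H10 n m N A a b => J A a b d K μs lam (W + v.fn))
        (gradF d lam K μs hW.1) 0 := fun W hW =>
    hasFDerivAt_J (hsys K μs hM) hA hm0 hlam0 hC.le hab hW.1 hW.2.2
  have hdJ : ∀ W (hW : W ∈ Bbar A a b R P),
      dJ A a b d K μs lam W = gradF d lam K μs hW.1 := fun W hW => (hder W hW).fderiv
  refine ⟨fun W hW => ?_, fun W₁ h₁ W₂ h₂ => ?_⟩
  · rw [hdJ W hW]
    exact hder W hW
  · have h := hconv m hm0 hmM hmM K μs (hsys K μs hM) lam hlam W₁ h₁.1 (bdiff h₂ h₁) h₁.2.2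
      (by rw [add_bdiff]; exact h₂.2.2)
    rwa [add_bdiff, ← hdJ W₁ h₁] at h

end

end Convexification

end

/-! ### The theorem -/

open Convexification

theorem theorem4p2 (n : ℕ) [NeZero n] (N : ℕ) (A d : ℝ) (hA : 0 < A) (hd : 0 < d) :
    -- there is a number `a₀ > 1` which makes `D_N` invertible for `a ≥ a₀`
    (∃ a₀ : ℝ, IsFar n N A d a₀) ∧
    -- the Fréchet derivative and its Lipschitz condition
    (∀ a b h₀ κ σ R lam : ℝ, 1 < a → a < b → 0 < h₀ → 0 < R → 0 ≤ lam →
      ∃ C₄ : ℝ, 0 < C₄ ∧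
        ∀ m : ℕ, 1 < m → h₀ ≤ meshStep A m →
        ∀ (K : Pt n → ℝ → ℝ → ℝ) (μs : Pt n → ℝ), IsMedium n A a b d κ σ K μs →
        ∀ P : GridFn n m N,
        ∃ G : GridFn n m N → H10 n m N A a b,
          (∀ W ∈ Bbar A a b R P,
            HasFDerivAt (fun v : H10 n m N A a b => J A a b d K μs lam (W + v.fn))
              (innerSL ℝ (G W)) 0) ∧
          ∀ W₁ ∈ Bbar A a b R P, ∀ W₂ ∈ Bbar A a b R P,
            ‖G W₁ - G W₂‖ ≤ C₄ * h1Norm A a b (W₁ - W₂)) ∧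
    -- convexity and minimization, for `a ≥ a₀`
    (∀ a₀ : ℝ, IsFar n N A d a₀ →
      ∀ a b h₀ κ : ℝ, a₀ ≤ a → a < b → 0 < h₀ →
      ∃ C₃ : ℝ, 0 < C₃ ∧
        ∀ R σ : ℝ, 0 < R →
        ∃ lam₁ : ℝ, 1 ≤ lam₁ ∧
          ∀ m : ℕ, 1 < m → h₀ ≤ meshStep A m →
          ∀ (K : Pt n → ℝ → ℝ → ℝ) (μs : Pt n → ℝ), IsMedium n A a b d κ σ K μs →
          ∀ P : GridFn n m N, ∀ lam : ℝ, lam₁ ≤ lam →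
          -- strict convexity
          (∀ (W₁ : GridFn n m N) (h₁ : W₁ ∈ Bbar A a b R P)
             (W₂ : GridFn n m N) (h₂ : W₂ ∈ Bbar A a b R P),
            J A a b d K μs lam W₂ - J A a b d K μs lam W₁
                - dJ A a b d K μs lam W₁ (bdiff h₂ h₁)
              ≥ C₃ * Real.exp (2 * lam * a) * h1Norm A a b (W₂ - W₁) ^ 2) ∧
          -- the minimizer and the variational inequality
          ((Bbar A a b R P).Nonempty →
            ∃ (Wmin : GridFn n m N) (hmin : Wmin ∈ Bbar A a b R P),
              IsMinOn (J A a b d K μs lam) (Bbar A a b R P) Wmin ∧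
              (∀ W ∈ Bbar A a b R P,
                IsMinOn (J A a b d K μs lam) (Bbar A a b R P) W → W = Wmin) ∧
              ∀ (W : GridFn n m N) (hW : W ∈ Bbar A a b R P),
                0 ≤ dJ A a b d K μs lam Wmin (bdiff hW hmin))) := by
  refine ⟨Convexification.exists_isFar n N hA hd, fun a b h₀ κ σ R lam ha hab hh₀ hR hlam =>
    Convexification.exists_lipschitz_gradient n N κ σ hA hd (one_pos.trans ha) hab hh₀ hR hlam,
    fun a₀ hfar a b h₀ κ ha hab hh₀ => ?_⟩
  obtain ⟨C₃, hC₃, h⟩ := Convexification.exists_convexity_constants κ hA hd hfar ha hab hh₀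
  refine ⟨C₃, hC₃, fun R σ hR => ?_⟩
  obtain ⟨lam₁, hlam₁, h⟩ := h R σ hR
  refine ⟨lam₁, hlam₁, fun m hm hmesh K μs hM P lam hlam => ?_⟩
  obtain ⟨hder, hconv⟩ := h m hm hmesh K μs hM P lam hlam
  refine ⟨fun W₁ h₁ W₂ h₂ => ?_, fun hne => ?_⟩
  · rw [← Convexification.norm_bdiff h₂ h₁]
    exact hconv W₁ h₁ W₂ h₂
  · exact Convexification.exists_minimizer_on_ball hab
      (Convexification.meshStep_pos hA (zero_lt_one.trans hm)) hne
      (mul_pos hC₃ (Real.exp_pos (2 * lam * a))) hder hconv
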